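/- Theorem 1.3 (sparse). Let $\theta>0$. There is a constant $C=C(\theta)>0$, depending only on $\theta$, such that the following holds. For each $n\ge 1$ let $p=p(n)$ be a positive integer with $\theta<y\le 1$, where $y=y_n:=p/n$, and let $p_n\in(0,1]$. Let $X_{jk}=X_{jk}^{(n)}$ ($1\le j\le p$, $1\le k\le n$) be independent real random variables with $$\mathbf E X_{jk}=0,\qquad \mathbf E X_{jk}^2=1,\qquad M_4=M_4^{(n)}:=\max_{j,k}\mathbf E|X_{jk}|^4<\infty ,$$ and let $\varepsilon_{jk}=\varepsilon_{jk}^{(n)}$ be independent Bernoulli variables with $\Pr\{\varepsilon_{jk}=1\}=p_n$ and $\Pr\{\varepsilon_{jk}=0\}=1-p_n$, the family $(\varepsilon_{jk})$ being independent of the family $(X_{jk})$. Put $\mathbf X^{(\varepsilon)}=\frac1{\sqrt{np_n}}(\varepsilon_{jk}X_{jk})$, a $p\times n$ matrix, let $\lambda_1^{(\varepsilon)},\dots,\lambda_p^{(\varepsilon)}$ be the eigenvalues of $\mathbf X^{(\varepsilon)}(\mathbf X^{(\varepsilon)})^T$ counted with multiplicity, and let $F_p^{(\varepsilon)}(x)=\frac1p\#\{k:\lambda_k^{(\varepsilon)}\le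 x\}$. Let $F_y$ be the distribution function of the Marchenko–Pastur law with parameter $y\in(0,1]$, whose density is $\frac{1}{2\pi xy}\sqrt{(b-x)(x-a)}$ on $[a,b]$, and zero elsewhere, with $a=(1-\sqrt y)^2$, $b=(1+\sqrt y)^2$. Assume that $np_n\to\infty$ as $n\to\infty$. Then, for every $n\ge1$, $$\sup_{x\in\mathbb R}\bigl|\mathbf E F_p^{(\varepsilon)}(x)-F_y(x)\bigr|\le C\,M_4^{1/2}\,(np_n)^{-1/2}.$$ -/

import Mathlib

open MeasureTheory ProbabilityTheory Filter
open scoped Matrix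

noncomputable section

/-- Density of the absolutely continuous part of the Marchenko-Pastur law with ratio `y`,
supported on `[a, b]` with `a = (1 - √y)²` and `b = (1 + √y)²`. -/
def mpDensity (y t : ℝ) : ℝ :=
  Set.indicator (Set.Icc ((1 - √y) ^ 2) ((1 + √y) ^ 2))
    (fun t => 1 / (2 * t * y * Real.pi) * √(((1 + √y) ^ 2 - t) * (t - (1 - √y) ^ 2))) t

/-- Distribution function of the Marchenko-Pastur law with ratio `y > 0`; for `y ≥ 1` the law
has an atom of mass `1 - y⁻¹` at the origin. -/
def mpCDF (y x : ℝ) : ℝ :=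
  (∫ t in Set.Iic x, mpDensity y t) + if 1 ≤ y ∧ 0 ≤ x then 1 - y⁻¹ else 0

/-- The Gram matrix `A Aᵀ` is symmetric. -/
theorem isHermitian_gram {p n : ℕ} (A : Matrix (Fin p) (Fin n) ℝ) : (A * Aᵀ).IsHermitian := by
  have h := Matrix.isHermitian_mul_conjTranspose_self A
  rwa [Matrix.conjTranspose_eq_transpose_of_trivial] at h

/-- Empirical distribution function of the `p` eigenvalues, counted with multiplicity, of the
symmetric `p × p` matrix `A Aᵀ`. -/
def gramESD {p n : ℕ} (A : Matrix (Fin p) (Fin n) ℝ) (x : ℝ) : ℝ :=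
  1 / (p : ℝ) *
    ∑ k : Fin p, Set.indicator (Set.Iic x) (fun _ => (1 : ℝ)) ((isHermitian_gram A).eigenvalues k)

/-- The sparse matrix with entries `ε j k * X j k / √(n q)`. -/
def sparseMatrix {p n : ℕ} (q : ℝ) (e X : Fin p → Fin n → ℝ) : Matrix (Fin p) (Fin n) ℝ :=
  Matrix.of fun j k => 1 / √((n : ℝ) * q) * (e j k * X j k)

/-- `e` is a Bernoulli random variable with success probability `q`. -/
def IsBernoulliVar {Ω : Type*} [MeasurableSpace Ω] (μ : Measure Ω) (e : Ω → ℝ) (q : ℝ) : Prop :=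
  Measurable e ∧ (∀ᵐ ω ∂μ, e ω = 0 ∨ e ω = 1) ∧ μ.real {ω | e ω = 1} = q

end

open scoped Topology

/-! Each entry of the scaled matrix has variance 1/n and fourth moment at most M/(nq)/n, so a
quadratic form of one column fluctuates around its mean with variance of order κ/n times the squared
Frobenius norm of its matrix, where κ = 8M/(nq). The target rate is √κ, and it comes from comparing
Stieltjes transforms at heights t ≥ v with v a constant times √κ.

Symmetrization. The spectral law is replaced by the law of ±√λ (`symmSqrt`). Its Stieltjes transform
at z is z times the original one at z², and the symmetrized Marchenko–Pastur law has a Lipschitz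
distribution function even when y = 1 (`symmSqrt_mpMeasure_lipschitz`). Smoothing at height v
therefore costs only O(v/y). The smoothed difference is a vertical integral of the difference of
transforms (`integral_arctan_eq_stieltjes`), so a bound K/t² for that difference contributes K/v
(`abs_cdf_sub_mpCDF_le`). With K of order κ/y and v of order √κ, both terms are of order √κ/y.

Self-consistent equation. Let t be the trace of z(N - z²)⁻¹ divided by n, τ its mean, A = z + τ and
c = (1 - y)/z. Removing one column is a rank-one perturbation, which gives an exact identity for the
average of -1/(z + qₖ), where qₖ is the form of the k-th column in the resolvent of the others
(`avg_inv_add_colForm`). Each qₖ is close to t by concentration of quadratic forms, and t is close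
to τ by the Efron–Stein inequality. All the variances carry the factor W = Im A + Im(-c), because
the Frobenius norm of the resolvent is controlled by the imaginary part of its trace. The outcome is
that A(A² - (z + c)A + 1) is at most (κ/v²) W (16 + 2|3A - (z + c)|), with v = Im z
(`norm_self_consistent_le`).

Stability. For the limit law A₀ = z + τ₀ is a root of the quadratic, which factors as (A - A₀)(A +
τ₀ - c). The imaginary part of the second factor is at least W, so W cancels and |A - A₀| = O(κ/v²)
with no loss near the spectral edges (`norm_sub_le_of_self_consistent`). This argument needs A to be
near A₀ already; a continuity argument descending from a large height supplies that
(`norm_stieltjes_sub_mp_le`). It also needs c bounded, which excludes z near 0 when y < 1. There the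
limit law has a gap, and monotonicity of distribution functions replaces the estimate. -/

/-! ### Cauchy smoothing and Stieltjes transforms -/

/-- Fubini: for fixed s the admissible τ form a half-line ending at (x - s)/v, whose mass under the
Cauchy kernel is an arctangent plus π/2. -/
theorem integral_cdf_mul_cauchy (μ : Measure ℝ) [IsProbabilityMeasure μ] {v : ℝ} (hv : 0 < v)
    (x : ℝ) :
    ∫ τ, μ.real (Set.Iic (x - v * τ)) * (1 + τ ^ 2)⁻¹
      = (∫ s, Real.arctan ((x - s) / v) ∂μ) + Real.pi / 2 := by
  have hmeas : MeasurableSet {q : ℝ × ℝ | q.2 ≤ x - v * q.1} :=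
    measurableSet_le measurable_snd (by fun_prop)
  let f : ℝ → ℝ → ℝ := fun τ s => Set.indicator {q : ℝ × ℝ | q.2 ≤ x - v * q.1}
    (fun q => (1 + q.1 ^ 2)⁻¹) (τ, s)
  have hc : Integrable (fun τ : ℝ => (1 + τ ^ 2)⁻¹) := integrable_inv_one_add_sq
  have hint : Integrable (Function.uncurry f) (volume.prod μ) := by
    have h1 : Integrable (fun q : ℝ × ℝ => (1 + q.1 ^ 2)⁻¹) (volume.prod μ) := hc.comp_fst μ
    exact h1.indicator hmeas
  have hswap := integral_integral_swap hint
  have hL : ∀ τ, ∫ s, f τ s ∂μ = μ.real (Set.Iic (x - v * τ)) * (1 + τ ^ 2)⁻¹ := by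
    intro τ
    have : (fun s => f τ s) = Set.indicator (Set.Iic (x - v * τ)) (fun _ => (1 + τ ^ 2)⁻¹) := by
      ext s; simp [f, Set.indicator]
    rw [this, integral_indicator measurableSet_Iic]; simp
  have hR : ∀ s, ∫ τ, f τ s = Real.arctan ((x - s) / v) + Real.pi / 2 := by
    intro s
    have : (fun τ => f τ s) = Set.indicator (Set.Iic ((x - s) / v)) (fun τ => (1 + τ ^ 2)⁻¹) := by
      ext τ
      have : s ≤ x - v * τ ↔ τ ≤ (x - s) / v := by
        rw [le_div_iff₀ hv]; constructor <;> intro h <;> linarith [mul_comm v τ]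
      simp only [f, Set.indicator, Set.mem_ofPred_eq, Set.mem_Iic, this]
    rw [this, integral_indicator measurableSet_Iic, integral_Iic_inv_one_add_sq]
  simp only [hL, hR] at hswap
  rw [hswap, integral_add _ (integrable_const _)]
  · simp
  · refine Integrable.of_bound (C := Real.pi / 2) ?_ (ae_of_all _ fun s => ?_)
    · exact (Real.measurable_arctan.comp (by fun_prop)).aestronglyMeasurable
    · rw [Real.norm_eq_abs, abs_le]
      exact ⟨(Real.neg_pi_div_two_lt_arctan _).le, (Real.arctan_lt_pi_div_two _).le⟩

theorem integrable_cdf_mul_cauchy (μ : Measure ℝ) [IsProbabilityMeasure μ] (x v : ℝ) :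
    Integrable fun τ : ℝ => μ.real (Set.Iic (x - v * τ)) * (1 + τ ^ 2)⁻¹ := by
  refine integrable_inv_one_add_sq.bdd_mul (c := 1) ?_ (ae_of_all _ fun τ => ?_)
  · have hm : Monotone fun t => μ.real (Set.Iic t) := fun a b hab =>
      measureReal_mono (Set.Iic_subset_Iic.2 hab)
    exact (hm.measurable.comp (by fun_prop)).aestronglyMeasurable
  · rw [Real.norm_eq_abs, abs_of_nonneg measureReal_nonneg]; exact measureReal_le_one

/-- Since arctan √3 = π/3, the kernel has mass 2π/3 on [-√3, √3] and π/3 outside. An inner mass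
above one half is what later lets the supremum Δ reappear with a factor smaller than 1. -/
theorem integral_cauchy_of_le_on {f : ℝ → ℝ} (hf : Integrable fun τ : ℝ => f τ * (1 + τ ^ 2)⁻¹)
    {c Δ : ℝ} (hlow : ∀ τ, -Δ ≤ f τ) (hmid : ∀ τ, |τ| ≤ √3 → c ≤ f τ) :
    2 * Real.pi / 3 * c - Real.pi / 3 * Δ ≤ ∫ τ, f τ * (1 + τ ^ 2)⁻¹ := by
  have hc : Integrable (fun τ : ℝ => (1 + τ ^ 2)⁻¹) := integrable_inv_one_add_sq
  have hI : ∫ τ in Set.Icc (-√3) (√3), (1 + τ ^ 2)⁻¹ = 2 * Real.pi / 3 := by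
    rw [integral_Icc_eq_integral_Ioc, ← intervalIntegral.integral_of_le
      (by linarith [Real.sqrt_nonneg 3]), integral_inv_one_add_sq, Real.arctan_neg,
      Real.arctan_sqrt_three]
    ring
  have key : ∀ τ, Set.indicator (Set.Icc (-√3) (√3)) (fun τ => (c + Δ) * (1 + τ ^ 2)⁻¹) τ
      - Δ * (1 + τ ^ 2)⁻¹ ≤ f τ * (1 + τ ^ 2)⁻¹ := by
    intro τ
    have hp : 0 < (1 + τ ^ 2)⁻¹ := by positivity
    by_cases h : τ ∈ Set.Icc (-√3) (√3)
    · rw [Set.indicator_of_mem h]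
      have := mul_le_mul_of_nonneg_right (hmid τ (abs_le.2 h)) hp.le
      linarith
    · rw [Set.indicator_of_notMem h]
      have := mul_le_mul_of_nonneg_right (hlow τ) hp.le
      linarith
  have h1 := integral_mono (((hc.const_mul (c + Δ)).indicator measurableSet_Icc).sub
    (hc.const_mul Δ)) hf key
  rw [integral_sub' ((hc.const_mul (c + Δ)).indicator measurableSet_Icc) (hc.const_mul Δ),
    integral_indicator measurableSet_Icc, integral_const_mul, integral_const_mul, hI,
    integral_univ_inv_one_add_sq] at h1
  linarith

/-- One-sided Cauchy smoothing bounds for the difference of two distribution functions. -/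
theorem cdf_sub_le_of_arctan (μ ν : Measure ℝ) [IsProbabilityMeasure μ] [IsProbabilityMeasure ν]
    {v L Δ : ℝ} (hv : 0 < v) (hL : ∀ x x', x ≤ x' →
      ν.real (Set.Iic x') - ν.real (Set.Iic x) ≤ L * (x' - x))
    (hΔ : ∀ x, |μ.real (Set.Iic x) - ν.real (Set.Iic x)| ≤ Δ) (x : ℝ) :
    μ.real (Set.Iic x) - ν.real (Set.Iic x) ≤
        3 / (2 * Real.pi) * |(∫ s, Real.arctan ((x + √3 * v - s) / v) ∂μ)
          - ∫ s, Real.arctan ((x + √3 * v - s) / v) ∂ν| + Δ / 2 + 2 * √3 * L * v ∧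
    ν.real (Set.Iic x) - μ.real (Set.Iic x) ≤
        3 / (2 * Real.pi) * |(∫ s, Real.arctan ((x - √3 * v - s) / v) ∂μ)
          - ∫ s, Real.arctan ((x - √3 * v - s) / v) ∂ν| + Δ / 2 + 2 * √3 * L * v := by
  have hLnn : 0 ≤ L := by
    have := hL 0 1 zero_le_one
    have h2 : ν.real (Set.Iic (0:ℝ)) ≤ ν.real (Set.Iic 1) :=
      measureReal_mono (Set.Iic_subset_Iic.2 zero_le_one)
    linarith
  have hmono : ∀ (ρ : Measure ℝ) [IsProbabilityMeasure ρ] {a b : ℝ}, a ≤ b →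
      ρ.real (Set.Iic a) ≤ ρ.real (Set.Iic b) := fun ρ _ a b hab =>
    measureReal_mono (Set.Iic_subset_Iic.2 hab)
  have hpi := Real.pi_pos
  have hfin : ∀ {c Φ : ℝ}, 2 * Real.pi / 3 * c - Real.pi / 3 * Δ ≤ Φ →
      c ≤ 3 / (2 * Real.pi) * |Φ| + Δ / 2 := by
    intro c Φ h
    have h2 := h.trans (le_abs_self Φ)
    have h3 := mul_le_mul_of_nonneg_left h2 (show 0 ≤ 3 / (2 * Real.pi) by positivity)
    have h4 : 3 / (2 * Real.pi) * (2 * Real.pi / 3 * c - Real.pi / 3 * Δ) = c - Δ / 2 := by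
      field_simp
    linarith
  constructor
  -- Centring at x + √3 v puts every y - vτ with |τ| ≤ √3 into [x, x + 2√3 v]. There monotonicity of
  -- μ and the Lipschitz bound for ν lose at most 2√3 L v. The other inequality uses the mirror
  -- image.
  · set y := x + √3 * v with hy
    have e : ∀ τ, (μ.real (Set.Iic (y - v * τ)) - ν.real (Set.Iic (y - v * τ))) * (1 + τ ^ 2)⁻¹
        = μ.real (Set.Iic (y - v * τ)) * (1 + τ ^ 2)⁻¹
          - ν.real (Set.Iic (y - v * τ)) * (1 + τ ^ 2)⁻¹ := fun τ => sub_mul _ _ _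
    have hm := integrable_cdf_mul_cauchy μ y v
    have hn := integrable_cdf_mul_cauchy ν y v
    have h := integral_cauchy_of_le_on (c := μ.real (Set.Iic x) - ν.real (Set.Iic x)
        - 2 * √3 * L * v) (Δ := Δ)
      (f := fun τ => μ.real (Set.Iic (y - v * τ)) - ν.real (Set.Iic (y - v * τ)))
      (by simp only [e]; exact hm.sub hn)
      (fun τ => (abs_le.1 (hΔ _)).1) ?_
    · simp only [e] at h
      rw [integral_sub hm hn, integral_cdf_mul_cauchy μ hv, integral_cdf_mul_cauchy ν hv] at h
      have := hfin h
      rw [add_sub_add_right_eq_sub] at this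
      linarith
    · intro τ hτ
      rw [abs_le] at hτ
      have h1 : x ≤ y - v * τ := by nlinarith
      have h2 : y - v * τ - x ≤ 2 * √3 * v := by nlinarith
      have := hL _ _ h1
      have h3 := hmono μ h1
      nlinarith [mul_le_mul_of_nonneg_left h2 hLnn]
  · set y := x - √3 * v with hy
    have e : ∀ τ, (ν.real (Set.Iic (y - v * τ)) - μ.real (Set.Iic (y - v * τ))) * (1 + τ ^ 2)⁻¹
        = ν.real (Set.Iic (y - v * τ)) * (1 + τ ^ 2)⁻¹
          - μ.real (Set.Iic (y - v * τ)) * (1 + τ ^ 2)⁻¹ := fun τ => sub_mul _ _ _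
    have hm := integrable_cdf_mul_cauchy μ y v
    have hn := integrable_cdf_mul_cauchy ν y v
    have h := integral_cauchy_of_le_on (c := ν.real (Set.Iic x) - μ.real (Set.Iic x)
        - 2 * √3 * L * v) (Δ := Δ)
      (f := fun τ => ν.real (Set.Iic (y - v * τ)) - μ.real (Set.Iic (y - v * τ)))
      (by simp only [e]; exact hn.sub hm)
      (fun τ => by linarith [(abs_le.1 (hΔ (y - v * τ))).2]) ?_
    · simp only [e] at h
      rw [integral_sub hn hm, integral_cdf_mul_cauchy μ hv, integral_cdf_mul_cauchy ν hv] at h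
      have := hfin h
      rw [add_sub_add_right_eq_sub, abs_sub_comm] at this
      linarith
    · intro τ hτ
      rw [abs_le] at hτ
      have h1 : y - v * τ ≤ x := by nlinarith
      have h2 : x - (y - v * τ) ≤ 2 * √3 * v := by nlinarith
      have := hL _ _ h1
      have h3 := hmono μ h1
      nlinarith [mul_le_mul_of_nonneg_left h2 hLnn]

theorem re_inv_sub_add_mul_I (s x t : ℝ) :
    (((s : ℂ) - (x + t * Complex.I))⁻¹).re = (s - x) / ((s - x) ^ 2 + t ^ 2) := by
  rw [Complex.inv_re, Complex.normSq_apply]; simp; ring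

theorem hasDerivAt_arctan_div (w : ℝ) {t : ℝ} (ht : 0 < t) :
    HasDerivAt (fun t => Real.arctan (w / t)) (-w / (w ^ 2 + t ^ 2)) t := by
  have h := ((hasDerivAt_inv ht.ne').const_mul w).arctan
  simp only [← div_eq_mul_inv] at h
  convert h using 1
  have : 0 < w ^ 2 + t ^ 2 := by positivity
  field_simp
  ring

theorem tendsto_arctan_div_atTop (w : ℝ) :
    Tendsto (fun t => Real.arctan (w / t)) atTop (nhds 0) := by
  have := (Real.continuous_arctan.tendsto 0).comp (tendsto_const_nhds (x := w).div_atTop tendsto_id)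
  rwa [Real.arctan_zero] at this

theorem integrableOn_Ioi_div_sq_add_sq (w : ℝ) {v : ℝ} (hv : 0 < v) :
    IntegrableOn (fun t => w / (w ^ 2 + t ^ 2)) (Set.Ioi v) ∧
      ∫ t in Set.Ioi v, w / (w ^ 2 + t ^ 2) = Real.arctan (w / v) := by
  have hd : ∀ t ∈ Set.Ici v, HasDerivAt (fun t => -Real.arctan (w / t)) (w / (w ^ 2 + t ^ 2)) t := by
    intro t ht
    exact (hasDerivAt_arctan_div w (hv.trans_le ht)).fun_neg.congr_deriv (by ring)
  have hlim : Tendsto (fun t => -Real.arctan (w / t)) atTop (nhds 0) := by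
    simpa using (tendsto_arctan_div_atTop w).neg
  have hint : IntegrableOn (fun t => w / (w ^ 2 + t ^ 2)) (Set.Ioi v) := by
    rcases le_total 0 w with hw | hw
    · exact integrableOn_Ioi_deriv_of_nonneg' hd (fun t _ => by positivity) hlim
    · exact integrableOn_Ioi_deriv_of_nonpos' hd
        (fun t _ => div_nonpos_of_nonpos_of_nonneg hw (by positivity)) hlim
  refine ⟨hint, ?_⟩
  rw [integral_Ioi_of_hasDerivAt_of_tendsto' hd hint hlim]; ring

/-- The arctangent transform of a probability measure is an integral of its Stieltjes transform
along a vertical half-line. -/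
theorem integral_arctan_eq_stieltjes (μ : Measure ℝ) [IsProbabilityMeasure μ] {v : ℝ} (hv : 0 < v)
    (x : ℝ) :
    IntegrableOn (fun t : ℝ => (∫ s : ℝ, ((s : ℂ) - (x + t * Complex.I))⁻¹ ∂μ).re) (Set.Ioi v) ∧
    ∫ s, Real.arctan ((x - s) / v) ∂μ
      = -∫ t in Set.Ioi v, (∫ s : ℝ, ((s : ℂ) - (x + t * Complex.I))⁻¹ ∂μ).re := by
  have hre : ∀ t ∈ Set.Ioi v, (∫ s : ℝ, ((s : ℂ) - (x + t * Complex.I))⁻¹ ∂μ).re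
      = ∫ s, (s - x) / ((s - x) ^ 2 + t ^ 2) ∂μ := by
    intro t ht
    have ht0 : 0 < t := hv.trans ht
    have hi : Integrable (fun s : ℝ => ((s : ℂ) - (x + t * Complex.I))⁻¹) μ := by
      refine Integrable.of_bound (C := t⁻¹) (by fun_prop) (ae_of_all _ fun s => ?_)
      rw [norm_inv]
      refine inv_anti₀ ht0 ?_
      have := Complex.abs_im_le_norm ((s : ℂ) - (x + t * Complex.I))
      simpa [abs_of_pos ht0] using this
    have := integral_re hi
    simp only [RCLike.re_to_complex, re_inv_sub_add_mul_I] at this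
    exact this.symm
  let f : ℝ → ℝ → ℝ := fun s t => (s - x) / ((s - x) ^ 2 + t ^ 2)
  have hfm : Measurable (Function.uncurry f) := by
    unfold f; fun_prop
  have hint : Integrable (Function.uncurry f) (μ.prod (volume.restrict (Set.Ioi v))) := by
    rw [integrable_prod_iff hfm.aestronglyMeasurable]
    refine ⟨ae_of_all _ fun s => (integrableOn_Ioi_div_sq_add_sq (s - x) hv).1, ?_⟩
    refine Integrable.of_bound (C := Real.pi / 2)
      hfm.stronglyMeasurable.norm.integral_prod_right'.aestronglyMeasurable
      (ae_of_all _ fun s => ?_)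
    have : ∀ t, ‖Function.uncurry f (s, t)‖ = |s - x| / (|s - x| ^ 2 + t ^ 2) := by
      intro t
      simp only [f, Function.uncurry, Real.norm_eq_abs, abs_div, sq_abs]
      rw [abs_of_nonneg (a := (s - x) ^ 2 + t ^ 2) (by positivity)]
    simp only [this]
    rw [(integrableOn_Ioi_div_sq_add_sq |s - x| hv).2, Real.norm_eq_abs, abs_le]
    exact ⟨(Real.neg_pi_div_two_lt_arctan _).le, (Real.arctan_lt_pi_div_two _).le⟩
  have hsw := integral_integral_swap hint
  constructor
  · refine IntegrableOn.congr_fun ?_ (fun t ht => (hre t ht).symm) measurableSet_Ioi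
    exact hint.integral_prod_right
  · rw [setIntegral_congr_fun measurableSet_Ioi hre]
    simp only [f] at hsw
    rw [← hsw, ← integral_neg]
    congr 1; ext s
    rw [(integrableOn_Ioi_div_sq_add_sq (s - x) hv).2, ← Real.arctan_neg]
    congr 1; ring

/-- Quadratic decay in the height makes the difference integrable over the whole half-line, with ∫
K/t² = K/v. No separate treatment of large heights is then needed. -/
theorem abs_integral_arctan_sub_le (μ ν : Measure ℝ) [IsProbabilityMeasure μ]
    [IsProbabilityMeasure ν] {v K : ℝ} (hv : 0 < v) (x : ℝ)
    (h : ∀ t : ℝ, v ≤ t → ‖(∫ s : ℝ, ((s : ℂ) - (x + t * Complex.I))⁻¹ ∂μ)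
      - ∫ s : ℝ, ((s : ℂ) - (x + t * Complex.I))⁻¹ ∂ν‖ ≤ K / t ^ 2) :
    |(∫ s, Real.arctan ((x - s) / v) ∂μ) - ∫ s, Real.arctan ((x - s) / v) ∂ν| ≤ K / v := by
  obtain ⟨i1, e1⟩ := integral_arctan_eq_stieltjes μ hv x
  obtain ⟨i2, e2⟩ := integral_arctan_eq_stieltjes ν hv x
  rw [e1, e2, neg_sub_neg, abs_sub_comm, ← integral_sub i1 i2]
  have hpow : IntegrableOn (fun t : ℝ => K / t ^ 2) (Set.Ioi v) := by
    have : IntegrableOn (fun t : ℝ => K * t ^ (-2 : ℝ)) (Set.Ioi v) :=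
      (integrableOn_Ioi_rpow_of_lt (a := -2) (by norm_num) hv).const_mul K
    refine this.congr_fun (fun t ht => ?_) measurableSet_Ioi
    have ht0 : (0:ℝ) < t := hv.trans ht
    simp only [Real.rpow_neg ht0.le]
    norm_num [div_eq_mul_inv]
  have hval : ∫ t in Set.Ioi v, K / t ^ 2 = K / v := by
    have h1 := integral_Ioi_rpow_of_lt (a := -2) (by norm_num) hv
    have h2 : ∀ t ∈ Set.Ioi v, K / t ^ 2 = K * t ^ (-2 : ℝ) := by
      intro t ht
      have ht0 : (0:ℝ) < t := hv.trans ht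
      simp only [Real.rpow_neg ht0.le]
      norm_num [div_eq_mul_inv]
    rw [setIntegral_congr_fun measurableSet_Ioi h2, integral_const_mul, h1]
    norm_num [Real.rpow_neg hv.le, div_eq_mul_inv]
  rw [← hval, ← Real.norm_eq_abs]
  refine norm_integral_le_of_norm_le hpow ?_
  refine (ae_restrict_iff' measurableSet_Ioi).2 (ae_of_all _ fun t ht => ?_)
  refine le_trans ?_ (h t (le_of_lt ht))
  rw [Real.norm_eq_abs, ← Complex.sub_re]
  exact Complex.abs_re_le_norm _

/-! ### The Marchenko–Pastur law and its Stieltjes transform -/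

theorem one_sub_two_mul_cos_add_sq (ζ : ℂ) (φ : ℝ) :
    1 - 2 * ζ * (Real.cos φ : ℂ) + ζ ^ 2
      = (1 - ζ * Complex.exp (φ * Complex.I)) * (1 - ζ * Complex.exp (-(φ * Complex.I))) := by
  have h : Complex.exp (φ * Complex.I) * Complex.exp (-(φ * Complex.I)) = 1 := by
    rw [← Complex.exp_add]; simp
  have hc : 2 * (Real.cos φ : ℂ) = Complex.exp (φ * Complex.I) + Complex.exp (-(φ * Complex.I)) := by
    rw [Complex.ofReal_cos, Complex.two_cos, neg_mul]
  linear_combination -ζ * hc - ζ ^ 2 * h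

theorem sq_one_sub_norm_le (ζ : ℂ) (hζ : ‖ζ‖ < 1) (φ : ℝ) :
    (1 - ‖ζ‖) ^ 2 ≤ ‖1 - 2 * ζ * (Real.cos φ : ℂ) + ζ ^ 2‖ := by
  rw [one_sub_two_mul_cos_add_sq, norm_mul, sq]
  have key : ∀ e : ℂ, ‖e‖ = 1 → 1 - ‖ζ‖ ≤ ‖1 - ζ * e‖ := by
    intro e he
    have := norm_sub_norm_le (1 : ℂ) (ζ * e)
    rwa [norm_mul, he, mul_one, norm_one] at this
  refine mul_le_mul (key _ (Complex.norm_exp_ofReal_mul_I φ)) (key _ ?_) (by linarith) (norm_nonneg _)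
  have := Complex.norm_exp_ofReal_mul_I (-φ)
  simpa using this

/-- Truncated generating function of the Chebyshev polynomials of the second kind, U_k(cos φ) sin φ
= sin((k + 1)φ). The last two terms are the remainder, geometrically small for |ζ| < 1. -/
theorem mul_sum_pow_mul_sin (ζ : ℂ) (φ : ℝ) (N : ℕ) :
    (1 - 2 * ζ * (Real.cos φ : ℂ) + ζ ^ 2) *
        ∑ k ∈ Finset.range N, ζ ^ k * (Real.sin ((k + 1) * φ) : ℂ)
      = (Real.sin φ : ℂ) - ζ ^ N * (Real.sin ((N + 1) * φ) : ℂ)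
        + ζ ^ (N + 1) * (Real.sin (N * φ) : ℂ) := by
  induction N with
  | zero => simp
  | succ N ih =>
    rw [Finset.sum_range_succ, mul_add, ih]
    have h : Real.sin ((N + 1 + 1) * φ) + Real.sin (N * φ)
        = 2 * Real.cos φ * Real.sin ((N + 1) * φ) := by
      rw [show ((N : ℝ) + 1 + 1) * φ = (N + 1) * φ + φ by ring,
        show (N : ℝ) * φ = (N + 1) * φ - φ by ring, Real.sin_add, Real.sin_sub]
      ring
    have h' : (Real.sin ((N + 1 + 1) * φ) : ℂ) + (Real.sin (N * φ) : ℂ)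
        = 2 * (Real.cos φ : ℂ) * (Real.sin ((N + 1) * φ) : ℂ) := by exact_mod_cast h
    push_cast at h' ⊢
    linear_combination (ζ ^ (N + 1)) * h'

theorem integral_cos_nat_mul (k : ℕ) (hk : k ≠ 0) :
    ∫ φ in (0 : ℝ)..Real.pi, Real.cos (k * φ) = 0 := by
  have hk' : (k : ℝ) ≠ 0 := Nat.cast_ne_zero.2 hk
  rw [intervalIntegral.integral_comp_mul_left (fun x => Real.cos x) hk', integral_cos]
  simp [Real.sin_nat_mul_pi]

theorem integral_sin_mul_sin_nat (k : ℕ) :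
    ∫ φ in (0 : ℝ)..Real.pi, Real.sin φ * Real.sin ((k + 1) * φ)
      = if k = 0 then Real.pi / 2 else 0 := by
  have h : ∀ φ : ℝ, Real.sin φ * Real.sin ((k + 1) * φ)
      = 2⁻¹ * (Real.cos (k * φ) - Real.cos ((k + 2 : ℕ) * φ)) := by
    intro φ
    push_cast
    rw [show (k : ℝ) * φ = (k + 1) * φ - φ by ring,
      show ((k : ℝ) + 2) * φ = (k + 1) * φ + φ by ring, Real.cos_sub, Real.cos_add]
    ring
  simp only [h]
  rw [intervalIntegral.integral_const_mul, intervalIntegral.integral_sub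
    (Continuous.intervalIntegrable (by fun_prop) _ _)
    (Continuous.intervalIntegrable (by fun_prop) _ _), integral_cos_nat_mul (k + 2) (by omega)]
  split_ifs with h0
  · subst h0; simp; ring
  · rw [integral_cos_nat_mul k h0]; simp

theorem integral_sin_mul_sum (ζ : ℂ) (N : ℕ) :
    ∫ φ in (0 : ℝ)..Real.pi, (Real.sin φ : ℂ) *
      ∑ k ∈ Finset.range (N + 1), ζ ^ k * (Real.sin ((k + 1) * φ) : ℂ) = (Real.pi : ℂ) / 2 := by
  have h : ∀ φ : ℝ, (Real.sin φ : ℂ) *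
      ∑ k ∈ Finset.range (N + 1), ζ ^ k * (Real.sin ((k + 1) * φ) : ℂ)
      = ∑ k ∈ Finset.range (N + 1), ζ ^ k * ((Real.sin φ * Real.sin ((k + 1) * φ) : ℝ) : ℂ) := by
    intro φ
    rw [Finset.mul_sum]
    refine Finset.sum_congr rfl fun k _ => ?_
    push_cast; ring
  simp only [h]
  rw [intervalIntegral.integral_finsetSum
    (fun k _ => Continuous.intervalIntegrable (by fun_prop) _ _)]
  simp only [intervalIntegral.integral_const_mul, intervalIntegral.integral_ofReal,
    integral_sin_mul_sin_nat]
  rw [Finset.sum_eq_single 0]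
  · simp
  · intro k _ hk; simp [hk]
  · simp

/-- Expand in the Chebyshev series and use orthogonality of sines: only the term k = 0 survives, so
the value does not depend on ζ. The remainder is uniformly geometric in N. -/
theorem integral_sin_sq_div (ζ : ℂ) (hζ : ‖ζ‖ < 1) :
    ∫ φ in (0 : ℝ)..Real.pi, (Real.sin φ : ℂ) ^ 2 / (1 - 2 * ζ * (Real.cos φ : ℂ) + ζ ^ 2)
      = (Real.pi : ℂ) / 2 := by
  set D : ℝ → ℂ := fun φ => 1 - 2 * ζ * (Real.cos φ : ℂ) + ζ ^ 2 with hD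
  have hpos : 0 < (1 - ‖ζ‖) ^ 2 := by have : 0 < 1 - ‖ζ‖ := by linarith
                                      positivity
  have hlow : ∀ φ, (1 - ‖ζ‖) ^ 2 ≤ ‖D φ‖ := fun φ => sq_one_sub_norm_le ζ hζ φ
  have hne : ∀ φ, D φ ≠ 0 := fun φ => norm_pos_iff.1 (hpos.trans_le (hlow φ))
  have hDc : Continuous D := by unfold D; fun_prop
  set E := ∫ φ in (0 : ℝ)..Real.pi, (Real.sin φ : ℂ) ^ 2 / D φ
  have bound : ∀ N : ℕ, ‖E - (Real.pi : ℂ) / 2‖ ≤ 2 * ‖ζ‖ ^ (N + 1) / (1 - ‖ζ‖) ^ 2 * Real.pi := by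
    intro N
    have hS : Continuous fun φ : ℝ => (Real.sin φ : ℂ) *
        ∑ k ∈ Finset.range (N + 1), ζ ^ k * (Real.sin ((k + 1) * φ) : ℂ) := by fun_prop
    have hQ : Continuous fun φ : ℝ => (Real.sin φ : ℂ) ^ 2 / D φ :=
      Continuous.div (by fun_prop) hDc hne
    rw [← integral_sin_mul_sum ζ N, ← intervalIntegral.integral_sub (hQ.intervalIntegrable _ _)
      (hS.intervalIntegrable _ _)]
    have := intervalIntegral.norm_integral_le_of_norm_le_const (a := 0) (b := Real.pi)
      (f := fun φ => (Real.sin φ : ℂ) ^ 2 / D φ - (Real.sin φ : ℂ) *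
        ∑ k ∈ Finset.range (N + 1), ζ ^ k * (Real.sin ((k + 1) * φ) : ℂ))
      (C := 2 * ‖ζ‖ ^ (N + 1) / (1 - ‖ζ‖) ^ 2) ?_
    · simpa [abs_of_pos Real.pi_pos] using this
    intro φ _
    have e := mul_sum_pow_mul_sin ζ φ (N + 1)
    have e2 : (Real.sin φ : ℂ) ^ 2 / D φ - (Real.sin φ : ℂ) *
        ∑ k ∈ Finset.range (N + 1), ζ ^ k * (Real.sin ((k + 1) * φ) : ℂ)
        = (Real.sin φ : ℂ) * (ζ ^ (N + 1) * (Real.sin (((N + 1 : ℕ) + 1) * φ) : ℂ)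
        - ζ ^ (N + 1 + 1) * (Real.sin ((N + 1 : ℕ) * φ) : ℂ)) / D φ := by
      rw [eq_div_iff (hne φ), sub_mul, div_mul_cancel₀ _ (hne φ)]
      linear_combination -(Real.sin φ : ℂ) * e
    have hs : ∀ x : ℝ, ‖(Real.sin x : ℂ)‖ ≤ 1 := fun x => by
      rw [Complex.norm_real]; exact Real.abs_sin_le_one x
    rw [e2, norm_div]
    refine div_le_div₀ (by positivity) ?_ hpos (hlow φ)
    rw [norm_mul]
    have h1 : ‖ζ ^ (N + 1) * (Real.sin (((N + 1 : ℕ) + 1) * φ) : ℂ)‖ ≤ ‖ζ‖ ^ (N + 1) := by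
      rw [norm_mul, norm_pow]
      exact mul_le_of_le_one_right (by positivity) (hs _)
    have h2 : ‖ζ ^ (N + 1 + 1) * (Real.sin ((N + 1 : ℕ) * φ) : ℂ)‖ ≤ ‖ζ‖ ^ (N + 1) := by
      rw [norm_mul, norm_pow]
      refine (mul_le_of_le_one_right (by positivity) (hs _)).trans ?_
      exact pow_le_pow_of_le_one (norm_nonneg _) hζ.le (by omega)
    refine (mul_le_of_le_one_left (norm_nonneg _) (hs _)).trans ?_
    refine (norm_sub_le _ _).trans ?_
    linarith
  have hlim : Tendsto (fun N : ℕ => 2 * ‖ζ‖ ^ (N + 1) / (1 - ‖ζ‖) ^ 2 * Real.pi) atTop (nhds 0) := by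
    have h0 := (tendsto_add_atTop_iff_nat 1).2
      (tendsto_pow_atTop_nhds_zero_of_lt_one (norm_nonneg ζ) hζ)
    have := ((h0.const_mul 2).div_const ((1 - ‖ζ‖) ^ 2)).mul_const Real.pi
    simpa using this
  have := ge_of_tendsto' hlim bound
  exact sub_eq_zero.1 (norm_le_zero_iff.1 this)

theorem one_add_two_mul_cos_pos {r : ℝ} (hr0 : 0 < r) {φ : ℝ}
    (hφ : φ ∈ Set.Ioo 0 Real.pi) : 0 < 1 + r ^ 2 + 2 * r * Real.cos φ := by
  have hs := Real.sin_pos_of_mem_Ioo hφ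
  have hc := Real.sin_sq_add_cos_sq φ
  have : -1 < Real.cos φ := by nlinarith [Real.neg_one_le_cos φ]
  nlinarith [sq_nonneg (1 - r)]

/-- The case ζ = -r of the previous integral. At r = 1 the series argument fails, but there the
integrand is (1 - cos φ)/2. -/
theorem integral_sin_sq_div_real {r : ℝ} (hr0 : 0 < r) (hr1 : r ≤ 1) :
    ∫ φ in Set.Ioo 0 Real.pi, (Real.sin φ : ℂ) ^ 2 / (1 + r ^ 2 + 2 * r * Real.cos φ : ℝ)
      = (Real.pi : ℂ) / 2 := by
  rw [← integral_Ioc_eq_integral_Ioo, ← intervalIntegral.integral_of_le Real.pi_pos.le]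
  rcases hr1.lt_or_eq with h | h
  · rw [← integral_sin_sq_div (-r : ℂ) (by simpa [abs_of_pos hr0] using h)]
    congr 1; ext φ; congr 1; push_cast; ring
  · subst h
    have e : ∀ φ ∈ Set.Ioo 0 Real.pi,
        (Real.sin φ : ℂ) ^ 2 / (1 + 1 ^ 2 + 2 * 1 * Real.cos φ : ℝ)
        = ((2⁻¹ * (1 - Real.cos φ) : ℝ) : ℂ) := by
      intro φ hφ
      have := one_add_two_mul_cos_pos one_pos hφ
      rw [← Complex.ofReal_pow, ← Complex.ofReal_div, Complex.ofReal_inj, div_eq_iff this.ne']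
      nlinarith [Real.sin_sq_add_cos_sq φ]
    rw [intervalIntegral.integral_of_le Real.pi_pos.le, integral_Ioc_eq_integral_Ioo,
      setIntegral_congr_fun measurableSet_Ioo e, ← integral_Ioc_eq_integral_Ioo,
      ← intervalIntegral.integral_of_le Real.pi_pos.le, intervalIntegral.integral_ofReal,
      intervalIntegral.integral_const_mul, intervalIntegral.integral_sub
        (Continuous.intervalIntegrable (by fun_prop) _ _)
        (Continuous.intervalIntegrable (by fun_prop) _ _), integral_cos]
    simp; ring

theorem mpDensity_nonneg {y : ℝ} (hy : 0 < y) (t : ℝ) : 0 ≤ mpDensity y t := by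
  unfold mpDensity
  refine Set.indicator_nonneg (fun t ht => ?_) t
  have : 0 ≤ t := (sq_nonneg _).trans ht.1
  have := Real.pi_pos
  positivity

theorem measurable_mpDensity (y : ℝ) : Measurable (mpDensity y) := by
  unfold mpDensity
  exact Measurable.indicator (by fun_prop) measurableSet_Icc

theorem mpDensity_of_notMem {y t : ℝ}
    (ht : t ∉ Set.Icc ((1 - √y) ^ 2) ((1 + √y) ^ 2)) : mpDensity y t = 0 := by
  unfold mpDensity; exact Set.indicator_of_notMem ht _

/-- Both b ≤ 4 and t - a ≤ t hold, so the square root is at most 2√t. The t^(-1/2) bound persists at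
y = 1, and the substitution t = s² turns it into a bounded density. -/
theorem mpDensity_le {y : ℝ} (hy0 : 0 < y) (hy1 : y ≤ 1) {t : ℝ} (ht : 0 < t) :
    mpDensity y t ≤ 1 / (2 * y) * t ^ (-(1 / 2) : ℝ) := by
  have hnn : 0 ≤ 1 / (2 * y) * t ^ (-(1 / 2) : ℝ) := by positivity
  unfold mpDensity
  by_cases hm : t ∈ Set.Icc ((1 - √y) ^ 2) ((1 + √y) ^ 2)
  · rw [Set.indicator_of_mem hm]
    have hr : √y ≤ 1 := Real.sqrt_le_one.2 hy1
    have h1 : √(((1 + √y) ^ 2 - t) * (t - (1 - √y) ^ 2)) ≤ 2 * √t := by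
      rw [Real.sqrt_le_left (by positivity), mul_pow, Real.sq_sqrt ht.le]
      have : (1 + √y) ^ 2 - t ≤ 4 := by nlinarith [Real.sqrt_nonneg y]
      have h2 : 0 ≤ t - (1 - √y) ^ 2 := sub_nonneg.2 hm.1
      have h3 : t - (1 - √y) ^ 2 ≤ t := by nlinarith [sq_nonneg (1 - √y)]
      nlinarith
    have e : t ^ (-(1 / 2) : ℝ) = (√t)⁻¹ := by rw [Real.rpow_neg ht.le, ← Real.sqrt_eq_rpow]
    have hst : 0 < √t := Real.sqrt_pos.2 ht
    have hp := Real.pi_gt_three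
    calc 1 / (2 * t * y * Real.pi) * √(((1 + √y) ^ 2 - t) * (t - (1 - √y) ^ 2))
        ≤ 1 / (2 * t * y * Real.pi) * (2 * √t) := by gcongr
      _ = 1 / (y * Real.pi) * (√t)⁻¹ := by
        nth_rw 1 [← Real.sq_sqrt ht.le]; field_simp
      _ ≤ 1 / (2 * y) * t ^ (-(1 / 2) : ℝ) := by
        rw [e, mul_comm 2 y]; gcongr; linarith
  · rw [Set.indicator_of_notMem hm]; exact hnn

theorem integrable_mpDensity {y : ℝ} (hy0 : 0 < y) (hy1 : y ≤ 1) : Integrable (mpDensity y) := by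
  have hb : IntegrableOn (fun t : ℝ => 1 / (2 * y) * t ^ (-(1 / 2) : ℝ)) (Set.Ioc 0 ((1 + √y) ^ 2)) :=
    ((intervalIntegral.intervalIntegrable_rpow' (by norm_num)).1).const_mul _
  have h1 : IntegrableOn (mpDensity y) (Set.Ioc 0 ((1 + √y) ^ 2)) := by
    refine Integrable.mono' hb (measurable_mpDensity y).aestronglyMeasurable ?_
    refine (ae_restrict_iff' measurableSet_Ioc).2 (ae_of_all _ fun t ht => ?_)
    rw [Real.norm_eq_abs, abs_of_nonneg (mpDensity_nonneg hy0 t)]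
    exact mpDensity_le hy0 hy1 ht.1
  have h2 : IntegrableOn (mpDensity y) (Set.Ici 0) := by
    rw [integrableOn_Ici_iff_integrableOn_Ioi]
    have : Set.Ioi (0:ℝ) = Set.Ioc 0 ((1 + √y) ^ 2) ∪ Set.Ioi ((1 + √y) ^ 2) :=
      (Set.Ioc_union_Ioi_eq_Ioi (by positivity)).symm
    rw [this]
    refine h1.union ?_
    refine (integrableOn_zero).congr_fun (fun t ht => ?_) measurableSet_Ioi
    rw [mpDensity_of_notMem (fun h => absurd h.2 (not_le.2 ht))]
  refine (integrableOn_iff_integrable_of_support_subset ?_).1 h2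
  intro t ht
  by_contra h
  exact ht (mpDensity_of_notMem fun hm => h ((sq_nonneg _).trans hm.1))

/-- Integrals against the Marchenko-Pastur density in the angular variable. -/
theorem integral_mpDensity_mul {y : ℝ} (hy0 : 0 < y) (hy1 : y ≤ 1) (g : ℝ → ℂ) :
    ∫ t, (mpDensity y t : ℂ) * g t
      = ∫ φ in Set.Ioo 0 Real.pi, ((2 / Real.pi * Real.sin φ ^ 2 /
          (1 + √y ^ 2 + 2 * √y * Real.cos φ) : ℝ) : ℂ) * g (1 + √y ^ 2 + 2 * √y * Real.cos φ) := by
  set r := √y with hr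
  have hr0 : 0 < r := Real.sqrt_pos.2 hy0
  have hr1 : r ≤ 1 := Real.sqrt_le_one.2 hy1
  have hry : r ^ 2 = y := Real.sq_sqrt hy0.le
  -- With this substitution (b - t)(t - a) = (2r sin φ)², and the Jacobian supplies a second factor
  -- 2r sin φ.
  set T : ℝ → ℝ := fun φ => 1 + r ^ 2 + 2 * r * Real.cos φ with hT
  have hderiv : ∀ φ ∈ Set.Ioo 0 Real.pi,
      HasDerivWithinAt T (-(2 * r * Real.sin φ)) (Set.Ioo 0 Real.pi) φ := by
    intro φ _
    have := ((Real.hasDerivAt_cos φ).const_mul (2 * r)).const_add (1 + r ^ 2)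
    exact (this.congr_deriv (by ring)).hasDerivWithinAt
  have hinj : Set.InjOn T (Set.Ioo 0 Real.pi) := by
    intro a ha b hb hab
    have : Real.cos a = Real.cos b := by
      simp only [hT] at hab
      have h2 : 2 * r * Real.cos a = 2 * r * Real.cos b := by linarith
      exact mul_left_cancel₀ (by positivity) h2
    exact Real.injOn_cos (Set.Ioo_subset_Icc_self ha) (Set.Ioo_subset_Icc_self hb) this
  have himg : T '' Set.Ioo 0 Real.pi = Set.Ioo ((1 - r) ^ 2) ((1 + r) ^ 2) := by
    ext t
    constructor
    · rintro ⟨φ, hφ, rfl⟩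
      have hs := Real.sin_pos_of_mem_Ioo hφ
      have hc := Real.sin_sq_add_cos_sq φ
      have h1 : -1 < Real.cos φ := by nlinarith [Real.neg_one_le_cos φ]
      have h2 : Real.cos φ < 1 := by nlinarith [Real.cos_le_one φ]
      constructor <;> simp only [hT] <;> nlinarith
    · rintro ⟨h1, h2⟩
      have hlo : -1 < (t - 1 - r ^ 2) / (2 * r) := by
        rw [lt_div_iff₀ (by positivity)]; nlinarith
      have hhi : (t - 1 - r ^ 2) / (2 * r) < 1 := by
        rw [div_lt_iff₀ (by positivity)]; nlinarith
      refine ⟨Real.arccos ((t - 1 - r ^ 2) / (2 * r)), ⟨?_, ?_⟩, ?_⟩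
      · exact Real.arccos_pos.2 hhi
      · refine lt_of_le_of_ne (Real.arccos_le_pi _) fun h => ?_
        exact absurd (Real.arccos_eq_pi.1 h) (not_le.2 hlo)
      · simp only [hT]
        rw [Real.cos_arccos hlo.le hhi.le]; field_simp; ring
  have hset : ∫ t, (mpDensity y t : ℂ) * g t
      = ∫ t in Set.Ioo ((1 - r) ^ 2) ((1 + r) ^ 2), (mpDensity y t : ℂ) * g t := by
    rw [← integral_Icc_eq_integral_Ioo, setIntegral_eq_integral_of_forall_compl_eq_zero]
    intro t ht
    rw [mpDensity_of_notMem ht]; simp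
  rw [hset, ← himg, integral_image_eq_integral_abs_deriv_smul measurableSet_Ioo hderiv hinj]
  refine setIntegral_congr_fun measurableSet_Ioo fun φ hφ => ?_
  have hs := Real.sin_pos_of_mem_Ioo hφ
  have hTpos := one_add_two_mul_cos_pos hr0 hφ
  have hmem : T φ ∈ Set.Icc ((1 - √y) ^ 2) ((1 + √y) ^ 2) :=
    Set.Ioo_subset_Icc_self (himg ▸ Set.mem_image_of_mem T hφ)
  have hval : mpDensity y (T φ) = 1 / (2 * T φ * y * Real.pi) * (2 * r * Real.sin φ) := by
    unfold mpDensity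
    rw [Set.indicator_of_mem hmem]
    congr 1
    rw [← hr, Real.sqrt_eq_iff_mul_self_eq (by
      have h1 := hmem.1; have h2 := hmem.2
      rw [← hr] at h1 h2
      exact mul_nonneg (by linarith) (by linarith)) (by positivity)]
    simp only [hT]
    have := Real.sin_sq_add_cos_sq φ
    nlinarith
  rw [hval, abs_neg, abs_of_pos (by positivity), Complex.real_smul, ← mul_assoc,
    ← Complex.ofReal_mul]
  congr 2
  change _ = 2 / Real.pi * Real.sin φ ^ 2 / T φ
  rw [← hry]
  have := Real.pi_pos
  have h3 : T φ ≠ 0 := hTpos.ne'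
  field_simp

theorem integral_mpDensity {y : ℝ} (hy0 : 0 < y) (hy1 : y ≤ 1) : ∫ t, mpDensity y t = 1 := by
  have h := integral_mpDensity_mul hy0 hy1 (fun _ => 1)
  simp only [mul_one] at h
  rw [integral_complex_ofReal] at h
  have e : ∀ φ : ℝ, ((2 / Real.pi * Real.sin φ ^ 2 / (1 + √y ^ 2 + 2 * √y * Real.cos φ) : ℝ) : ℂ)
      = (2 / Real.pi : ℂ) * ((Real.sin φ : ℂ) ^ 2 / (1 + √y ^ 2 + 2 * √y * Real.cos φ : ℝ)) := by
    intro φ; push_cast; ring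
  simp only [e] at h
  rw [integral_const_mul, integral_sin_sq_div_real (Real.sqrt_pos.2 hy0) (Real.sqrt_le_one.2 hy1)] at h
  have hp : (Real.pi : ℂ) ≠ 0 := by exact_mod_cast Real.pi_ne_zero
  have : ((∫ t, mpDensity y t : ℝ) : ℂ) = 1 := by
    rw [h]; field_simp
  exact_mod_cast this

theorem sq_ne_ofReal_of_nonneg {z : ℂ} (hz : 0 < z.im) {c : ℝ} (hc : 0 ≤ c) : z ^ 2 ≠ c := by
  intro h
  have h1 := congrArg Complex.re h
  have h2 := congrArg Complex.im h
  simp only [sq, Complex.mul_re, Complex.mul_im, Complex.ofReal_re, Complex.ofReal_im] at h1 h2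
  have : z.re = 0 := by nlinarith
  rw [this] at h1
  nlinarith

/-- The equation for ζ is a quadratic whose roots have product 1. A root on the unit circle would
make z² = 1 + r² + 2r Re ζ real and nonnegative, which Im z > 0 forbids; hence one root lies
strictly inside. -/
theorem exists_joukowski {r : ℝ} (hr0 : 0 < r) {z : ℂ} (hz : 0 < z.im) :
    ∃ ζ : ℂ, ζ ≠ 0 ∧ ‖ζ‖ < 1 ∧ z ^ 2 * ζ = (ζ + r) * (1 + r * ζ) := by
  have hrc : (r : ℂ) ≠ 0 := by exact_mod_cast hr0.ne'
  set c : ℂ := (z ^ 2 - 1 - r ^ 2) / r with hc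
  obtain ⟨s, hs⟩ := IsAlgClosed.exists_pow_nat_eq (c ^ 2 - 4) (n := 2) (by norm_num)
  have hc' : r * c = z ^ 2 - 1 - r ^ 2 := by rw [hc]; field_simp
  have key : ∀ ζ : ℂ, ζ ^ 2 - c * ζ + 1 = 0 →
      ζ ≠ 0 ∧ ‖ζ‖ ≠ 1 ∧ z ^ 2 * ζ = (ζ + r) * (1 + r * ζ) := by
    intro ζ h
    have h0 : ζ ≠ 0 := by rintro rfl; simp at h
    have h1 : z ^ 2 * ζ = (ζ + r) * (1 + r * ζ) := by
      linear_combination (-r) * h - ζ * hc'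
    refine ⟨h0, fun hn => ?_, h1⟩
    have hconj : ζ * (starRingEnd ℂ) ζ = 1 := by
      rw [Complex.mul_conj, Complex.normSq_eq_norm_sq, hn]; simp
    have hre : ζ + (starRingEnd ℂ) ζ = (2 * ζ.re : ℝ) := Complex.add_conj ζ
    have hz2 : z ^ 2 = ((1 + r ^ 2 + 2 * r * ζ.re : ℝ) : ℂ) := by
      apply mul_right_cancel₀ h0
      rw [h1]; push_cast
      push_cast at hre
      linear_combination (r * ζ) * hre - r * hconj
    refine sq_ne_ofReal_of_nonneg hz ?_ hz2
    have := (abs_le.1 (Complex.abs_re_le_norm ζ)).1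
    rw [hn] at this
    nlinarith [sq_nonneg (1 - r)]
  have hroot : ((c + s) / 2) ^ 2 - c * ((c + s) / 2) + 1 = 0 := by linear_combination hs / 4
  obtain ⟨h0, h1, h2⟩ := key _ hroot
  rcases lt_or_gt_of_ne h1 with h | h
  · exact ⟨_, h0, h, h2⟩
  · have hroot' : ((c - s) / 2) ^ 2 - c * ((c - s) / 2) + 1 = 0 := by linear_combination hs / 4
    obtain ⟨g0, g1, g2⟩ := key _ hroot'
    refine ⟨_, g0, ?_, g2⟩
    have hp : (c + s) / 2 * ((c - s) / 2) = 1 := by linear_combination -hs / 4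
    have hn := congrArg norm hp
    rw [norm_mul, norm_one] at hn
    by_contra hge
    push Not at hge
    nlinarith

/-- The Marchenko-Pastur law with ratio `y ≤ 1`. -/
noncomputable def mpMeasure (y : ℝ) : Measure ℝ :=
  volume.withDensity fun t => ENNReal.ofReal (mpDensity y t)

theorem integral_mpMeasure {y : ℝ} (hy0 : 0 < y) (g : ℝ → ℂ) :
    ∫ t, g t ∂(mpMeasure y) = ∫ t, (mpDensity y t : ℂ) * g t := by
  rw [mpMeasure, integral_withDensity_eq_integral_toReal_smul
    (measurable_mpDensity y).ennreal_ofReal (ae_of_all _ fun _ => ENNReal.ofReal_lt_top)]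
  congr 1; ext t
  rw [ENNReal.toReal_ofReal (mpDensity_nonneg hy0 t), Complex.real_smul]

theorem mpMeasure_real {y : ℝ} (hy0 : 0 < y) (hy1 : y ≤ 1) {s : Set ℝ} (hs : MeasurableSet s) :
    (mpMeasure y).real s = ∫ t in s, mpDensity y t := by
  rw [measureReal_def, mpMeasure, withDensity_apply _ hs,
    ← ofReal_integral_eq_lintegral_ofReal (integrable_mpDensity hy0 hy1).integrableOn
      (ae_of_all _ (mpDensity_nonneg hy0)), ENNReal.toReal_ofReal
      (integral_nonneg (mpDensity_nonneg hy0))]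

theorem isProbabilityMeasure_mpMeasure {y : ℝ} (hy0 : 0 < y) (hy1 : y ≤ 1) :
    IsProbabilityMeasure (mpMeasure y) := by
  constructor
  rw [mpMeasure, withDensity_apply _ MeasurableSet.univ, Measure.restrict_univ,
    ← ofReal_integral_eq_lintegral_ofReal (integrable_mpDensity hy0 hy1)
      (ae_of_all _ (mpDensity_nonneg hy0)), integral_mpDensity hy0 hy1]
  simp

theorem mpMeasure_real_Iic {y : ℝ} (hy0 : 0 < y) (hy1 : y ≤ 1) (x : ℝ) :
    (mpMeasure y).real (Set.Iic x) = mpCDF y x := by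
  rw [mpMeasure_real hy0 hy1 measurableSet_Iic, mpCDF]
  split_ifs with h
  -- Here y = 1, where the atom term of `mpCDF` has weight 1 - 1 = 0.
  · rw [le_antisymm hy1 h.1]; simp
  · simp

theorem mpMeasure_eq_zero {y : ℝ} {s : Set ℝ} (hs : MeasurableSet s)
    (h : ∀ t ∈ s, t < (1 - √y) ^ 2 ) : mpMeasure y s = 0 := by
  rw [mpMeasure, withDensity_apply _ hs, setLIntegral_congr_fun hs (g := fun _ => 0)]
  · simp
  · intro t ht
    simp only []
    rw [mpDensity_of_notMem (fun hm => absurd hm.1 (not_le.2 (h t ht)))]; simp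

/-- The Stieltjes transform of the Marchenko-Pastur law in the uniformizing variable. -/
theorem exists_stieltjes_mpMeasure {y : ℝ} (hy0 : 0 < y) (hy1 : y ≤ 1) {z : ℂ} (hz : 0 < z.im) :
    ∃ ζ : ℂ, ζ ≠ 0 ∧ ‖ζ‖ < 1 ∧ z ^ 2 * ζ = (ζ + √y) * (1 + √y * ζ) ∧
      z ^ 2 * (√y * ∫ t : ℝ, ((t : ℂ) - z ^ 2)⁻¹ ∂(mpMeasure y)) = -(√y + ζ) := by
  set r := √y with hr
  have hr0 : 0 < r := Real.sqrt_pos.2 hy0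
  have hr1 : r ≤ 1 := Real.sqrt_le_one.2 hy1
  obtain ⟨ζ, h0, h1, h2⟩ := exists_joukowski hr0 hz
  refine ⟨ζ, h0, h1, h2, ?_⟩
  have hrc : (r : ℂ) ≠ 0 := by exact_mod_cast hr0.ne'
  have hw : z ^ 2 ≠ 0 := by simpa using sq_ne_ofReal_of_nonneg hz (le_refl (0:ℝ))
  have hz0 : z ≠ 0 := by rintro rfl; simp at hz
  have hpi : (Real.pi : ℂ) ≠ 0 := by exact_mod_cast Real.pi_ne_zero
  rw [integral_mpMeasure hy0, integral_mpDensity_mul hy0 hy1]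
  have hDne : ∀ φ : ℝ, 1 - 2 * ζ * (Real.cos φ : ℂ) + ζ ^ 2 ≠ 0 := by
    intro φ
    have := sq_one_sub_norm_le ζ h1 φ
    refine norm_pos_iff.1 (lt_of_lt_of_le ?_ this)
    have : 0 < 1 - ‖ζ‖ := by linarith
    positivity
  -- With T = 1 + r² + 2r cos φ, partial fractions split 1/(T(T - z²)) into (1/z²)(1/(T - z²) -
  -- 1/T). In terms of ζ, T - z² is -(r/ζ)(1 - 2ζ cos φ + ζ²), so both resulting integrals equal
  -- π/2.
  have e : ∀ φ ∈ Set.Ioo 0 Real.pi,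
      ((2 / Real.pi * Real.sin φ ^ 2 / (1 + √y ^ 2 + 2 * √y * Real.cos φ) : ℝ) : ℂ)
        * (((1 + √y ^ 2 + 2 * √y * Real.cos φ : ℝ) : ℂ) - z ^ 2)⁻¹
      = (-(2 / (Real.pi * z ^ 2) * (ζ / r))) * ((Real.sin φ : ℂ) ^ 2 /
          (1 - 2 * ζ * (Real.cos φ : ℂ) + ζ ^ 2))
        - (2 / (Real.pi * z ^ 2)) * ((Real.sin φ : ℂ) ^ 2 / (1 + r ^ 2 + 2 * r * Real.cos φ : ℝ)) := by
    intro φ hφ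
    have hT : ((1 + r ^ 2 + 2 * r * Real.cos φ : ℝ) : ℂ) ≠ 0 := by
      exact_mod_cast (one_add_two_mul_cos_pos hr0 hφ).ne'
    have hD := hDne φ
    have hrel : (((1 + r ^ 2 + 2 * r * Real.cos φ : ℝ) : ℂ) - z ^ 2) * ζ
        = -(r * (1 - 2 * ζ * (Real.cos φ : ℂ) + ζ ^ 2)) := by
      push_cast
      linear_combination -h2
    have hsub : ((1 + r ^ 2 + 2 * r * Real.cos φ : ℝ) : ℂ) - z ^ 2
        = -(r / ζ * (1 - 2 * ζ * (Real.cos φ : ℂ) + ζ ^ 2)) := by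
      apply mul_right_cancel₀ h0
      rw [hrel]; field_simp
    have hinv : (((1 + r ^ 2 + 2 * r * Real.cos φ : ℝ) : ℂ) - z ^ 2)⁻¹
        = -(ζ / r / (1 - 2 * ζ * (Real.cos φ : ℂ) + ζ ^ 2)) := by
      rw [hsub, inv_neg, mul_inv, inv_div, div_eq_mul_inv (ζ / r)]
    have hcoef : ((2 / Real.pi * Real.sin φ ^ 2 / (1 + r ^ 2 + 2 * r * Real.cos φ) : ℝ) : ℂ)
        = 2 / Real.pi * (Real.sin φ : ℂ) ^ 2 / ((1 + r ^ 2 + 2 * r * Real.cos φ : ℝ) : ℂ) := by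
      push_cast; ring
    have hTw : (((1 + r ^ 2 + 2 * r * Real.cos φ : ℝ) : ℂ) - z ^ 2) ≠ 0 := by
      rw [hsub, neg_ne_zero]
      exact mul_ne_zero (div_ne_zero hrc h0) hD
    rw [← hr, hcoef]
    have h3 : -(2 / (Real.pi * z ^ 2) * (ζ / r)) * ((Real.sin φ : ℂ) ^ 2 /
          (1 - 2 * ζ * (Real.cos φ : ℂ) + ζ ^ 2))
        = 2 / (Real.pi * z ^ 2) * (Real.sin φ : ℂ) ^ 2
          * (((1 + r ^ 2 + 2 * r * Real.cos φ : ℝ) : ℂ) - z ^ 2)⁻¹ := by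
      rw [hinv]; ring
    rw [h3]
    generalize ((1 + r ^ 2 + 2 * r * Real.cos φ : ℝ) : ℂ) = T at hT hTw
    field_simp
    ring
  rw [setIntegral_congr_fun measurableSet_Ioo e]
  have i1 : IntegrableOn (fun φ : ℝ => (Real.sin φ : ℂ) ^ 2 /
      (1 - 2 * ζ * (Real.cos φ : ℂ) + ζ ^ 2)) (Set.Ioo 0 Real.pi) := by
    refine (ContinuousOn.integrableOn_Icc ?_).mono_set Set.Ioo_subset_Icc_self
    exact (Continuous.div (by fun_prop) (by fun_prop) hDne).continuousOn
  have i2 : IntegrableOn (fun φ : ℝ => (Real.sin φ : ℂ) ^ 2 /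
      (1 + r ^ 2 + 2 * r * Real.cos φ : ℝ)) (Set.Ioo 0 Real.pi) := by
    -- A non-integrable function has Bochner integral 0, whereas this integral is already known to
    -- be π/2.
    by_contra hn
    have := integral_sin_sq_div_real hr0 hr1
    rw [integral_undef hn] at this
    exact absurd this.symm (div_ne_zero hpi two_ne_zero)
  rw [integral_sub (i1.const_mul _) (i2.const_mul _), integral_const_mul, integral_const_mul,
    integral_sin_sq_div_real hr0 hr1, ← integral_Ioc_eq_integral_Ioo,
    ← intervalIntegral.integral_of_le Real.pi_pos.le, integral_sin_sq_div ζ h1]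
  field_simp
  ring

/-- The self-consistent equation for the Stieltjes transform of the symmetrized
Marchenko-Pastur law, with its a priori bound. -/
theorem mp_self_consistent {y : ℝ} (hy0 : 0 < y) (hy1 : y ≤ 1) {z : ℂ} (hz : 0 < z.im) {τ : ℂ}
    (hτ : τ = y * (z * ∫ t : ℝ, ((t : ℂ) - z ^ 2)⁻¹ ∂(mpMeasure y))) :
    (z + τ) * (τ - (1 - y) / z) = -1 ∧ ‖τ‖ ≤ 1 := by
  obtain ⟨ζ, h0, h1, h2, h3⟩ := exists_stieltjes_mpMeasure hy0 hy1 hz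
  set r := √y with hr
  have hr0 : 0 < r := Real.sqrt_pos.2 hy0
  have hr1 : r ≤ 1 := Real.sqrt_le_one.2 hy1
  have hry : (y : ℂ) = r ^ 2 := by rw [hr]; exact_mod_cast (Real.sq_sqrt hy0.le).symm
  have hz0 : z ≠ 0 := by rintro rfl; simp at hz
  have hzτ : z * τ = -(r * (r + ζ)) := by
    rw [hτ, hry]
    linear_combination r * h3
  constructor
  · have h4 : ζ * (z ^ 2 * ((z + τ) * (τ - (1 - y) / z))) = ζ * (z ^ 2 * (-1)) := by
      have : z ^ 2 * ((z + τ) * (τ - (1 - y) / z)) = (z ^ 2 + z * τ) * (z * τ - (1 - y)) := by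
        field_simp
      rw [this, hzτ, hry]
      linear_combination (-r * ζ) * h2
    exact mul_left_cancel₀ (pow_ne_zero 2 hz0) (mul_left_cancel₀ h0 h4)
  -- The Schwarz–Pick inequality for the disc. Together with z²ζ = (ζ + r)(1 + rζ) and |ζ| < 1 it
  -- gives |ζ + r| ≤ |z|, and zτ = -r(r + ζ) then bounds τ.
  · have hn : ‖ζ + r‖ ≤ ‖1 + r * ζ‖ := by
      rw [← sq_le_sq₀ (norm_nonneg _) (norm_nonneg _), ← Complex.normSq_eq_norm_sq,
        ← Complex.normSq_eq_norm_sq, Complex.normSq_apply, Complex.normSq_apply]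
      have hζ2 : ζ.re * ζ.re + ζ.im * ζ.im ≤ 1 := by
        rw [← Complex.normSq_apply, Complex.normSq_eq_norm_sq]
        nlinarith [norm_nonneg ζ]
      simp only [Complex.add_re, Complex.add_im, Complex.ofReal_re, Complex.ofReal_im,
        Complex.one_re, Complex.one_im, Complex.mul_re, Complex.mul_im]
      have : 0 ≤ (1 - r ^ 2) * (1 - (ζ.re * ζ.re + ζ.im * ζ.im)) :=
        mul_nonneg (by nlinarith) (by linarith)
      nlinarith
    have hn2 := congrArg norm h2
    rw [norm_mul, norm_mul, norm_pow] at hn2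
    have hn3 := congrArg norm hzτ
    rw [norm_mul, norm_neg, norm_mul, Complex.norm_real, Real.norm_eq_abs, abs_of_pos hr0,
      add_comm (r : ℂ)] at hn3
    have hle : ‖ζ + r‖ ≤ ‖z‖ := by
      have h5 : ‖ζ + r‖ ^ 2 ≤ ‖z‖ ^ 2 := by
        have h6 : ‖ζ + r‖ * ‖ζ + r‖ ≤ ‖ζ + r‖ * ‖1 + r * ζ‖ :=
          mul_le_mul_of_nonneg_left hn (norm_nonneg _)
        have h7 : ‖z‖ ^ 2 * ‖ζ‖ ≤ ‖z‖ ^ 2 := mul_le_of_le_one_right (by positivity) h1.le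
        nlinarith
      exact (sq_le_sq₀ (norm_nonneg _) (norm_nonneg _)).1 h5
    have hzp : 0 < ‖z‖ := norm_pos_iff.2 hz0
    have : ‖z‖ * ‖τ‖ ≤ ‖z‖ * 1 := by
      rw [hn3]; nlinarith [norm_nonneg (ζ + (r:ℂ))]
    exact le_of_mul_le_mul_left this hzp

/-! ### Symmetrization and the smoothing inequality -/

/-- The symmetric law of `±√t` for `t` distributed according to `μ`. -/
noncomputable def symmSqrt (μ : Measure ℝ) : Measure ℝ :=
  (2⁻¹ : ENNReal) • (μ.map Real.sqrt + μ.map fun t => -Real.sqrt t)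

theorem measurable_neg_sqrt : Measurable fun t : ℝ => -Real.sqrt t := by fun_prop

instance isProbabilityMeasure_symmSqrt (μ : Measure ℝ) [IsProbabilityMeasure μ] :
    IsProbabilityMeasure (symmSqrt μ) := by
  constructor
  rw [symmSqrt, Measure.smul_apply, Measure.add_apply,
    Measure.map_apply Real.continuous_sqrt.measurable MeasurableSet.univ,
    Measure.map_apply measurable_neg_sqrt MeasurableSet.univ]
  simp only [Set.preimage_univ, measure_univ, smul_eq_mul, one_add_one_eq_two]
  exact ENNReal.inv_mul_cancel two_ne_zero ENNReal.ofNat_ne_top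

theorem symmSqrt_real (μ : Measure ℝ) [IsProbabilityMeasure μ] {s : Set ℝ} (hs : MeasurableSet s) :
    (symmSqrt μ).real s = (μ.real (Real.sqrt ⁻¹' s) + μ.real ((fun t => -Real.sqrt t) ⁻¹' s)) / 2 := by
  have : IsProbabilityMeasure (μ.map Real.sqrt) :=
    Measure.isProbabilityMeasure_map Real.continuous_sqrt.measurable.aemeasurable
  have : IsProbabilityMeasure (μ.map fun t => -Real.sqrt t) :=
    Measure.isProbabilityMeasure_map measurable_neg_sqrt.aemeasurable
  rw [symmSqrt, measureReal_ennreal_smul_apply, measureReal_add_apply,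
    map_measureReal_apply Real.continuous_sqrt.measurable hs,
    map_measureReal_apply measurable_neg_sqrt hs]
  simp; ring

theorem symmSqrt_real_Iic (μ : Measure ℝ) [IsProbabilityMeasure μ] {x : ℝ} (hx : 0 ≤ x) :
    (symmSqrt μ).real (Set.Iic x) = (μ.real (Set.Iic (x ^ 2)) + 1) / 2 := by
  rw [symmSqrt_real μ measurableSet_Iic]
  have h1 : Real.sqrt ⁻¹' Set.Iic x = Set.Iic (x ^ 2) := by
    ext t; simp [Real.sqrt_le_left hx]
  have h2 : (fun t => -Real.sqrt t) ⁻¹' Set.Iic x = Set.univ := by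
    ext t
    have := Real.sqrt_nonneg t
    simp; linarith
  rw [h1, h2]; simp

theorem norm_inv_ofReal_sub_le {z : ℂ} (hz : 0 < z.im) (s : ℝ) : ‖((s : ℂ) - z)⁻¹‖ ≤ z.im⁻¹ := by
  rw [norm_inv]
  refine inv_anti₀ hz ?_
  simpa [abs_of_pos hz] using Complex.abs_im_le_norm ((s : ℂ) - z)

theorem integrable_inv_ofReal_sub (μ : Measure ℝ) [IsProbabilityMeasure μ] {z : ℂ} (hz : 0 < z.im) :
    Integrable (fun s : ℝ => ((s : ℂ) - z)⁻¹) μ :=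
  Integrable.of_bound (C := z.im⁻¹) (by fun_prop) (ae_of_all _ (norm_inv_ofReal_sub_le hz))

theorem inv_sqrt_sub_add_inv_neg_sqrt_sub {z : ℂ} (hz : 0 < z.im) {t : ℝ} (ht : 0 ≤ t) :
    (((√t : ℝ) : ℂ) - z)⁻¹ + (((-√t : ℝ) : ℂ) - z)⁻¹ = 2 * (z * ((t : ℂ) - z ^ 2)⁻¹) := by
  have hne : ∀ s : ℝ, (s : ℂ) - z ≠ 0 := by
    intro s h
    have := congrArg Complex.im h
    simp at this; linarith
  have e : ((t : ℂ) - z ^ 2) = -((((√t : ℝ) : ℂ) - z) * (((-√t : ℝ) : ℂ) - z)) := by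
    have : ((√t : ℝ) : ℂ) ^ 2 = t := by exact_mod_cast Real.sq_sqrt ht
    push_cast
    linear_combination -this
  rw [e]
  have h1 := hne (√t)
  have h2 := hne (-√t)
  field_simp
  push_cast; ring

/-- Averaging 1/(s - z) over s = ±√t gives z/(t - z²). The mass on negative t must vanish because
the real square root sends all of it to 0. -/
theorem integral_symmSqrt (μ : Measure ℝ) [IsProbabilityMeasure μ] (hμ : μ (Set.Iio 0) = 0)
    {z : ℂ} (hz : 0 < z.im) :
    ∫ s : ℝ, ((s : ℂ) - z)⁻¹ ∂(symmSqrt μ) = z * ∫ t : ℝ, ((t : ℂ) - z ^ 2)⁻¹ ∂μ := by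
  have hp1 : IsProbabilityMeasure (μ.map Real.sqrt) :=
    Measure.isProbabilityMeasure_map Real.continuous_sqrt.measurable.aemeasurable
  have hp2 : IsProbabilityMeasure (μ.map fun t => -Real.sqrt t) :=
    Measure.isProbabilityMeasure_map measurable_neg_sqrt.aemeasurable
  have i1 := integrable_inv_ofReal_sub (μ.map Real.sqrt) hz
  have i2 := integrable_inv_ofReal_sub (μ.map fun t => -Real.sqrt t) hz
  rw [symmSqrt, integral_smul_measure, integral_add_measure i1 i2,
    integral_map Real.continuous_sqrt.measurable.aemeasurable i1.aestronglyMeasurable,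
    integral_map measurable_neg_sqrt.aemeasurable i2.aestronglyMeasurable,
    ← integral_add (f := fun t : ℝ => (((√t : ℝ) : ℂ) - z)⁻¹)
      (g := fun t : ℝ => (((-√t : ℝ) : ℂ) - z)⁻¹)
      (i1.comp_measurable Real.continuous_sqrt.measurable)
      (i2.comp_measurable measurable_neg_sqrt)]
  have hae : ∀ᵐ t ∂μ, (((√t : ℝ) : ℂ) - z)⁻¹ + (((-√t : ℝ) : ℂ) - z)⁻¹
      = 2 * (z * ((t : ℂ) - z ^ 2)⁻¹) := by
    have : ∀ᵐ t ∂μ, t ∉ Set.Iio (0 : ℝ) := measure_eq_zero_iff_ae_notMem.1 hμ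
    filter_upwards [this] with t ht
    exact inv_sqrt_sub_add_inv_neg_sqrt_sub hz (not_lt.1 ht)
  rw [integral_congr_ae hae, integral_const_mul, integral_const_mul]
  simp

theorem im_stieltjes_nonneg (μ : Measure ℝ) [IsProbabilityMeasure μ] {z : ℂ} (hz : 0 < z.im) :
    0 ≤ (∫ s : ℝ, ((s : ℂ) - z)⁻¹ ∂μ).im := by
  have h := integral_im (integrable_inv_ofReal_sub μ hz)
  simp only [RCLike.im_to_complex] at h
  rw [← h]
  refine integral_nonneg fun s => ?_
  simp only [Complex.inv_im, Complex.sub_im, Complex.ofReal_im, zero_sub, neg_neg, Pi.zero_apply]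
  exact div_nonneg hz.le (Complex.normSq_nonneg _)

theorem norm_stieltjes_le (μ : Measure ℝ) [IsProbabilityMeasure μ] {z : ℂ} (hz : 0 < z.im) :
    ‖∫ s : ℝ, ((s : ℂ) - z)⁻¹ ∂μ‖ ≤ z.im⁻¹ := by
  simpa using norm_integral_le_of_norm_le_const (μ := μ) (ae_of_all _ (norm_inv_ofReal_sub_le hz))

/-- Continuity in the height is what the bootstrap from large to small heights relies on. -/
theorem continuousOn_stieltjes (μ : Measure ℝ) [IsProbabilityMeasure μ] (x : ℝ) :
    ContinuousOn (fun t : ℝ => ∫ s : ℝ, ((s : ℂ) - (x + t * Complex.I))⁻¹ ∂μ) (Set.Ioi 0) := by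
  intro t ht
  refine ContinuousAt.continuousWithinAt ?_
  have ht' : (0 : ℝ) < t := ht
  have hev : ∀ᶠ u : ℝ in nhds t, t / 2 < u := lt_mem_nhds (by linarith)
  refine continuousAt_of_dominated (bound := fun _ => (t / 2)⁻¹) (Eventually.of_forall fun u => ?_)
    ?_ (integrable_const _) (ae_of_all _ fun s => ?_)
  · exact (by fun_prop : Measurable _).aestronglyMeasurable
  · filter_upwards [hev] with u hu
    refine ae_of_all _ fun s => ?_
    have hu0 : 0 < u := by linarith
    refine (norm_inv_ofReal_sub_le (z := x + u * Complex.I) (by simpa using hu0) s).trans ?_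
    simpa using inv_anti₀ (by linarith : 0 < t / 2) hu.le
  · refine ContinuousAt.inv₀ (by fun_prop) ?_
    intro h
    have := congrArg Complex.im h
    simp at this; linarith

theorem integral_rpow_neg_half {a b : ℝ} (ha : 0 ≤ a) (hb : 0 ≤ b) :
    ∫ t in (a ^ 2)..(b ^ 2), t ^ (-(1 / 2) : ℝ) = 2 * (b - a) := by
  rw [integral_rpow (Or.inl (by norm_num))]
  have : (-(1 / 2) + 1 : ℝ) = 1 / 2 := by norm_num
  rw [this, ← Real.sqrt_eq_rpow, ← Real.sqrt_eq_rpow, Real.sqrt_sq ha, Real.sqrt_sq hb]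
  ring

/-- Integrating t^(-1/2)/(2y) over [α², β²] gives (β - α)/y. A negative α is cut at 0; the preimage
then also contains the negative axis, which is null. -/
theorem mpMeasure_real_sqrt_Icc_le {y : ℝ} (hy0 : 0 < y) (hy1 : y ≤ 1) {α β : ℝ} (h : α ≤ β) :
    (mpMeasure y).real (Real.sqrt ⁻¹' Set.Icc α β) ≤ 1 / y * (β - α) := by
  have hP := isProbabilityMeasure_mpMeasure hy0 hy1
  have hnn : 0 ≤ 1 / y * (β - α) := mul_nonneg (by positivity) (by linarith)
  rcases lt_or_ge β 0 with hβ | hβ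
  · have : Real.sqrt ⁻¹' Set.Icc α β = ∅ := by
      ext t
      simp only [Set.mem_preimage, Set.mem_Icc, Set.mem_empty_iff_false, iff_false, not_and]
      intro _ h2
      linarith [Real.sqrt_nonneg t]
    rw [this]; simpa using hnn
  set α' := max α 0
  have hα' : 0 ≤ α' := le_max_right _ _
  have hle : α' ≤ β := max_le h hβ
  have hsub : Real.sqrt ⁻¹' Set.Icc α β ⊆ Set.Iio 0 ∪ Set.Icc (α' ^ 2) (β ^ 2) := by
    rintro t ⟨h1, h2⟩
    rcases lt_or_ge t 0 with ht | ht
    · exact Or.inl ht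
    · refine Or.inr ⟨?_, ?_⟩
      · have : α' ≤ √t := max_le h1 (Real.sqrt_nonneg t)
        calc α' ^ 2 ≤ √t ^ 2 := by gcongr
          _ = t := Real.sq_sqrt ht
      · calc t = √t ^ 2 := (Real.sq_sqrt ht).symm
          _ ≤ β ^ 2 := by gcongr
  have h0 : (mpMeasure y).real (Set.Iio 0) = 0 := by
    rw [measureReal_def, mpMeasure_eq_zero measurableSet_Iio (fun t ht => lt_of_lt_of_le ht
      (sq_nonneg _))]; simp
  have hsq : α' ^ 2 ≤ β ^ 2 := by gcongr
  have hI : IntervalIntegrable (fun t : ℝ => 1 / (2 * y) * t ^ (-(1 / 2) : ℝ)) volume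
      (α' ^ 2) (β ^ 2) := (intervalIntegral.intervalIntegrable_rpow' (by norm_num)).const_mul _
  calc (mpMeasure y).real (Real.sqrt ⁻¹' Set.Icc α β)
      ≤ (mpMeasure y).real (Set.Iio 0 ∪ Set.Icc (α' ^ 2) (β ^ 2)) := measureReal_mono hsub
    _ ≤ (mpMeasure y).real (Set.Iio 0) + (mpMeasure y).real (Set.Icc (α' ^ 2) (β ^ 2)) :=
        measureReal_union_le _ _
    _ = ∫ t in Set.Ioc (α' ^ 2) (β ^ 2), mpDensity y t := by
        rw [h0, zero_add, mpMeasure_real hy0 hy1 measurableSet_Icc, integral_Icc_eq_integral_Ioc]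
    _ ≤ ∫ t in Set.Ioc (α' ^ 2) (β ^ 2), 1 / (2 * y) * t ^ (-(1 / 2) : ℝ) := by
        refine setIntegral_mono_on (integrable_mpDensity hy0 hy1).integrableOn hI.1
          measurableSet_Ioc fun t ht => mpDensity_le hy0 hy1 ?_
        exact lt_of_le_of_lt (sq_nonneg _) ht.1
    _ = 1 / y * (β - α') := by
        rw [← intervalIntegral.integral_of_le hsq, intervalIntegral.integral_const_mul,
          integral_rpow_neg_half hα' hβ]
        field_simp
    _ ≤ 1 / y * (β - α) := by
        have : α ≤ α' := le_max_left _ _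
        gcongr

theorem symmSqrt_mpMeasure_lipschitz {y : ℝ} (hy0 : 0 < y) (hy1 : y ≤ 1) {x x' : ℝ} (h : x ≤ x') :
    (symmSqrt (mpMeasure y)).real (Set.Iic x') - (symmSqrt (mpMeasure y)).real (Set.Iic x)
      ≤ 1 / y * (x' - x) := by
  have hP := isProbabilityMeasure_mpMeasure hy0 hy1
  have hd : (symmSqrt (mpMeasure y)).real (Set.Iic x') - (symmSqrt (mpMeasure y)).real (Set.Iic x)
      = (symmSqrt (mpMeasure y)).real (Set.Ioc x x') := by
    have : Set.Ioc x x' = Set.Iic x' \ Set.Iic x := by ext t; simp [and_comm]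
    rw [this, measureReal_sdiff (Set.Iic_subset_Iic.2 h) measurableSet_Iic]
  rw [hd, symmSqrt_real _ measurableSet_Ioc]
  have h1 : (mpMeasure y).real (Real.sqrt ⁻¹' Set.Ioc x x') ≤ 1 / y * (x' - x) :=
    (measureReal_mono (Set.preimage_mono Set.Ioc_subset_Icc_self)).trans
      (mpMeasure_real_sqrt_Icc_le hy0 hy1 h)
  have h2 : (mpMeasure y).real ((fun t => -Real.sqrt t) ⁻¹' Set.Ioc x x') ≤ 1 / y * (x' - x) := by
    refine (measureReal_mono (s₂ := Real.sqrt ⁻¹' Set.Icc (-x') (-x)) ?_).trans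
      ((mpMeasure_real_sqrt_Icc_le hy0 hy1 (neg_le_neg h)).trans (le_of_eq (by ring)))
    rintro t ⟨h1, h2⟩
    simp only [Set.mem_preimage, Set.mem_Icc]
    constructor <;> linarith
  linarith

/-- Squares of such points do not exceed the left edge of the support, so each sign carries half the
mass on its own side. This exact value replaces Stieltjes estimates near the origin. -/
theorem symmSqrt_mpMeasure_gap {y : ℝ} (hy0 : 0 < y) (hy1 : y ≤ 1) {x : ℝ}
    (hx : |x| ≤ 1 - √y) : (symmSqrt (mpMeasure y)).real (Set.Iic x) = 1 / 2 := by
  have hP := isProbabilityMeasure_mpMeasure hy0 hy1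
  rw [abs_le] at hx
  have hr1 : 0 ≤ 1 - √y := sub_nonneg.2 (Real.sqrt_le_one.2 hy1)
  have hIic : (mpMeasure y).real (Set.Iic ((1 - √y) ^ 2)) = 0 := by
    rw [mpMeasure_real hy0 hy1 measurableSet_Iic, integral_Iic_eq_integral_Iio,
      setIntegral_eq_zero_of_forall_eq_zero]
    intro t ht
    exact mpDensity_of_notMem fun hm => absurd hm.1 (not_le.2 ht)
  rw [symmSqrt_real _ measurableSet_Iic]
  have h1 : (mpMeasure y).real (Real.sqrt ⁻¹' Set.Iic x) = 0 := by
    refine le_antisymm ?_ measureReal_nonneg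
    rw [← hIic]
    refine measureReal_mono fun t ht => ?_
    have ht' : √t ≤ 1 - √y := le_trans ht hx.2
    exact (Real.sqrt_le_left hr1).1 ht'
  have h2 : (mpMeasure y).real ((fun t => -Real.sqrt t) ⁻¹' Set.Iic x) = 1 := by
    have hc : (mpMeasure y).real (Set.Iic ((1 - √y) ^ 2))ᶜ = 1 := by
      rw [probReal_compl_eq_one_sub measurableSet_Iic, hIic, sub_zero]
    refine le_antisymm measureReal_le_one ?_
    rw [← hc]
    refine measureReal_mono fun t ht => ?_
    simp only [Set.mem_compl_iff, Set.mem_Iic, not_le] at ht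
    have : 1 - √y < √t := Real.lt_sqrt_of_sq_lt ht
    simp only [Set.mem_preimage, Set.mem_Iic]
    linarith
  rw [h1, h2]; norm_num

/-- Distance to the Marchenko-Pastur distribution function from a quadratic-decay comparison of
the Stieltjes transforms of the symmetrized laws. -/
theorem abs_cdf_sub_mpCDF_le {y : ℝ} (hy0 : 0 < y) (hy1 : y ≤ 1) (μ : Measure ℝ)
    [IsProbabilityMeasure μ] (hμ : μ (Set.Iio 0) = 0) {v K : ℝ} (hv : 0 < v) (hK : 0 ≤ K)
    (h : ∀ x t : ℝ, v ≤ t → (1 - √y) / 4 ≤ max |x| t →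
      ‖(∫ s : ℝ, ((s : ℂ) - (x + t * Complex.I))⁻¹ ∂(symmSqrt μ))
        - ∫ s : ℝ, ((s : ℂ) - (x + t * Complex.I))⁻¹ ∂(symmSqrt (mpMeasure y))‖ ≤ K / t ^ 2)
    (x : ℝ) : |μ.real (Set.Iic x) - mpCDF y x| ≤ 2 * (K / v) + 16 * (v / y) := by
  have hP := isProbabilityMeasure_mpMeasure hy0 hy1
  set r := √y with hr
  have hr1 : 0 ≤ 1 - r := sub_nonneg.2 (Real.sqrt_le_one.2 hy1)
  set M := symmSqrt μ
  set N := symmSqrt (mpMeasure y)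
  set E := K / v / 2 + 4 * (v / y) with hE
  have hEnn : 0 ≤ E := by positivity
  have hs3 : √3 ≤ 7 / 4 := by rw [Real.sqrt_le_left (by norm_num)]; norm_num
  have hs0 : 0 ≤ √3 := Real.sqrt_nonneg 3
  have hpi := Real.pi_gt_three
  -- the smoothed difference is small away from the gap
  have harc : ∀ u, 1 - r - √3 * v ≤ |u| → 3 / (2 * Real.pi) *
      |(∫ s, Real.arctan ((u - s) / v) ∂M) - ∫ s, Real.arctan ((u - s) / v) ∂N| ≤ K / v / 2 := by
    intro u hu
    have := abs_integral_arctan_sub_le M N hv u (K := K) fun t ht => h u t ht ?_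
    · calc _ ≤ 3 / (2 * Real.pi) * (K / v) := by gcongr
        _ ≤ 1 / 2 * (K / v) := by
          refine mul_le_mul_of_nonneg_right ?_ (by positivity)
          rw [div_le_div_iff₀ (by positivity) (by norm_num)]; linarith
        _ = _ := by ring
    -- If v < (1 - r)/4, then √3 v ≤ (7/16)(1 - r), which leaves |u| ≥ (9/16)(1 - r).
    · by_cases hc : (1 - r) / 4 ≤ v
      · exact (hc.trans ht).trans (le_max_right _ _)
      · refine le_trans ?_ (le_max_left _ _)
        push Not at hc
        nlinarith
  have hmono : ∀ (ρ : Measure ℝ) [IsProbabilityMeasure ρ] {a b : ℝ}, a ≤ b →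
      ρ.real (Set.Iic a) ≤ ρ.real (Set.Iic b) := fun ρ _ a b hab =>
    measureReal_mono (Set.Iic_subset_Iic.2 hab)
  have hL : 2 * √3 * (1 / y) * v ≤ 4 * (v / y) := by
    rw [show 2 * √3 * (1 / y) * v = (2 * √3) * (v / y) by ring]
    gcongr; linarith
  have step : ∀ Δ : ℝ, (∀ x, |M.real (Set.Iic x) - N.real (Set.Iic x)| ≤ Δ) →
      ∀ x, |M.real (Set.Iic x) - N.real (Set.Iic x)| ≤ E + Δ / 2 := by
    intro Δ hΔ
    have main := fun x => cdf_sub_le_of_arctan M N hv (L := 1 / y)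
      (fun x x' hxx => symmSqrt_mpMeasure_lipschitz hy0 hy1 hxx) hΔ x
    have up : ∀ x, 1 - r ≤ |x| → M.real (Set.Iic x) - N.real (Set.Iic x) ≤ E + Δ / 2 ∧
        N.real (Set.Iic x) - M.real (Set.Iic x) ≤ E + Δ / 2 := by
      intro x hx
      have hsv : |√3 * v| = √3 * v := abs_of_nonneg (by positivity)
      have a1 := harc (x + √3 * v) (by
        have := abs_sub_abs_le_abs_sub x (-(√3 * v))
        rw [abs_neg, hsv, sub_neg_eq_add] at this; linarith)
      have a2 := harc (x - √3 * v) (by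
        have := abs_sub_abs_le_abs_sub x (√3 * v)
        rw [hsv] at this; linarith)
      obtain ⟨m1, m2⟩ := main x
      constructor <;> linarith
    intro x
    rcases le_total (1 - r) |x| with hx | hx
    · obtain ⟨u1, u2⟩ := up x hx
      rw [abs_le]; constructor <;> linarith
    -- Inside the gap the limit function is constantly 1/2, so monotonicity of the other one reduces
    -- the claim to the two endpoints ±(1 - r).
    · have hab : |1 - r| = 1 - r := abs_of_nonneg hr1
      have hab' : |-(1 - r)| = 1 - r := by rw [abs_neg, hab]
      have g0 := symmSqrt_mpMeasure_gap hy0 hy1 hx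
      have g1 := symmSqrt_mpMeasure_gap hy0 hy1 hab.le
      have g2 := symmSqrt_mpMeasure_gap hy0 hy1 hab'.le
      have u1 := (up (1 - r) hab.ge).1
      have u2 := (up (-(1 - r)) hab'.ge).2
      have m1 := hmono M (abs_le.1 hx).2
      have m2 := hmono M (abs_le.1 hx).1
      change N.real _ = _ at g0 g1 g2
      rw [g1] at u1
      rw [g2] at u2
      rw [g0, abs_le]; constructor <;> linarith
  have hle1 : ∀ (ρ : Measure ℝ) [IsProbabilityMeasure ρ] (s : Set ℝ), ρ.real s ≤ 1 :=
    fun ρ _ s => measureReal_le_one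
  have hbdd : BddAbove (Set.range fun x => |M.real (Set.Iic x) - N.real (Set.Iic x)|) := by
    refine ⟨1, ?_⟩
    rintro _ ⟨x, rfl⟩
    have a1 := hle1 M (Set.Iic x)
    have a2 := hle1 N (Set.Iic x)
    have b1 := measureReal_nonneg (μ := M) (s := Set.Iic x)
    have b2 := measureReal_nonneg (μ := N) (s := Set.Iic x)
    simp only [abs_le]; constructor <;> linarith
  -- Taking Δ to be the supremum itself, the bound E + Δ/2 is absorbed and yields Δ ≤ 2E.
  have hsup := step _ (fun x => le_ciSup hbdd x)
  have hfin : (⨆ x, |M.real (Set.Iic x) - N.real (Set.Iic x)|) ≤ 2 * E := by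
    have := ciSup_le hsup
    linarith
  rw [← mpMeasure_real_Iic hy0 hy1]
  rcases lt_or_ge x 0 with hx | hx
  · have z1 : μ.real (Set.Iic x) = 0 := by
      rw [measureReal_def, measure_mono_null (Set.Iic_subset_Iio.2 hx) hμ]; simp
    have z2 : (mpMeasure y).real (Set.Iic x) = 0 := by
      rw [measureReal_def, mpMeasure_eq_zero measurableSet_Iic
        (fun t ht => (lt_of_le_of_lt ht hx).trans_le (sq_nonneg _))]; simp
    rw [z1, z2]; simp; positivity
  · have hs := (le_ciSup hbdd (√x)).trans hfin
    simp only [M, N] at hs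
    rw [symmSqrt_real_Iic μ (Real.sqrt_nonneg x), symmSqrt_real_Iic _ (Real.sqrt_nonneg x),
      Real.sq_sqrt hx, ← sub_div, add_sub_add_right_eq_sub, abs_div, abs_two] at hs
    -- The symmetrized function at √x is (F(x) + 1)/2, so undoing the symmetrization doubles 2E.
    have : |μ.real (Set.Iic x) - (mpMeasure y).real (Set.Iic x)| ≤ 4 * E := by linarith
    refine this.trans (le_of_eq ?_)
    rw [hE]; ring

/-! ### Resolvent bounds and rank-one perturbation -/

/-- A complex symmetric matrix with nonnegative quadratic form. -/
def IsSymmNonneg {ι : Type*} [Fintype ι] (N : Matrix ι ι ℂ) : Prop :=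
  Nᵀ = N ∧ ∀ u : ι → ℂ, ∃ a : ℝ, 0 ≤ a ∧ star u ⬝ᵥ (N *ᵥ u) = a

/-- The matrix `z (N - z²)⁻¹`. -/
noncomputable def sqResolvent {ι : Type*} [Fintype ι] [DecidableEq ι] (N : Matrix ι ι ℂ) (z : ℂ) :
    Matrix ι ι ℂ :=
  z • (N - (z ^ 2) • (1 : Matrix ι ι ℂ))⁻¹

theorem star_dotProduct_self {ι : Type*} [Fintype ι] (u : ι → ℂ) : star u ⬝ᵥ u = ((∑ i, ‖u i‖ ^ 2 : ℝ) : ℂ) := by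
  simp only [dotProduct, Pi.star_apply, Complex.star_def]
  push_cast
  exact Finset.sum_congr rfl fun i _ => Complex.conj_mul' (u i)

section Resolvent

variable {ι : Type*} [Fintype ι] [DecidableEq ι] {N : Matrix ι ι ℂ} {z : ℂ}

/-- A kernel vector u would force z² = a/‖u‖² ≥ 0, with a the value of the form at u; a square of a
point in the upper half-plane is never a nonnegative real. -/
theorem det_sub_sq_ne_zero (hN : IsSymmNonneg N) (hz : 0 < z.im) :
    (N - (z ^ 2) • (1 : Matrix ι ι ℂ)).det ≠ 0 := by
  intro h
  obtain ⟨u, hu, hu0⟩ := Matrix.exists_mulVec_eq_zero_iff.2 h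
  obtain ⟨a, ha, hau⟩ := hN.2 u
  have h1 : N *ᵥ u = (z ^ 2) • u := by
    rw [Matrix.sub_mulVec, Matrix.smul_mulVec, Matrix.one_mulVec] at hu0
    exact sub_eq_zero.1 hu0
  rw [h1, dotProduct_smul, star_dotProduct_self, smul_eq_mul] at hau
  have hpos : 0 < ∑ i, ‖u i‖ ^ 2 := by
    obtain ⟨i, hi⟩ := Function.ne_iff.1 hu
    exact Finset.sum_pos' (fun _ _ => by positivity)
      ⟨i, Finset.mem_univ _, by have := norm_pos_iff.2 hi; positivity⟩
  refine sq_ne_ofReal_of_nonneg hz (div_nonneg ha hpos.le) ?_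
  rw [Complex.ofReal_div, eq_div_iff (by exact_mod_cast hpos.ne')]
  exact hau

theorem sub_mul_inv_cancel (hN : IsSymmNonneg N) (hz : 0 < z.im) :
    (N - (z ^ 2) • (1 : Matrix ι ι ℂ)) * (N - (z ^ 2) • (1 : Matrix ι ι ℂ))⁻¹ = 1 :=
  Matrix.mul_nonsing_inv _ (isUnit_iff_ne_zero.2 (det_sub_sq_ne_zero hN hz))

theorem sub_mul_sqResolvent (hN : IsSymmNonneg N) (hz : 0 < z.im) :
    (N - (z ^ 2) • (1 : Matrix ι ι ℂ)) * sqResolvent N z = z • 1 := by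
  rw [sqResolvent, Matrix.mul_smul, sub_mul_inv_cancel hN hz]

theorem mul_sqResolvent (hN : IsSymmNonneg N) (hz : 0 < z.im) :
    N * sqResolvent N z = z • 1 + (z ^ 2) • sqResolvent N z := by
  have := sub_mul_sqResolvent hN hz
  rw [Matrix.sub_mul, Matrix.smul_mul, Matrix.one_mul] at this
  exact sub_eq_iff_eq_add.1 this

theorem transpose_sqResolvent (hN : IsSymmNonneg N) (z : ℂ) : (sqResolvent N z)ᵀ = sqResolvent N z := by
  rw [sqResolvent, Matrix.transpose_smul, Matrix.transpose_nonsing_inv, Matrix.transpose_sub, hN.1,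
    Matrix.transpose_smul, Matrix.transpose_one]

/-- The quadratic form of the resolvent has imaginary part bounded below. -/
theorem im_star_dotProduct_sqResolvent (hN : IsSymmNonneg N) (hz : 0 < z.im) (c : ι → ℂ) :
    z.im * ∑ i, ‖(sqResolvent N z *ᵥ c) i‖ ^ 2 ≤ (star c ⬝ᵥ (sqResolvent N z *ᵥ c)).im := by
  have hz0 : z ≠ 0 := by rintro rfl; simp at hz
  set w := sqResolvent N z *ᵥ c with hw
  obtain ⟨a, ha, haw⟩ := hN.2 w
  have h1 : N *ᵥ w = z • c + (z ^ 2) • w := by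
    rw [hw, Matrix.mulVec_mulVec, mul_sqResolvent hN hz, Matrix.add_mulVec, Matrix.smul_mulVec,
      Matrix.smul_mulVec, Matrix.one_mulVec]
  rw [h1, dotProduct_add, dotProduct_smul, dotProduct_smul, star_dotProduct_self, smul_eq_mul,
    smul_eq_mul] at haw
  set n := ∑ i, ‖w i‖ ^ 2 with hn
  have hn0 : 0 ≤ n := Finset.sum_nonneg fun _ _ => by positivity
  have h2 : star c ⬝ᵥ w = star (star w ⬝ᵥ c) := by
    rw [Matrix.star_dotProduct]
  -- Pair (N - z²)w = zc with w and divide by z. After conjugation both terms have nonnegative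
  -- imaginary part, and the second is exactly z.im times ‖w‖².
  have h3 : star w ⬝ᵥ c = a / z - z * n := by
    field_simp
    linear_combination haw
  rw [h2, h3]
  have : (star ((a : ℂ) / z - z * n)).im = a * z.im / Complex.normSq z + z.im * n := by
    simp only [Complex.star_def, Complex.conj_im, Complex.sub_im, Complex.div_im, Complex.mul_im,
      Complex.ofReal_re, Complex.ofReal_im]
    ring
  rw [this]
  have : 0 ≤ a * z.im / Complex.normSq z :=
    div_nonneg (mul_nonneg ha hz.le) (Complex.normSq_nonneg z)
  linarith

/-- Summing the previous bound over basis vectors gives a Ward-type inequality. It converts the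
Frobenius norm in the variance of quadratic forms into the imaginary part of the trace. -/
theorem im_trace_sqResolvent (hN : IsSymmNonneg N) (hz : 0 < z.im) :
    z.im * ∑ j, ∑ i, ‖sqResolvent N z i j‖ ^ 2 ≤ (sqResolvent N z).trace.im := by
  rw [Matrix.trace, Complex.im_sum, Finset.mul_sum]
  refine Finset.sum_le_sum fun j _ => ?_
  have := im_star_dotProduct_sqResolvent hN hz (Pi.single j 1)
  have hs : star (Pi.single j (1 : ℂ)) = (Pi.single j 1 : ι → ℂ) := by
    ext i; by_cases h : i = j
    · subst h; simp
    · simp [h]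
  rw [hs] at this
  simpa [Matrix.mulVec_single_one, Matrix.col_apply] using this

theorem norm_trace_sqResolvent_le (hN : IsSymmNonneg N) (hz : 0 < z.im) :
    ‖(sqResolvent N z).trace‖ ≤ Fintype.card ι / z.im := by
  have key : ∀ j, ‖sqResolvent N z j j‖ ≤ 1 / z.im := by
    intro j
    have := im_star_dotProduct_sqResolvent hN hz (Pi.single j 1)
    have hs : star (Pi.single j (1 : ℂ)) = (Pi.single j 1 : ι → ℂ) := by
      ext i; by_cases h : i = j
      · subst h; simp
      · simp [h]
    rw [hs] at this
    simp only [Matrix.mulVec_single_one, Matrix.col_apply, single_dotProduct, one_mul] at this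
    have h1 : ‖sqResolvent N z j j‖ ^ 2 ≤ ∑ i, ‖sqResolvent N z i j‖ ^ 2 :=
      Finset.single_le_sum (f := fun i => ‖sqResolvent N z i j‖ ^ 2)
        (fun _ _ => by positivity) (Finset.mem_univ j)
    have h2 := (le_abs_self _).trans (Complex.abs_im_le_norm (sqResolvent N z j j))
    have h3 : z.im * ‖sqResolvent N z j j‖ ^ 2 ≤ ‖sqResolvent N z j j‖ :=
      (mul_le_mul_of_nonneg_left h1 hz.le).trans (this.trans h2)
    rw [le_div_iff₀ hz]
    rcases (norm_nonneg (sqResolvent N z j j)).eq_or_lt with h0 | h0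
    · rw [← h0]; simp
    · nlinarith
  calc ‖(sqResolvent N z).trace‖ ≤ ∑ j, ‖sqResolvent N z j j‖ := norm_sum_le _ _
    _ ≤ ∑ _j : ι, 1 / z.im := Finset.sum_le_sum fun j _ => key j
    _ = _ := by simp [div_eq_mul_inv]

/-- The quadratic form `cᵀ R c`. -/
noncomputable def resolventForm (N : Matrix ι ι ℂ) (z : ℂ) (c : ι → ℝ) : ℂ :=
  (fun i => (c i : ℂ)) ⬝ᵥ (sqResolvent N z *ᵥ fun i => (c i : ℂ))

/-- The quadratic form `cᵀ R² c`. -/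
noncomputable def resolventSqForm (N : Matrix ι ι ℂ) (z : ℂ) (c : ι → ℝ) : ℂ :=
  ∑ i, (sqResolvent N z *ᵥ fun i => (c i : ℂ)) i ^ 2

/-- With w = Rc, |∑ wᵢ²| ≤ ∑ |wᵢ|², and the imaginary part of cᵀRc controls the latter. This bounds
the numerator of the trace increment due to one column. -/
theorem norm_resolventSqForm_le (hN : IsSymmNonneg N) (hz : 0 < z.im) (c : ι → ℝ) :
    z.im * ‖resolventSqForm N z c‖ ≤ (resolventForm N z c).im := by
  have h := im_star_dotProduct_sqResolvent hN hz (fun i => (c i : ℂ))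
  have hs : star (fun i => (c i : ℂ)) = fun i => (c i : ℂ) := by ext i; simp
  rw [hs] at h
  refine le_trans ?_ h
  refine mul_le_mul_of_nonneg_left ?_ hz.le
  refine (norm_sum_le _ _).trans (le_of_eq ?_)
  simp only [norm_pow]

theorem im_resolventForm_nonneg (hN : IsSymmNonneg N) (hz : 0 < z.im) (c : ι → ℝ) :
    0 ≤ (resolventForm N z c).im :=
  (mul_nonneg hz.le (norm_nonneg _)).trans (norm_resolventSqForm_le hN hz c)

theorem im_add_resolventForm_le (N : Matrix ι ι ℂ) (z : ℂ) (c : ι → ℝ) :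
    z.im + (resolventForm N z c).im ≤ ‖z + resolventForm N z c‖ := by
  have := Complex.abs_im_le_norm (z + resolventForm N z c)
  rw [Complex.add_im] at this
  exact (le_abs_self _).trans this

theorem add_resolventForm_ne_zero (hN : IsSymmNonneg N) (hz : 0 < z.im) (c : ι → ℝ) :
    z + resolventForm N z c ≠ 0 := by
  have h1 := im_add_resolventForm_le N z c
  have h2 := im_resolventForm_nonneg hN hz c
  exact norm_pos_iff.1 (by linarith)

theorem resolventSqForm_eq (hN : IsSymmNonneg N) (c : ι → ℝ) :
    resolventSqForm N z c = (sqResolvent N z * Matrix.vecMulVec (fun i => (c i : ℂ))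
      (fun i => (c i : ℂ)) * sqResolvent N z).trace := by
  rw [Matrix.mul_vecMulVec, Matrix.vecMulVec_mul, Matrix.trace_vecMulVec,
    ← Matrix.mulVec_transpose, transpose_sqResolvent hN, resolventSqForm, dotProduct]
  simp only [sq]

/-- Rank-one perturbation of the resolvent. -/
theorem sqResolvent_add_vecMulVec (hN : IsSymmNonneg N) (hz : 0 < z.im) (c : ι → ℝ) :
    sqResolvent (N + Matrix.vecMulVec (fun i => (c i : ℂ)) (fun i => (c i : ℂ))) z
      = sqResolvent N z - (z + resolventForm N z c)⁻¹ • (sqResolvent N z *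
        Matrix.vecMulVec (fun i => (c i : ℂ)) (fun i => (c i : ℂ)) * sqResolvent N z) := by
  set cc : ι → ℂ := fun i => (c i : ℂ) with hcc
  set V := Matrix.vecMulVec cc cc with hV
  have hz0 : z ≠ 0 := by rintro rfl; simp at hz
  have hq := add_resolventForm_ne_zero hN hz c
  set q := resolventForm N z c with hqdef
  set R := sqResolvent N z with hR
  have hVRV : V * R * V = q • V := by
    rw [hV, Matrix.vecMulVec_mul, Matrix.vecMulVec_mul_vecMulVec, ← Matrix.dotProduct_mulVec,
      Matrix.vecMulVec_smul]
    rfl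
  set B := N - (z ^ 2) • (1 : Matrix ι ι ℂ) with hB
  have hBR : B * R = z • 1 := sub_mul_sqResolvent hN hz
  have hsub : N + V - (z ^ 2) • (1 : Matrix ι ι ℂ) = B + V := by rw [hB]; abel
  rw [sqResolvent, hsub]
  have hinv : (B + V) * (z⁻¹ • (R - (z + q)⁻¹ • (R * V * R))) = 1 := by
    rw [Matrix.mul_smul, Matrix.add_mul, Matrix.mul_sub, Matrix.mul_sub, Matrix.mul_smul,
      Matrix.mul_smul, ← Matrix.mul_assoc, ← Matrix.mul_assoc, ← Matrix.mul_assoc,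
      ← Matrix.mul_assoc, hBR, hVRV, Matrix.smul_mul, Matrix.one_mul, Matrix.smul_mul,
      Matrix.smul_mul, smul_smul, smul_smul]
    have : (z + q)⁻¹ * z + (z + q)⁻¹ * q = 1 := by rw [← mul_add, inv_mul_cancel₀ hq]
    have h2 : z • (1 : Matrix ι ι ℂ) - ((z + q)⁻¹ * z) • (V * R) +
        (V * R - ((z + q)⁻¹ * q) • (V * R)) = z • (1 : Matrix ι ι ℂ) := by
      have : ((z + q)⁻¹ * z) • (V * R) + ((z + q)⁻¹ * q) • (V * R) = V * R := by
        rw [← add_smul, this, one_smul]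
      nth_rw 2 [← this]
      abel
    rw [h2, smul_smul, inv_mul_cancel₀ hz0, one_smul]
  rw [Matrix.inv_eq_right_inv hinv, smul_smul, mul_inv_cancel₀ hz0, one_smul]

theorem trace_sqResolvent_add_vecMulVec (hN : IsSymmNonneg N) (hz : 0 < z.im) (c : ι → ℝ) :
    (sqResolvent (N + Matrix.vecMulVec (fun i => (c i : ℂ)) (fun i => (c i : ℂ))) z).trace
      = (sqResolvent N z).trace - resolventSqForm N z c / (z + resolventForm N z c) := by
  rw [sqResolvent_add_vecMulVec hN hz, Matrix.trace_sub, Matrix.trace_smul,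
    ← resolventSqForm_eq hN, smul_eq_mul, div_eq_inv_mul]

/-- By the rank-one formula the new form is q - q²/(z + q), with q the old one. It lets the full
resolvent be expressed through the leave-one-out forms. -/
theorem resolventForm_add_vecMulVec (hN : IsSymmNonneg N) (hz : 0 < z.im) (c : ι → ℝ) :
    resolventForm (N + Matrix.vecMulVec (fun i => (c i : ℂ)) (fun i => (c i : ℂ))) z c
      = z * (1 - z / (z + resolventForm N z c)) := by
  have hq := add_resolventForm_ne_zero hN hz c
  rw [resolventForm, sqResolvent_add_vecMulVec hN hz, Matrix.sub_mulVec, dotProduct_sub,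
    Matrix.smul_mulVec, dotProduct_smul, Matrix.mul_assoc, ← Matrix.mulVec_mulVec,
    ← Matrix.mulVec_mulVec, Matrix.vecMulVec_mulVec, Matrix.mulVec_smul, dotProduct_smul]
  change resolventForm N z c - (z + resolventForm N z c)⁻¹ •
    MulOpposite.op (resolventForm N z c) • resolventForm N z c = _
  simp only [smul_eq_mul, MulOpposite.smul_eq_mul_unop, MulOpposite.unop_op]
  field_simp
  ring

end Resolvent

/-! ### Leave-one-column-out identities for Gram matrices -/

section Gram

variable {ι : Type*} {n : ℕ}

/-- The complexified Gram matrix `∑ₖ cₖ cₖᵀ` of a family of columns. -/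
noncomputable def colGram (x : Fin n → ι → ℝ) : Matrix ι ι ℂ :=
  ∑ k, Matrix.vecMulVec (fun i => (x k i : ℂ)) (fun i => (x k i : ℂ))

variable [Fintype ι]

theorem isSymmNonneg_vecMulVec (c : ι → ℝ) :
    IsSymmNonneg (Matrix.vecMulVec (fun i => (c i : ℂ)) (fun i => (c i : ℂ))) := by
  refine ⟨Matrix.transpose_vecMulVec _ _, fun u => ⟨‖(fun i => (c i : ℂ)) ⬝ᵥ u‖ ^ 2, by positivity, ?_⟩⟩
  rw [Matrix.vecMulVec_mulVec, dotProduct_smul]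
  have hs : star (fun i => (c i : ℂ)) = fun i => (c i : ℂ) := by ext i; simp
  have : star u ⬝ᵥ (fun i => (c i : ℂ)) = star ((fun i => (c i : ℂ)) ⬝ᵥ u) := by
    rw [Matrix.star_dotProduct, hs]
  simp only [MulOpposite.smul_eq_mul_unop, MulOpposite.unop_op]
  rw [this, Complex.star_def, Complex.conj_mul']
  push_cast; ring

theorem IsSymmNonneg.sum {α : Type*} (s : Finset α) (f : α → Matrix ι ι ℂ)
    (h : ∀ a ∈ s, IsSymmNonneg (f a)) : IsSymmNonneg (∑ a ∈ s, f a) := by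
  classical
  induction s using Finset.induction_on with
  | empty => exact ⟨by simp, fun u => ⟨0, le_rfl, by simp⟩⟩
  | insert a s ha ih =>
    rw [Finset.sum_insert ha]
    have h1 := h a (Finset.mem_insert_self a s)
    have h2 := ih fun b hb => h b (Finset.mem_insert_of_mem hb)
    refine ⟨by rw [Matrix.transpose_add, h1.1, h2.1], fun u => ?_⟩
    obtain ⟨a1, ha1, e1⟩ := h1.2 u
    obtain ⟨a2, ha2, e2⟩ := h2.2 u
    exact ⟨a1 + a2, by positivity, by
      rw [Matrix.add_mulVec, dotProduct_add, e1, e2]; push_cast; rfl⟩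

theorem isSymmNonneg_colGram (x : Fin n → ι → ℝ) : IsSymmNonneg (colGram x) :=
  IsSymmNonneg.sum _ _ fun _ _ => isSymmNonneg_vecMulVec _

end Gram

/-- Zeroing a column rather than deleting it keeps the index type fixed, so all leave-one-out
quantities are functions on one product space. -/
theorem colGram_eq_update {ι : Type*} {n : ℕ} (x : Fin n → ι → ℝ) (k : Fin n) :
    colGram x = colGram (Function.update x k 0)
      + Matrix.vecMulVec (fun i => (x k i : ℂ)) (fun i => (x k i : ℂ)) := by
  unfold colGram
  rw [← Finset.sum_erase_add _ _ (Finset.mem_univ k),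
    ← Finset.sum_erase_add (Finset.univ) _ (Finset.mem_univ k)]
  congr 1
  have : Matrix.vecMulVec (fun i => ((Function.update x k 0 k i : ℝ) : ℂ))
      (fun i => ((Function.update x k 0 k i : ℝ) : ℂ)) = 0 := by
    ext i j; simp [Matrix.vecMulVec_apply]
  rw [this, add_zero]
  refine Finset.sum_congr rfl fun j hj => ?_
  rw [Function.update_of_ne (Finset.ne_of_mem_erase hj)]

theorem continuous_colGram {ι : Type*} {n : ℕ} : Continuous (colGram : (Fin n → ι → ℝ) → Matrix ι ι ℂ) := by
  unfold colGram Matrix.vecMulVec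
  refine continuous_finsetSum _ fun k _ => ?_
  refine continuous_matrix fun i j => ?_
  simp only [Matrix.of_apply]
  fun_prop

theorem continuous_update_zero {ι : Type*} {n : ℕ} (k : Fin n) :
    Continuous fun x : Fin n → ι → ℝ => Function.update x k 0 :=
  continuous_id.update k continuous_const

section ColumnResolvent

variable {ι : Type*} [Fintype ι] [DecidableEq ι] {n : ℕ}

/-- The trace of the resolvent normalized by the number of columns. -/
noncomputable def colTrace (x : Fin n → ι → ℝ) (z : ℂ) : ℂ :=
  (n : ℂ)⁻¹ * (sqResolvent (colGram x) z).trace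

/-- The quadratic form of the `k`-th column in the resolvent of the other columns. -/
noncomputable def colForm (x : Fin n → ι → ℝ) (k : Fin n) (z : ℂ) : ℂ :=
  resolventForm (colGram (Function.update x k 0)) z (x k)

theorem continuous_sqResolvent_colGram {z : ℂ} (hz : 0 < z.im) :
    Continuous fun x : Fin n → ι → ℝ => sqResolvent (colGram x) z := by
  simp only [sqResolvent, Matrix.inv_def, Ring.inverse_eq_inv']
  have h : Continuous fun x : Fin n → ι → ℝ => colGram x - (z ^ 2) • (1 : Matrix ι ι ℂ) :=
    continuous_colGram.sub continuous_const
  have h2 := h.matrix_det.inv₀ fun x => det_sub_sq_ne_zero (isSymmNonneg_colGram x) hz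
  exact (h2.smul h.matrix_adjugate).const_smul z

theorem continuous_colTrace {z : ℂ} (hz : 0 < z.im) :
    Continuous fun x : Fin n → ι → ℝ => colTrace x z :=
  continuous_const.mul (continuous_sqResolvent_colGram hz).matrix_trace

theorem continuous_colForm {z : ℂ} (hz : 0 < z.im) (k : Fin n) :
    Continuous fun x : Fin n → ι → ℝ => colForm x k z := by
  unfold colForm resolventForm
  have h1 : Continuous fun x : Fin n → ι → ℝ => fun i => ((x k i : ℝ) : ℂ) := by fun_prop
  exact h1.dotProduct (((continuous_sqResolvent_colGram hz).comp
    (continuous_update_zero k)).matrix_mulVec h1)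

theorem im_colForm_nonneg (x : Fin n → ι → ℝ) (k : Fin n) {z : ℂ} (hz : 0 < z.im) :
    0 ≤ (colForm x k z).im :=
  im_resolventForm_nonneg (isSymmNonneg_colGram _) hz _

theorem im_add_colForm_le (x : Fin n → ι → ℝ) (k : Fin n) (z : ℂ) :
    z.im + (colForm x k z).im ≤ ‖z + colForm x k z‖ := im_add_resolventForm_le _ _ _

theorem add_colForm_ne_zero (x : Fin n → ι → ℝ) (k : Fin n) {z : ℂ} (hz : 0 < z.im) :
    z + colForm x k z ≠ 0 := add_resolventForm_ne_zero (isSymmNonneg_colGram _) hz _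

theorem norm_inv_add_colForm_le (x : Fin n → ι → ℝ) (k : Fin n) {z : ℂ} (hz : 0 < z.im) :
    ‖(z + colForm x k z)⁻¹‖ ≤ z.im⁻¹ := by
  rw [norm_inv]
  exact inv_anti₀ hz (by linarith [im_add_colForm_le x k z, im_colForm_nonneg x k hz])

theorem norm_colTrace_le (x : Fin n → ι → ℝ) {z : ℂ} (hz : 0 < z.im) :
    ‖colTrace x z‖ ≤ Fintype.card ι / n / z.im := by
  rw [colTrace, norm_mul, norm_inv, Complex.norm_natCast]
  have := norm_trace_sqResolvent_le (isSymmNonneg_colGram x) hz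
  calc _ ≤ (n : ℝ)⁻¹ * (Fintype.card ι / z.im) := by gcongr
    _ = _ := by ring

theorem sum_norm_sq_le_im_colTrace (hn : 0 < n) (x : Fin n → ι → ℝ) {z : ℂ} (hz : 0 < z.im) :
    z.im * ∑ j, ∑ i, ‖sqResolvent (colGram x) z i j‖ ^ 2 ≤ n * (colTrace x z).im := by
  have h := im_trace_sqResolvent (isSymmNonneg_colGram x) hz
  have hn' : (0 : ℝ) < n := by exact_mod_cast hn
  have e : (colTrace x z).im = (n : ℝ)⁻¹ * (sqResolvent (colGram x) z).trace.im := by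
    rw [colTrace, ← Complex.ofReal_natCast, ← Complex.ofReal_inv, Complex.im_ofReal_mul]
  rw [e, mul_inv_cancel_left₀ hn'.ne']
  exact h

theorem im_colTrace_nonneg (hn : 0 < n) (x : Fin n → ι → ℝ) {z : ℂ} (hz : 0 < z.im) :
    0 ≤ (colTrace x z).im := by
  have h := sum_norm_sq_le_im_colTrace hn x hz
  have hn' : (0 : ℝ) < n := by exact_mod_cast hn
  have h1 : 0 ≤ z.im * ∑ j, ∑ i, ‖sqResolvent (colGram x) z i j‖ ^ 2 := by positivity
  exact nonneg_of_mul_nonneg_right (h1.trans h) hn'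

theorem colTrace_sub_update (x : Fin n → ι → ℝ) (k : Fin n) {z : ℂ} (hz : 0 < z.im) :
    colTrace x z - colTrace (Function.update x k 0) z
      = -((n : ℂ)⁻¹ * (resolventSqForm (colGram (Function.update x k 0)) z (x k)
          / (z + colForm x k z))) := by
  rw [colTrace, colGram_eq_update x k,
    trace_sqResolvent_add_vecMulVec (isSymmNonneg_colGram _) hz, colTrace, colForm]
  ring

theorem norm_colTrace_sub_update_mul_le (hn : 0 < n) (x : Fin n → ι → ℝ) (k : Fin n) {z : ℂ}
    (hz : 0 < z.im) :
    ‖colTrace x z - colTrace (Function.update x k 0) z‖ * (n * z.im)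
      ≤ (colForm x k z).im / ‖z + colForm x k z‖ := by
  have h := norm_resolventSqForm_le (isSymmNonneg_colGram (Function.update x k 0)) hz (x k)
  have hn' : (0 : ℝ) < n := by exact_mod_cast hn
  rw [colTrace_sub_update x k hz, norm_neg, norm_mul, norm_inv, Complex.norm_natCast, norm_div]
  have e : (n : ℝ)⁻¹ * (‖resolventSqForm (colGram (Function.update x k 0)) z (x k)‖
      / ‖z + colForm x k z‖) * (n * z.im)
      = (z.im * ‖resolventSqForm (colGram (Function.update x k 0)) z (x k)‖)
      / ‖z + colForm x k z‖ := by
    field_simp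
  rw [e]
  exact div_le_div_of_nonneg_right h (norm_nonneg _)

theorem norm_colTrace_sub_update_le (hn : 0 < n) (x : Fin n → ι → ℝ) (k : Fin n) {z : ℂ}
    (hz : 0 < z.im) :
    ‖colTrace x z - colTrace (Function.update x k 0) z‖ ≤ 1 / (n * z.im) := by
  have hn' : (0 : ℝ) < n := by exact_mod_cast hn
  rw [le_div_iff₀ (by positivity)]
  refine (norm_colTrace_sub_update_mul_le hn x k hz).trans ?_
  refine div_le_one_of_le₀ ?_ (norm_nonneg _)
  linarith [im_add_colForm_le x k z]

/-- Let w = z + qₖ and a = Im w ≤ |w|. The square is at most (a/|w|)² up to scale. If a ≤ 1 this is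
at most a/|w|² = Im(-1/w); if a ≥ 1 it is at most 1 ≤ a. Both Im(-1/w) and a have computable
averages, unlike (a/|w|)². -/
theorem norm_sq_colTrace_sub_update_le (hn : 0 < n) (x : Fin n → ι → ℝ) (k : Fin n) {z : ℂ}
    (hz : 0 < z.im) :
    ‖colTrace x z - colTrace (Function.update x k 0) z‖ ^ 2
      ≤ ((-(z + colForm x k z)⁻¹).im + (z.im + (colForm x k z).im)) / (n * z.im) ^ 2 := by
  have hn' : (0 : ℝ) < n := by exact_mod_cast hn
  have h1 := norm_colTrace_sub_update_mul_le hn x k hz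
  have h2 := im_add_colForm_le x k z
  have h3 := im_colForm_nonneg x k hz
  set w := z + colForm x k z with hw
  set a := z.im + (colForm x k z).im with ha
  have ha0 : 0 < a := by linarith
  have hw0 : 0 < ‖w‖ := by linarith
  have him : (-(w)⁻¹).im = a / ‖w‖ ^ 2 := by
    rw [Complex.neg_im, Complex.inv_im, Complex.normSq_eq_norm_sq, hw, Complex.add_im, ← ha]
    ring
  rw [le_div_iff₀ (by positivity), ← mul_pow, him]
  have h4 : ‖colTrace x z - colTrace (Function.update x k 0) z‖ * (n * z.im) ≤ a / ‖w‖ :=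
    h1.trans (div_le_div_of_nonneg_right (by linarith) hw0.le)
  have h5 : (‖colTrace x z - colTrace (Function.update x k 0) z‖ * (n * z.im)) ^ 2
      ≤ (a / ‖w‖) ^ 2 := pow_le_pow_left₀ (by positivity) h4 2
  refine h5.trans ?_
  rcases le_total a 1 with h | h
  · have : (a / ‖w‖) ^ 2 ≤ a / ‖w‖ ^ 2 := by
      rw [div_pow]
      exact div_le_div_of_nonneg_right (by nlinarith) (by positivity)
    linarith
  · have h6 : a / ‖w‖ ≤ 1 := div_le_one_of_le₀ h2 (norm_nonneg _)
    have : (a / ‖w‖) ^ 2 ≤ 1 := pow_le_one₀ (by positivity) h6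
    have : 0 ≤ a / ‖w‖ ^ 2 := by positivity
    linarith

/-- The averaged identity linking the column quadratic forms with the trace. -/
theorem avg_inv_add_colForm (hn : 0 < n) (x : Fin n → ι → ℝ) {z : ℂ} (hz : 0 < z.im) :
    (n : ℂ)⁻¹ * ∑ k, -(z + colForm x k z)⁻¹
      = colTrace x z - (1 - (Fintype.card ι / n : ℂ)) / z := by
  have hz0 : z ≠ 0 := by rintro rfl; simp at hz
  have hn' : (n : ℂ) ≠ 0 := by exact_mod_cast hn.ne'
  have hk : ∀ k, z * (1 - z * (z + colForm x k z)⁻¹)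
      = (sqResolvent (colGram x) z *
          Matrix.vecMulVec (fun i => (x k i : ℂ)) (fun i => (x k i : ℂ))).trace := by
    intro k
    have h := resolventForm_add_vecMulVec (isSymmNonneg_colGram (Function.update x k 0)) hz (x k)
    rw [← colGram_eq_update x k] at h
    rw [← div_eq_mul_inv, colForm, ← h, Matrix.mul_vecMulVec, Matrix.trace_vecMulVec,
      dotProduct_comm]
    rfl
  -- The summands are the forms cₖᵀRcₖ in the full resolvent, so their sum is tr(NR) = z p + z² tr
  -- R, with p the number of rows.
  have hsum : ∑ k, z * (1 - z * (z + colForm x k z)⁻¹)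
      = z * Fintype.card ι + z ^ 2 * (sqResolvent (colGram x) z).trace := by
    simp only [hk]
    rw [← Matrix.trace_sum, ← Finset.mul_sum, Matrix.trace_mul_comm]
    change (colGram x * sqResolvent (colGram x) z).trace = _
    rw [mul_sqResolvent (isSymmNonneg_colGram x) hz, Matrix.trace_add, Matrix.trace_smul,
      Matrix.trace_smul, Matrix.trace_one, smul_eq_mul, smul_eq_mul]
  have hsum2 : ∑ k, z * (1 - z * (z + colForm x k z)⁻¹)
      = z * n + z ^ 2 * ∑ k, -(z + colForm x k z)⁻¹ := by
    have : ∀ k, z * (1 - z * (z + colForm x k z)⁻¹) = z + z ^ 2 * -(z + colForm x k z)⁻¹ :=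
      fun k => by ring
    simp only [this]
    rw [Finset.sum_add_distrib, ← Finset.mul_sum]
    simp [mul_comm]
  rw [hsum2] at hsum
  rw [colTrace]
  generalize ∑ k, -(z + colForm x k z)⁻¹ = S at hsum ⊢
  generalize (sqResolvent (colGram x) z).trace = T at hsum ⊢
  have h2 : z * S = Fintype.card ι + z * T - n := by
    apply mul_left_cancel₀ hz0
    linear_combination hsum
  field_simp
  linear_combination h2

end ColumnResolvent

/-! ### Product measures and the Efron–Stein inequality -/

/-- Resampling one coordinate preserves a product measure. -/
theorem measurePreserving_update {ι : Type*} [Fintype ι] [DecidableEq ι] {E : Type*}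
    [MeasurableSpace E] (π : ι → Measure E) [∀ k, IsProbabilityMeasure (π k)] (k : ι) :
    MeasurePreserving (fun q : (ι → E) × E => Function.update q.1 k q.2)
      ((Measure.pi π).prod (π k)) (Measure.pi π) := by
  have hm : Measurable (fun q : (ι → E) × E => Function.update q.1 k q.2) := by
    refine measurable_pi_iff.2 fun j => ?_
    by_cases h : j = k
    · subst h; simpa using measurable_snd
    · simp only [Function.update_of_ne h]
      exact (measurable_pi_apply j).comp measurable_fst
  refine ⟨hm, ?_⟩
  refine (Measure.pi_eq fun s hs => ?_).symm
  rw [Measure.map_apply hm (MeasurableSet.univ_pi hs)]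
  have : (fun q : (ι → E) × E => Function.update q.1 k q.2) ⁻¹' Set.univ.pi s
      = (Set.univ.pi (Function.update s k Set.univ)) ×ˢ s k := by
    ext ⟨x, c⟩
    simp only [Set.mem_preimage, Set.mem_pi, Set.mem_univ, true_implies, Set.mem_prod]
    constructor
    · intro h
      refine ⟨fun j => ?_, by simpa using h k⟩
      by_cases hj : j = k
      · subst hj; simp
      · simpa [Function.update_of_ne hj] using h j
    · rintro ⟨h1, h2⟩ j
      by_cases hj : j = k
      · subst hj; simpa using h2
      · simpa [Function.update_of_ne hj] using h1 j
  rw [this, Measure.prod_prod, Measure.pi_pi, ← Finset.prod_erase_mul _ _ (Finset.mem_univ k),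
    ← Finset.prod_erase_mul Finset.univ (fun i => π i (s i)) (Finset.mem_univ k)]
  simp only [Function.update_self, measure_univ, mul_one]
  congr 1
  refine Finset.prod_congr rfl fun j hj => ?_
  rw [Function.update_of_ne (Finset.ne_of_mem_erase hj)]

theorem integral_eq_integral_update {ι : Type*} [Fintype ι] [DecidableEq ι] {E : Type*}
    [MeasurableSpace E] (π : ι → Measure E) [∀ k, IsProbabilityMeasure (π k)] (k : ι)
    {F : Type*} [NormedAddCommGroup F] [NormedSpace ℝ F] {f : (ι → E) → F}
    (hf : Integrable f (Measure.pi π)) :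
    ∫ x, f x ∂(Measure.pi π) = ∫ x, ∫ c, f (Function.update x k c) ∂(π k) ∂(Measure.pi π) := by
  have hmp := measurePreserving_update π k
  have h1 : Integrable (fun q : (ι → E) × E => f (Function.update q.1 k q.2))
      ((Measure.pi π).prod (π k)) := hmp.integrable_comp_of_integrable hf
  rw [← integral_prod _ h1, ← integral_map hmp.measurable.aemeasurable]
  · rw [hmp.map_eq]
  · rw [hmp.map_eq]; exact hf.aestronglyMeasurable

theorem integrable_of_measurable_bdd {Ω : Type*} [MeasurableSpace Ω] (μ : Measure Ω)
    [IsFiniteMeasure μ] {f : Ω → ℝ} (hf : Measurable f) {C : ℝ} (hC : ∀ x, |f x| ≤ C) :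
    Integrable f μ :=
  Integrable.of_bound hf.aestronglyMeasurable C (ae_of_all _ hC)

theorem abs_integral_le_of_bdd {Ω : Type*} [MeasurableSpace Ω] (μ : Measure Ω)
    [IsProbabilityMeasure μ] {f : Ω → ℝ} {C : ℝ} (hC : ∀ x, |f x| ≤ C) : |∫ x, f x ∂μ| ≤ C := by
  simpa using norm_integral_le_of_norm_le_const (μ := μ) (f := f) (ae_of_all _ hC)

theorem sq_integral_le {Ω : Type*} [MeasurableSpace Ω] (μ : Measure Ω) [IsProbabilityMeasure μ]
    {f : Ω → ℝ} (hf : Measurable f) {C : ℝ} (hC : ∀ x, |f x| ≤ C) :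
    (∫ x, f x ∂μ) ^ 2 ≤ ∫ x, f x ^ 2 ∂μ := by
  have hL : MemLp f 2 μ := MemLp.of_bound hf.aestronglyMeasurable C (ae_of_all _ hC)
  have h1 := variance_eq_sub hL
  have h2 := variance_nonneg f μ
  simp only [Pi.pow_apply] at h1
  linarith

theorem integral_sq_sub_integral_le {Ω : Type*} [MeasurableSpace Ω] (μ : Measure Ω)
    [IsProbabilityMeasure μ] {f : Ω → ℝ} (hf : Measurable f) {C : ℝ} (hC : ∀ x, |f x| ≤ C) (a : ℝ) :
    ∫ x, (f x - ∫ y, f y ∂μ) ^ 2 ∂μ ≤ ∫ x, (f x - a) ^ 2 ∂μ := by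
  have i1 := integrable_of_measurable_bdd μ hf hC
  have i2 : Integrable (fun x => f x ^ 2) μ :=
    integrable_of_measurable_bdd μ (hf.pow_const 2) (C := C ^ 2) fun x => by
      rw [abs_pow]; exact pow_le_pow_left₀ (abs_nonneg _) (hC x) 2
  have key : ∀ b : ℝ, ∫ x, (f x - b) ^ 2 ∂μ = ∫ x, f x ^ 2 ∂μ - 2 * b * ∫ x, f x ∂μ + b ^ 2 := by
    intro b
    have : ∀ x, (f x - b) ^ 2 = f x ^ 2 - 2 * b * f x + b ^ 2 := fun x => by ring
    simp only [this]
    have i3 : Integrable (fun x => f x ^ 2 - 2 * b * f x) μ := i2.sub (i1.const_mul _)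
    rw [integral_add i3 (integrable_const _),
      integral_sub i2 (i1.const_mul _), integral_const_mul]
    simp
  rw [key, key]
  nlinarith [sq_nonneg (∫ x, f x ∂μ - a)]

/-- The Efron-Stein inequality for bounded functions of independent variables. -/
theorem efronStein {E : Type*} [MeasurableSpace E] (a : E) :
    ∀ {n : ℕ} (π : Fin n → Measure E) [∀ k, IsProbabilityMeasure (π k)] {f : (Fin n → E) → ℝ}
      (_ : Measurable f) {C : ℝ} (_ : ∀ x, |f x| ≤ C),
      ∫ x, (f x - ∫ x', f x' ∂(Measure.pi π)) ^ 2 ∂(Measure.pi π)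
        ≤ ∑ k, ∫ x, (f x - f (Function.update x k a)) ^ 2 ∂(Measure.pi π) := by
  intro n
  induction n with
  | zero =>
    intro π _ f hf C hC
    have : ∀ x, f x - ∫ x', f x' ∂(Measure.pi π) = 0 := by
      intro x
      have : ∀ x', f x' = f x := fun x' => congrArg f (Subsingleton.elim _ _)
      simp [this]
    simp [this]
  | succ n ih =>
    intro π _ f hf C hC
    set P := Measure.pi fun j : Fin n => π j.succ with hP
    have hmp : MeasurePreserving (fun q : E × (Fin n → E) => (Fin.cons q.1 q.2 : Fin (n + 1) → E))
        ((π 0).prod P) (Measure.pi π) := by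
      have := (measurePreserving_piFinSuccAbove π 0).symm
      simpa [MeasurableEquiv.piFinSuccAbove, Fin.insertNthEquiv, Fin.insertNth_zero] using this
    have hcm := hmp.measurable
    have hI : ∀ {g : (Fin (n + 1) → E) → ℝ} (_ : Measurable g) {D : ℝ} (_ : ∀ x, |g x| ≤ D),
        ∫ x, g x ∂(Measure.pi π) = ∫ u, ∫ w, g (Fin.cons u w) ∂P ∂(π 0) := by
      intro g hg D hD
      have h1 : Integrable (fun q : E × (Fin n → E) => g (Fin.cons q.1 q.2)) ((π 0).prod P) :=
        integrable_of_measurable_bdd _ (hg.comp hcm) fun q => hD _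
      rw [← integral_prod _ h1, ← hmp.map_eq, integral_map hcm.aemeasurable hg.aestronglyMeasurable]
    have hfc : Measurable fun q : E × (Fin n → E) => f (Fin.cons q.1 q.2) := hf.comp hcm
    have hsec : ∀ u, Measurable fun w : Fin n → E => f (Fin.cons u w) := fun u =>
      hfc.comp measurable_prodMk_left
    set h : E → ℝ := fun u => ∫ w, f (Fin.cons u w) ∂P with hh
    have hhm : Measurable h := hfc.stronglyMeasurable.integral_prod_right'.measurable
    have hhC : ∀ u, |h u| ≤ C := by
      intro u
      exact abs_integral_le_of_bdd P fun w => hC (Fin.cons u w)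
    have hC0 : 0 ≤ C := (abs_nonneg _).trans (hhC a)
    set m := ∫ x', f x' ∂(Measure.pi π) with hm
    have hmh : m = ∫ u, h u ∂(π 0) := hI hf hC
    have hmC : |m| ≤ C := by
      exact abs_integral_le_of_bdd (Measure.pi π) fun w => hC w
    have bsq : ∀ {s t : ℝ}, |s| ≤ C → |t| ≤ C → |(s - t) ^ 2| ≤ (2 * C) ^ 2 := by
      intro s t hs ht
      rw [abs_pow]
      refine pow_le_pow_left₀ (abs_nonneg _) ?_ 2
      exact (abs_sub s t).trans (by linarith)
    -- conditional decomposition on the first coordinate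
    have hdec : ∀ u, ∫ w, (f (Fin.cons u w) - m) ^ 2 ∂P
        = ∫ w, (f (Fin.cons u w) - h u) ^ 2 ∂P + (h u - m) ^ 2 := by
      intro u
      have i1 := integrable_of_measurable_bdd P (hsec u) (fun w => hC _)
      have i2 : Integrable (fun w => (f (Fin.cons u w) - h u) ^ 2) P :=
        integrable_of_measurable_bdd P (((hsec u).sub_const _).pow_const 2)
          fun w => bsq (hC _) (hhC u)
      have : ∀ w, (f (Fin.cons u w) - m) ^ 2 = (f (Fin.cons u w) - h u) ^ 2
          + (2 * (h u - m)) * (f (Fin.cons u w) - h u) + (h u - m) ^ 2 := fun w => by ring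
      have h0 : ∫ w, (f (Fin.cons u w) - h u) ∂P = 0 := by
        rw [integral_sub i1 (integrable_const _)]; simp [hh]
      simp only [this]
      have i3 : Integrable (fun w => (2 * (h u - m)) * (f (Fin.cons u w) - h u)) P :=
        (i1.sub (integrable_const _)).const_mul _
      have i4 : Integrable (fun w => (f (Fin.cons u w) - h u) ^ 2
          + (2 * (h u - m)) * (f (Fin.cons u w) - h u)) P := i2.add i3
      rw [integral_add i4 (integrable_const _), integral_add i2 i3, integral_const_mul, h0]
      simp
    have hjm : ∀ (g : (Fin (n + 1) → E) → ℝ), Measurable g → (∀ x, |g x| ≤ (2 * C) ^ 2) →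
        Integrable (fun u => ∫ w, g (Fin.cons u w) ∂P) (π 0) := by
      intro g hg hgb
      refine integrable_of_measurable_bdd _
        (hg.comp hcm).stronglyMeasurable.integral_prod_right'.measurable (C := (2 * C) ^ 2) ?_
      intro u
      exact abs_integral_le_of_bdd P fun w => hgb (Fin.cons u w)
    have hupd : ∀ k : Fin (n + 1), Measurable fun x : Fin (n + 1) → E => f (Function.update x k a) :=
      fun k => hf.comp (measurable_update'.comp (measurable_id.prodMk measurable_const))
    have hgk : ∀ k : Fin (n + 1), Measurable
        fun x : Fin (n + 1) → E => (f x - f (Function.update x k a)) ^ 2 :=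
      fun k => (hf.sub (hupd k)).pow_const 2
    have hgkb : ∀ (k : Fin (n + 1)) x, |(f x - f (Function.update x k a)) ^ 2| ≤ (2 * C) ^ 2 :=
      fun k x => bsq (hC _) (hC _)
    have hm2 : Integrable (fun u => (h u - m) ^ 2) (π 0) :=
      integrable_of_measurable_bdd _ ((hhm.sub_const _).pow_const 2) fun u => bsq (hhC u) hmC
    have hleft : ∫ x, (f x - m) ^ 2 ∂(Measure.pi π)
        = ∫ u, (∫ w, (f (Fin.cons u w) - h u) ^ 2 ∂P + (h u - m) ^ 2) ∂(π 0) := by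
      rw [hI ((hf.sub_const m).pow_const 2) (D := (2 * C) ^ 2) fun x => bsq (hC _) hmC]
      exact integral_congr_ae (ae_of_all _ hdec)
    have hfirst : ∫ u, (h u - m) ^ 2 ∂(π 0)
        ≤ ∫ x, (f x - f (Function.update x 0 a)) ^ 2 ∂(Measure.pi π) := by
      -- The mean minimizes the mean square deviation, so the mean of h may be replaced by the fixed
      -- value h a. Jensen's inequality in the remaining coordinates then gives the increment of f.
      -- No independent copy is needed.
      rw [hmh]
      refine (integral_sq_sub_integral_le (π 0) hhm hhC (h a)).trans ?_
      rw [hI (hgk 0) (hgkb 0)]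
      refine integral_mono ?_ (hjm _ (hgk 0) (hgkb 0)) fun u => ?_
      · exact integrable_of_measurable_bdd _ ((hhm.sub_const _).pow_const 2)
          fun u => bsq (hhC u) (hhC a)
      · simp only [Fin.update_cons_zero]
        have e : h u - h a = ∫ w, (f (Fin.cons u w) - f (Fin.cons a w)) ∂P :=
          (integral_sub (integrable_of_measurable_bdd P (hsec u) (fun w => hC _))
            (integrable_of_measurable_bdd P (hsec a) (fun w => hC _))).symm
        rw [e]
        exact sq_integral_le P ((hsec u).sub (hsec a)) (C := 2 * C) fun w =>
          (abs_sub _ _).trans (by linarith [hC (Fin.cons u w), hC (Fin.cons a w)])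
    have hrest : ∫ u, ∫ w, (f (Fin.cons u w) - h u) ^ 2 ∂P ∂(π 0)
        ≤ ∑ k : Fin n, ∫ x, (f x - f (Function.update x k.succ a)) ^ 2 ∂(Measure.pi π) := by
      have e : ∀ k : Fin n, ∫ x, (f x - f (Function.update x k.succ a)) ^ 2 ∂(Measure.pi π)
          = ∫ u, ∫ w, (f (Fin.cons u w) - f (Fin.cons u (Function.update w k a))) ^ 2 ∂P ∂(π 0) := by
        intro k
        rw [hI (hgk k.succ) (hgkb k.succ)]
        simp only [Fin.cons_update]
      have hik : ∀ k : Fin n, Integrable (fun u => ∫ w, (f (Fin.cons u w)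
          - f (Fin.cons u (Function.update w k a))) ^ 2 ∂P) (π 0) := by
        intro k
        have := hjm _ (hgk k.succ) (hgkb k.succ)
        simpa only [Fin.cons_update] using this
      simp only [e]
      rw [← integral_finsetSum _ fun k _ => hik k]
      refine integral_mono ?_ (integrable_finsetSum _ fun k _ => hik k) fun u => ?_
      · have hmeas : Measurable fun q : E × (Fin n → E) => (f (Fin.cons q.1 q.2) - h q.1) ^ 2 :=
          (hfc.sub (hhm.comp measurable_fst)).pow_const 2
        refine integrable_of_measurable_bdd _
          hmeas.stronglyMeasurable.integral_prod_right'.measurable (C := (2 * C) ^ 2) fun u => ?_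
        exact abs_integral_le_of_bdd P fun w => bsq (hC (Fin.cons u w)) (hhC u)
      · exact ih (fun j => π j.succ) (hsec u) (fun w => hC _)
    have hi1 : Integrable (fun u => ∫ w, (f (Fin.cons u w) - h u) ^ 2 ∂P) (π 0) := by
      have hmeas : Measurable fun q : E × (Fin n → E) => (f (Fin.cons q.1 q.2) - h q.1) ^ 2 :=
        (hfc.sub (hhm.comp measurable_fst)).pow_const 2
      refine integrable_of_measurable_bdd _
        hmeas.stronglyMeasurable.integral_prod_right'.measurable (C := (2 * C) ^ 2) fun u => ?_
      exact abs_integral_le_of_bdd P fun w => bsq (hC (Fin.cons u w)) (hhC u)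
    rw [hleft, integral_add hi1 hm2, Fin.sum_univ_succ]
    linarith

/-! ### Concentration of quadratic forms -/

instance holderTriple_four_four_two : ENNReal.HolderTriple 4 4 2 where
  inv_add_inv_eq_inv := by
    have h : (4 : ENNReal)⁻¹ + 4⁻¹ = 2 * 4⁻¹ := by rw [two_mul]
    rw [h, show (4 : ENNReal) = 2 * 2 by norm_num, ENNReal.mul_inv (by simp) (by simp), ← mul_assoc,
      ENNReal.mul_inv_cancel (by simp) (by simp), one_mul]

section QuadraticForm

variable {Ω : Type*} [MeasurableSpace Ω] {μ : Measure Ω} {ι : Type*}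
  {c : ι → Ω → ℝ} {s K : ℝ}

theorem integral_mul_of_iIndepFun (hm : ∀ i, Measurable (c i)) (hind : iIndepFun c μ)
    (h0 : ∀ i, ∫ ω, c i ω ∂μ = 0) {i j : ι} (hij : i ≠ j) : ∫ ω, c i ω * c j ω ∂μ = 0 := by
  rw [(hind.indepFun hij).integral_fun_mul_eq_mul_integral (hm i).aestronglyMeasurable
    (hm j).aestronglyMeasurable, h0 i, zero_mul]

theorem memLp_mul_of_four (h4 : ∀ i, MemLp (c i) 4 μ) (i j : ι) :
    MemLp (fun ω => c i ω * c j ω) 2 μ := (h4 j).mul (h4 i)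

theorem integral_sq_linear [IsProbabilityMeasure μ] (hm : ∀ i, Measurable (c i)) (h4 : ∀ i, MemLp (c i) 4 μ)
    (hind : iIndepFun c μ) (h0 : ∀ i, ∫ ω, c i ω ∂μ = 0) (h2 : ∀ i, ∫ ω, c i ω ^ 2 ∂μ = s)
    (S : Finset ι) (b : ι → ℝ) :
    ∫ ω, (∑ j ∈ S, b j * c j ω) ^ 2 ∂μ = s * ∑ j ∈ S, b j ^ 2 := by
  have hi : ∀ i j, Integrable (fun ω => (b i * b j) * (c i ω * c j ω)) μ := fun i j =>
    ((memLp_mul_of_four h4 i j).integrable one_le_two).const_mul _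
  have e : ∀ ω, (∑ j ∈ S, b j * c j ω) ^ 2
      = ∑ i ∈ S, ∑ j ∈ S, (b i * b j) * (c i ω * c j ω) := by
    intro ω
    rw [sq, Finset.sum_mul_sum]
    exact Finset.sum_congr rfl fun i _ => Finset.sum_congr rfl fun j _ => by ring
  simp only [e]
  rw [integral_finsetSum _ fun i _ => integrable_finsetSum _ fun j _ => hi i j, Finset.mul_sum]
  refine Finset.sum_congr rfl fun i hiS => ?_
  rw [integral_finsetSum _ fun j _ => hi i j, Finset.sum_eq_single i]
  · rw [integral_const_mul, ← h2 i]
    have : ∀ ω, c i ω * c i ω = c i ω ^ 2 := fun ω => by ring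
    simp only [this]; ring
  · intro j _ hji
    rw [integral_const_mul, integral_mul_of_iIndepFun hm hind h0 hji.symm, mul_zero]
  · exact fun h => absurd hiS h

variable [IsProbabilityMeasure μ]

theorem memLp_quadratic (h4 : ∀ i, MemLp (c i) 4 μ) (S : Finset ι) (B : ι → ι → ℝ) (a : ℝ) :
    MemLp (fun ω => (∑ i ∈ S, ∑ j ∈ S, B i j * (c i ω * c j ω)) - a) 2 μ :=
  (memLp_finsetSum _ fun i _ => memLp_finsetSum _ fun j _ =>
    (memLp_mul_of_four h4 i j).const_mul _).sub (memLp_const _)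

/-- Variance bound for quadratic forms in independent variables. -/
theorem integral_sq_quadratic_le (hm : ∀ i, Measurable (c i)) (h4 : ∀ i, MemLp (c i) 4 μ)
    (hind : iIndepFun c μ) (h0 : ∀ i, ∫ ω, c i ω ∂μ = 0) (h2 : ∀ i, ∫ ω, c i ω ^ 2 ∂μ = s)
    (hK : ∀ i, ∫ ω, c i ω ^ 4 ∂μ ≤ K) (hsK : s ^ 2 ≤ K) {B : ι → ι → ℝ}
    (hB : ∀ i j, B i j = B j i) (S : Finset ι) :
    ∫ ω, ((∑ i ∈ S, ∑ j ∈ S, B i j * (c i ω * c j ω)) - s * ∑ i ∈ S, B i i) ^ 2 ∂μ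
      ≤ 8 * K * ∑ i ∈ S, ∑ j ∈ S, B i j ^ 2 := by
  classical
  have hKnn : 0 ≤ K := (sq_nonneg s).trans hsK
  -- Adding indices one at a time gives a martingale decomposition: V depends only on the indices in
  -- S, and the increment is orthogonal to it, so second moments add.
  induction S using Finset.induction_on with
  | empty => simp
  | insert a S ha ih =>
    set V : Ω → ℝ := fun ω => (∑ i ∈ S, ∑ j ∈ S, B i j * (c i ω * c j ω)) - s * ∑ i ∈ S, B i i
      with hV
    set l : Ω → ℝ := fun ω => ∑ j ∈ S, B a j * c j ω with hl
    set d : Ω → ℝ := fun ω => c a ω ^ 2 - s with hd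
    have hVL : MemLp V 2 μ := memLp_quadratic h4 S B _
    have hl4 : MemLp l 4 μ := memLp_finsetSum _ fun j _ => (h4 j).const_mul _
    have hsq : MemLp (fun ω => c a ω ^ 2) 2 μ := by
      simpa only [sq] using memLp_mul_of_four h4 a a
    have hdL : MemLp d 2 μ := hsq.sub (memLp_const _)
    have hclL : MemLp (fun ω => c a ω * l ω) 2 μ := hl4.mul (h4 a)
    have hl2 : MemLp l 2 μ := hl4.mono_exponent (by norm_num)
    have hVm : Measurable V := by
      refine Measurable.sub_const (Finset.measurable_fun_sum _ fun i _ =>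
        Finset.measurable_fun_sum _ fun j _ => ?_) _
      exact ((hm i).mul (hm j)).const_mul _
    have hlm : Measurable l := Finset.measurable_fun_sum _ fun j _ => (hm j).const_mul _
    have hdm : Measurable d := ((hm a).pow_const 2).sub_const _
    -- independence of the new variable
    have hI := hind.indepFun_finset S {a} (Finset.disjoint_singleton_right.2 ha) hm
    let VV : (S → ℝ) → ℝ := fun w =>
      (∑ i : S, ∑ j : S, B i j * (w i * w j)) - s * ∑ i ∈ S, B i i
    let ll : (S → ℝ) → ℝ := fun w => ∑ j : S, B a j * w j
    have hVVm : Measurable VV := by unfold VV; fun_prop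
    have hllm : Measurable ll := by unfold ll; fun_prop
    have hVV : ∀ ω, VV (fun i : S => c i ω) = V ω := by
      intro ω
      simp only [VV, hV]
      congr 1
      rw [← Finset.sum_coe_sort S]
      refine Finset.sum_congr rfl fun i _ => ?_
      rw [← Finset.sum_coe_sort S]
    have hll : ∀ ω, ll (fun i : S => c i ω) = l ω := by
      intro ω
      simp only [ll, hl]
      rw [← Finset.sum_coe_sort S]
    have hψ : Measurable fun w : ({a} : Finset ι) → ℝ => w ⟨a, Finset.mem_singleton_self a⟩ :=
      measurable_pi_apply _
    have hI1 : IndepFun (fun ω => V ω * l ω) (c a) μ := by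
      have := hI.comp (hVVm.mul hllm) hψ
      have e : ((VV * ll) ∘ fun ω (i : S) => c i ω) = fun ω => V ω * l ω := by
        ext ω; simp only [Function.comp, Pi.mul_apply, hVV, hll]
      rw [e] at this
      exact this
    have hI2 : IndepFun V d μ := by
      have := hI.comp (φ := VV) (ψ := fun w : ({a} : Finset ι) → ℝ =>
        w ⟨a, Finset.mem_singleton_self a⟩ ^ 2 - s) hVVm (by fun_prop)
      have e : (VV ∘ fun ω (i : S) => c i ω) = V := by
        ext ω; simp only [Function.comp, hVV]
      rw [e] at this
      exact this
    have hI3 : IndepFun (fun ω => c a ω ^ 2) (fun ω => l ω ^ 2) μ := by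
      have := hI.comp (φ := fun w => ll w ^ 2) (ψ := fun w : ({a} : Finset ι) → ℝ =>
        w ⟨a, Finset.mem_singleton_self a⟩ ^ 2) (hllm.pow_const 2) (by fun_prop)
      have e : ((fun w => ll w ^ 2) ∘ fun ω (i : S) => c i ω) = fun ω => l ω ^ 2 := by
        ext ω; simp only [Function.comp, hll]
      rw [e] at this
      exact this.symm
    -- decomposition
    have hdec : ∀ ω, (∑ i ∈ insert a S, ∑ j ∈ insert a S, B i j * (c i ω * c j ω))
        - s * ∑ i ∈ insert a S, B i i = V ω + (2 * (c a ω * l ω) + B a a * d ω) := by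
      intro ω
      simp only [Finset.sum_insert ha, Finset.sum_add_distrib, hV, hl, hd]
      have e1 : ∑ i ∈ S, B i a * (c i ω * c a ω) = c a ω * ∑ j ∈ S, B a j * c j ω := by
        rw [Finset.mul_sum]
        exact Finset.sum_congr rfl fun i _ => by rw [hB i a]; ring
      have e2 : ∑ i ∈ S, B a i * (c a ω * c i ω) = c a ω * ∑ j ∈ S, B a j * c j ω := by
        rw [Finset.mul_sum]
        exact Finset.sum_congr rfl fun i _ => by ring
      rw [e1, e2]; ring
    have hsB : ∑ i ∈ insert a S, ∑ j ∈ insert a S, B i j ^ 2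
        = ∑ i ∈ S, ∑ j ∈ S, B i j ^ 2 + 2 * ∑ j ∈ S, B a j ^ 2 + B a a ^ 2 := by
      simp only [Finset.sum_insert ha, Finset.sum_add_distrib]
      have : ∑ i ∈ S, B i a ^ 2 = ∑ j ∈ S, B a j ^ 2 :=
        Finset.sum_congr rfl fun i _ => by rw [hB i a]
      rw [this]; ring
    set U : Ω → ℝ := fun ω => 2 * (c a ω * l ω) + B a a * d ω with hU
    have hUL : MemLp U 2 μ := (hclL.const_mul 2).add (hdL.const_mul _)
    have hcross : ∫ ω, V ω * U ω ∂μ = 0 := by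
      have i1 : Integrable (fun ω => 2 * ((V ω * l ω) * c a ω)) μ := by
        have := (hVL.integrable_mul hclL).const_mul 2
        refine this.congr (ae_of_all _ fun ω => ?_)
        simp only [Pi.mul_apply]; ring
      have i2 : Integrable (fun ω => B a a * (V ω * d ω)) μ := (hVL.integrable_mul hdL).const_mul _
      have e : ∀ ω, V ω * U ω = 2 * ((V ω * l ω) * c a ω) + B a a * (V ω * d ω) := fun ω => by
        simp only [hU]; ring
      simp only [e]
      rw [integral_add i1 i2, integral_const_mul, integral_const_mul,
        hI1.integral_fun_mul_eq_mul_integral (hVm.mul hlm).aestronglyMeasurable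
          (hm a).aestronglyMeasurable, h0 a,
        hI2.integral_fun_mul_eq_mul_integral hVm.aestronglyMeasurable hdm.aestronglyMeasurable]
      have : ∫ ω, d ω ∂μ = 0 := by
        simp only [hd]
        rw [integral_sub (hsq.integrable one_le_two) (integrable_const _), h2 a]; simp
      rw [this]; ring
    have hUsq : ∫ ω, U ω ^ 2 ∂μ ≤ 8 * K * (2 * ∑ j ∈ S, B a j ^ 2 + B a a ^ 2) := by
      have j1 := hclL.integrable_sq
      have j2 := hdL.integrable_sq
      -- From (x + y)² ≤ 2x² + 2y². The first part integrates to 8s²∑B² ≤ 8K∑B², the second to at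
      -- most 2K B_aa² because E d² = E c_a⁴ - s² ≤ K. Both fit under the claimed 8K.
      have hle : ∫ ω, U ω ^ 2 ∂μ ≤ ∫ ω, (8 * (c a ω * l ω) ^ 2 + 2 * B a a ^ 2 * d ω ^ 2) ∂μ := by
        refine integral_mono hUL.integrable_sq ((j1.const_mul _).add (j2.const_mul _)) fun ω => ?_
        simp only [hU]
        nlinarith [sq_nonneg (2 * (c a ω * l ω) - B a a * d ω)]
      rw [integral_add (j1.const_mul _) (j2.const_mul _), integral_const_mul,
        integral_const_mul] at hle
      have k1 : ∫ ω, (c a ω * l ω) ^ 2 ∂μ = s * (s * ∑ j ∈ S, B a j ^ 2) := by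
        simp only [mul_pow]
        rw [hI3.integral_fun_mul_eq_mul_integral ((hm a).pow_const 2).aestronglyMeasurable
          (hlm.pow_const 2).aestronglyMeasurable, h2 a, integral_sq_linear hm h4 hind h0 h2]
      have k2 : ∫ ω, d ω ^ 2 ∂μ ≤ K := by
        have hi4 : Integrable (fun ω => c a ω ^ 4) μ := by
          refine hsq.integrable_sq.congr (ae_of_all _ fun ω => ?_)
          simp only []; ring
        have e : ∀ ω, d ω ^ 2 = c a ω ^ 4 - 2 * s * c a ω ^ 2 + s ^ 2 := fun ω => by
          simp only [hd]; ring
        have i3 : Integrable (fun ω => c a ω ^ 4 - 2 * s * c a ω ^ 2) μ :=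
          hi4.sub ((hsq.integrable one_le_two).const_mul _)
        simp only [e]
        rw [integral_add i3 (integrable_const _),
          integral_sub hi4 ((hsq.integrable one_le_two).const_mul _), integral_const_mul, h2 a]
        simp only [integral_const, probReal_univ, one_smul]
        nlinarith [hK a, sq_nonneg s]
      rw [k1] at hle
      have n1 : 0 ≤ ∑ j ∈ S, B a j ^ 2 := Finset.sum_nonneg fun _ _ => sq_nonneg _
      have n2 : s * (s * ∑ j ∈ S, B a j ^ 2) ≤ K * ∑ j ∈ S, B a j ^ 2 := by
        rw [← mul_assoc, ← sq]; exact mul_le_mul_of_nonneg_right hsK n1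
      have n3 : 2 * B a a ^ 2 * ∫ ω, d ω ^ 2 ∂μ ≤ 2 * B a a ^ 2 * K :=
        mul_le_mul_of_nonneg_left k2 (by positivity)
      nlinarith [mul_nonneg hKnn n1, mul_nonneg hKnn (sq_nonneg (B a a))]
    simp only [hdec]
    have e : ∀ ω, (V ω + U ω) ^ 2 = V ω ^ 2 + 2 * (V ω * U ω) + U ω ^ 2 := fun ω => by ring
    have q0 : Integrable (fun ω => 2 * (V ω * U ω)) μ := (hVL.integrable_mul hUL).const_mul 2
    have q1 : Integrable (fun ω => V ω ^ 2 + 2 * (V ω * U ω)) μ := hVL.integrable_sq.add q0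
    change ∫ ω, (V ω + U ω) ^ 2 ∂μ ≤ _
    simp only [e]
    rw [integral_add q1 hUL.integrable_sq, integral_add hVL.integrable_sq q0,
      integral_const_mul, hcross, hsB]
    linarith

theorem integral_quadratic (hm : ∀ i, Measurable (c i)) (h4 : ∀ i, MemLp (c i) 4 μ)
    (hind : iIndepFun c μ) (h0 : ∀ i, ∫ ω, c i ω ∂μ = 0) (h2 : ∀ i, ∫ ω, c i ω ^ 2 ∂μ = s)
    (B : ι → ι → ℝ) (S : Finset ι) :
    ∫ ω, ∑ i ∈ S, ∑ j ∈ S, B i j * (c i ω * c j ω) ∂μ = s * ∑ i ∈ S, B i i := by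
  have hi : ∀ i j, Integrable (fun ω => B i j * (c i ω * c j ω)) μ := fun i j =>
    ((memLp_mul_of_four h4 i j).integrable one_le_two).const_mul _
  rw [integral_finsetSum _ fun i _ => integrable_finsetSum _ fun j _ => hi i j, Finset.mul_sum]
  refine Finset.sum_congr rfl fun i hiS => ?_
  rw [integral_finsetSum _ fun j _ => hi i j, Finset.sum_eq_single i]
  · rw [integral_const_mul, ← h2 i]
    have : ∀ ω, c i ω * c i ω = c i ω ^ 2 := fun ω => by ring
    simp only [this]; ring
  · intro j _ hji
    rw [integral_const_mul, integral_mul_of_iIndepFun hm hind h0 hji.symm, mul_zero]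
  · exact fun h => absurd hiS h

end QuadraticForm

/-- Second-order concentration of quadratic forms of a random vector with law `π`: the form of `B`
has mean `s tr B` and its variance is at most `K ∑ |B i j|²`. -/
def QuadraticConcentration {ι : Type*} [Fintype ι] (π : Measure (ι → ℝ)) (s K : ℝ) : Prop :=
  ∀ B : Matrix ι ι ℂ, Bᵀ = B →
    MemLp (fun c : ι → ℝ => (fun i => (c i : ℂ)) ⬝ᵥ (B *ᵥ fun i => (c i : ℂ))) 2 π ∧
    ∫ c, (fun i => (c i : ℂ)) ⬝ᵥ (B *ᵥ fun i => (c i : ℂ)) ∂π = s * B.trace ∧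
    ∫ c, ‖(fun i => (c i : ℂ)) ⬝ᵥ (B *ᵥ fun i => (c i : ℂ)) - s * B.trace‖ ^ 2 ∂π
      ≤ K * ∑ j, ∑ i, ‖B i j‖ ^ 2

theorem complex_quadratic_eq {ι : Type*} [Fintype ι] (B : Matrix ι ι ℂ) (c : ι → ℝ) :
    (fun i => (c i : ℂ)) ⬝ᵥ (B *ᵥ fun i => (c i : ℂ))
      = ((∑ i, ∑ j, (B i j).re * (c i * c j) : ℝ) : ℂ)
        + ((∑ i, ∑ j, (B i j).im * (c i * c j) : ℝ) : ℂ) * Complex.I := by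
  simp only [dotProduct, Matrix.mulVec]
  push_cast
  rw [Finset.sum_mul, ← Finset.sum_add_distrib]
  refine Finset.sum_congr rfl fun i _ => ?_
  rw [Finset.mul_sum, Finset.sum_mul, ← Finset.sum_add_distrib]
  refine Finset.sum_congr rfl fun j _ => ?_
  nth_rw 1 [← Complex.re_add_im (B i j)]
  ring

theorem complex_trace_eq {ι : Type*} [Fintype ι] (B : Matrix ι ι ℂ) :
    B.trace = ((∑ i, (B i i).re : ℝ) : ℂ) + ((∑ i, (B i i).im : ℝ) : ℂ) * Complex.I := by
  rw [Matrix.trace]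
  push_cast
  rw [Finset.sum_mul, ← Finset.sum_add_distrib]
  exact Finset.sum_congr rfl fun i _ => (Complex.re_add_im _).symm

theorem norm_sq_complex_quadratic_sub {ι : Type*} [Fintype ι] (B : Matrix ι ι ℂ) (c : ι → ℝ)
    (s : ℝ) :
    ‖(fun i => (c i : ℂ)) ⬝ᵥ (B *ᵥ fun i => (c i : ℂ)) - s * B.trace‖ ^ 2
      = ((∑ i, ∑ j, (B i j).re * (c i * c j)) - s * ∑ i, (B i i).re) ^ 2
        + ((∑ i, ∑ j, (B i j).im * (c i * c j)) - s * ∑ i, (B i i).im) ^ 2 := by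
  have : (fun i => (c i : ℂ)) ⬝ᵥ (B *ᵥ fun i => (c i : ℂ)) - s * B.trace
      = (((∑ i, ∑ j, (B i j).re * (c i * c j)) - s * ∑ i, (B i i).re : ℝ) : ℂ)
        + (((∑ i, ∑ j, (B i j).im * (c i * c j)) - s * ∑ i, (B i i).im : ℝ) : ℂ) * Complex.I := by
    rw [complex_quadratic_eq, complex_trace_eq]
    simp only [Complex.ofReal_sub, Complex.ofReal_mul]
    ring
  rw [this, ← Complex.normSq_eq_norm_sq, Complex.normSq_add_mul_I]

theorem continuous_complex_quadratic {ι : Type*} [Fintype ι] (B : Matrix ι ι ℂ) :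
    Continuous fun c : ι → ℝ => (fun i => (c i : ℂ)) ⬝ᵥ (B *ᵥ fun i => (c i : ℂ)) := by
  simp only [dotProduct, Matrix.mulVec]; fun_prop

/-- Symmetry under transposition, without conjugation, makes the real and imaginary parts of B real
symmetric. The real variance bound applies to each, and the squares recombine to |B i j|². -/
theorem quadraticConcentration_map {Ω : Type*} [MeasurableSpace Ω] {μ : Measure Ω}
    [IsProbabilityMeasure μ] {ι : Type*} [Fintype ι] {c : ι → Ω → ℝ} {s K : ℝ}
    (hm : ∀ i, Measurable (c i)) (h4 : ∀ i, MemLp (c i) 4 μ)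
    (hind : iIndepFun c μ) (h0 : ∀ i, ∫ ω, c i ω ∂μ = 0) (h2 : ∀ i, ∫ ω, c i ω ^ 2 ∂μ = s)
    (hK : ∀ i, ∫ ω, c i ω ^ 4 ∂μ ≤ K) (hsK : s ^ 2 ≤ K) :
    QuadraticConcentration (μ.map fun ω i => c i ω) s (8 * K) := by
  intro B hB
  have hB' : ∀ i j, B i j = B j i := fun i j => by
    conv_lhs => rw [← hB, Matrix.transpose_apply]
  have hmc : Measurable fun ω i => c i ω := measurable_pi_iff.2 hm
  have hform := continuous_complex_quadratic B
  have hXL := memLp_quadratic h4 Finset.univ (fun i j => (B i j).re) 0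
  have hYL := memLp_quadratic h4 Finset.univ (fun i j => (B i j).im) 0
  simp only [sub_zero] at hXL hYL
  have hYI : MemLp (fun ω => ((∑ i, ∑ j, (B i j).im * (c i ω * c j ω) : ℝ) : ℂ) * Complex.I) 2 μ :=
    (hYL.ofReal (K := ℂ)).mul_const Complex.I
  have hXC : MemLp (fun ω => ((∑ i, ∑ j, (B i j).re * (c i ω * c j ω) : ℝ) : ℂ)) 2 μ :=
    hXL.ofReal (K := ℂ)
  refine ⟨?_, ?_, ?_⟩
  · rw [memLp_map_measure_iff hform.aestronglyMeasurable hmc.aemeasurable]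
    refine (hXC.add hYI).ae_eq (ae_of_all _ fun ω => ?_)
    exact (complex_quadratic_eq B _).symm
  · rw [integral_map hmc.aemeasurable hform.aestronglyMeasurable]
    simp only [complex_quadratic_eq]
    rw [integral_add (hXC.integrable one_le_two) (hYI.integrable one_le_two), integral_mul_const,
      integral_complex_ofReal, integral_complex_ofReal,
      integral_quadratic hm h4 hind h0 h2, integral_quadratic hm h4 hind h0 h2, complex_trace_eq]
    simp only [Complex.ofReal_mul]
    ring
  · have hsq : Continuous fun c : ι → ℝ =>
        ‖(fun i => (c i : ℂ)) ⬝ᵥ (B *ᵥ fun i => (c i : ℂ)) - s * B.trace‖ ^ 2 :=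
      (hform.sub continuous_const).norm.pow 2
    rw [integral_map hmc.aemeasurable hsq.aestronglyMeasurable]
    simp only [norm_sq_complex_quadratic_sub]
    have m1 := memLp_quadratic h4 Finset.univ (fun i j => (B i j).re) (s * ∑ i, (B i i).re)
    have m2 := memLp_quadratic h4 Finset.univ (fun i j => (B i j).im) (s * ∑ i, (B i i).im)
    rw [integral_add m1.integrable_sq m2.integrable_sq]
    have b1 := integral_sq_quadratic_le hm h4 hind h0 h2 hK hsK (B := fun i j => (B i j).re)
      (fun i j => by rw [hB' i j]) Finset.univ
    have b2 := integral_sq_quadratic_le hm h4 hind h0 h2 hK hsK (B := fun i j => (B i j).im)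
      (fun i j => by rw [hB' i j]) Finset.univ
    refine (add_le_add b1 b2).trans (le_of_eq ?_)
    rw [← mul_add, ← Finset.sum_add_distrib, Finset.sum_comm (f := fun j i => ‖B i j‖ ^ 2)]
    congr 1
    refine Finset.sum_congr rfl fun i _ => ?_
    rw [← Finset.sum_add_distrib]
    refine Finset.sum_congr rfl fun j _ => ?_
    rw [← Complex.normSq_eq_norm_sq, Complex.normSq_apply]; ring

/-! ### Trace fluctuations and the averaged self-consistent equation -/

theorem norm_integral_le_of_forall {Ω : Type*} [MeasurableSpace Ω] (μ : Measure Ω)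
    [IsProbabilityMeasure μ] {f : Ω → ℂ} {C : ℝ} (hC : ∀ x, ‖f x‖ ≤ C) : ‖∫ x, f x ∂μ‖ ≤ C := by
  simpa using norm_integral_le_of_norm_le_const (μ := μ) (f := f) (ae_of_all _ hC)

/-- The Efron-Stein inequality for bounded complex functions. -/
theorem efronStein_complex {E : Type*} [MeasurableSpace E] (a : E) {n : ℕ} (π : Fin n → Measure E)
    [∀ k, IsProbabilityMeasure (π k)] {f : (Fin n → E) → ℂ} (hf : Measurable f) {C : ℝ}
    (hC : ∀ x, ‖f x‖ ≤ C) :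
    ∫ x, ‖f x - ∫ x', f x' ∂(Measure.pi π)‖ ^ 2 ∂(Measure.pi π)
      ≤ ∑ k, ∫ x, ‖f x - f (Function.update x k a)‖ ^ 2 ∂(Measure.pi π) := by
  set P := Measure.pi π
  have hre : Measurable fun x => (f x).re := Complex.measurable_re.comp hf
  have him : Measurable fun x => (f x).im := Complex.measurable_im.comp hf
  have hreC : ∀ x, |(f x).re| ≤ C := fun x => (Complex.abs_re_le_norm _).trans (hC x)
  have himC : ∀ x, |(f x).im| ≤ C := fun x => (Complex.abs_im_le_norm _).trans (hC x)
  have hfi : Integrable f P := Integrable.of_bound hf.aestronglyMeasurable C (ae_of_all _ hC)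
  set m := ∫ x', f x' ∂P
  have hmC : ‖m‖ ≤ C := norm_integral_le_of_forall P hC
  have hmre : ∫ x, (f x).re ∂P = m.re := integral_re hfi
  have hmim : ∫ x, (f x).im ∂P = m.im := integral_im hfi
  have h1 := efronStein a π hre hreC
  have h2 := efronStein a π him himC
  rw [hmre] at h1
  rw [hmim] at h2
  have e : ∀ w w' : ℂ, ‖w - w'‖ ^ 2 = (w.re - w'.re) ^ 2 + (w.im - w'.im) ^ 2 := by
    intro w w'
    rw [← Complex.normSq_eq_norm_sq, Complex.normSq_apply, Complex.sub_re, Complex.sub_im]; ring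
  have bsq : ∀ {s t : ℝ}, |s| ≤ C → |t| ≤ C → |(s - t) ^ 2| ≤ (2 * C) ^ 2 := by
    intro s t hs ht
    rw [abs_pow]
    refine pow_le_pow_left₀ (abs_nonneg _) ?_ 2
    exact (abs_sub s t).trans (by linarith)
  have hup : ∀ k, Measurable fun x : Fin n → E => Function.update x k a := fun k =>
    measurable_update'.comp (measurable_id.prodMk measurable_const)
  simp only [e]
  rw [integral_add
    (integrable_of_measurable_bdd P ((hre.sub_const _).pow_const 2) fun x =>
      bsq (hreC x) ((Complex.abs_re_le_norm _).trans hmC))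
    (integrable_of_measurable_bdd P ((him.sub_const _).pow_const 2) fun x =>
      bsq (himC x) ((Complex.abs_im_le_norm _).trans hmC))]
  have : ∀ k, ∫ x, (((f x).re - (f (Function.update x k a)).re) ^ 2
        + ((f x).im - (f (Function.update x k a)).im) ^ 2) ∂P
      = ∫ x, ((f x).re - (f (Function.update x k a)).re) ^ 2 ∂P
        + ∫ x, ((f x).im - (f (Function.update x k a)).im) ^ 2 ∂P := fun k =>
    integral_add
      (integrable_of_measurable_bdd P ((hre.sub (hre.comp (hup k))).pow_const 2) fun x =>
        bsq (hreC x) (hreC _))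
      (integrable_of_measurable_bdd P ((him.sub (him.comp (hup k))).pow_const 2) fun x =>
        bsq (himC x) (himC _))
  simp only [this, Finset.sum_add_distrib]
  exact add_le_add h1 h2

section SelfConsistent

variable {ι : Type*} [Fintype ι] [DecidableEq ι] {n : ℕ} {π : Fin n → Measure (ι → ℝ)}
  [∀ k, IsProbabilityMeasure (π k)] {z : ℂ} {κ : ℝ}

theorem measurable_colTrace (hz : 0 < z.im) :
    Measurable fun x : Fin n → ι → ℝ => colTrace x z := (continuous_colTrace hz).measurable

theorem measurable_colTrace_update (hz : 0 < z.im) (k : Fin n) :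
    Measurable fun x : Fin n → ι → ℝ => colTrace (Function.update x k 0) z :=
  ((continuous_colTrace hz).comp (continuous_update_zero k)).measurable

theorem integrable_colTrace (hz : 0 < z.im) :
    Integrable (fun x => colTrace x z) (Measure.pi π) :=
  Integrable.of_bound (measurable_colTrace hz).aestronglyMeasurable _
    (ae_of_all _ fun x => norm_colTrace_le x hz)

theorem integrable_colTrace_update (hz : 0 < z.im) (k : Fin n) :
    Integrable (fun x => colTrace (Function.update x k 0) z) (Measure.pi π) :=
  Integrable.of_bound (measurable_colTrace_update hz k).aestronglyMeasurable _
    (ae_of_all _ fun _ => norm_colTrace_le _ hz)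

theorem colForm_update (x : Fin n → ι → ℝ) (k : Fin n) (c : ι → ℝ) (z : ℂ) :
    colForm (Function.update x k c) k z
      = resolventForm (colGram (Function.update x k 0)) z c := by
  rw [colForm, Function.update_idem, Function.update_self]

/-- Conditional mean and variance of the quadratic form of one column. -/
theorem colForm_moments (hn : 0 < n) (hz : 0 < z.im)
    (hQ : ∀ k, QuadraticConcentration (π k) (n : ℝ)⁻¹ (κ / n)) (hκ : 0 ≤ κ) (k : Fin n) :
    MemLp (fun x => colForm x k z - colTrace (Function.update x k 0) z) 2 (Measure.pi π) ∧
    ∫ x, (colForm x k z - colTrace (Function.update x k 0) z) ∂(Measure.pi π) = 0 ∧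
    ∫ x, ‖colForm x k z - colTrace (Function.update x k 0) z‖ ^ 2 ∂(Measure.pi π)
      ≤ κ / z.im * ∫ x, (colTrace (Function.update x k 0) z).im ∂(Measure.pi π) := by
  set P := Measure.pi π with hP
  have hn' : (0 : ℝ) < n := by exact_mod_cast hn
  set d : (Fin n → ι → ℝ) → ℂ := fun x => colForm x k z - colTrace (Function.update x k 0) z with hd
  have hdm : Measurable d := ((continuous_colForm hz k).sub
    ((continuous_colTrace hz).comp (continuous_update_zero k))).measurable
  have hmp := measurePreserving_update π k
  have hdu : ∀ x c, d (Function.update x k c)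
      = resolventForm (colGram (Function.update x k 0)) z c
        - ((n : ℝ)⁻¹ : ℝ) * (sqResolvent (colGram (Function.update x k 0)) z).trace := by
    intro x c
    simp only [hd]
    rw [colForm_update, Function.update_idem, colTrace]
    push_cast; rfl
  have hsec : ∀ x, MemLp (fun c => d (Function.update x k c)) 2 (π k) ∧
      ∫ c, d (Function.update x k c) ∂(π k) = 0 ∧
      ∫ c, ‖d (Function.update x k c)‖ ^ 2 ∂(π k)
        ≤ κ / z.im * (colTrace (Function.update x k 0) z).im := by
    intro x
    obtain ⟨q1, q2, q3⟩ := hQ k (sqResolvent (colGram (Function.update x k 0)) z)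
      (transpose_sqResolvent (isSymmNonneg_colGram _) z)
    simp only [hdu]
    refine ⟨q1.sub (memLp_const _), ?_, q3.trans ?_⟩
    · have := integral_sub (q1.integrable one_le_two) (integrable_const
        ((((n : ℝ)⁻¹ : ℝ) : ℂ) * (sqResolvent (colGram (Function.update x k 0)) z).trace))
      refine this.trans ?_
      rw [q2]; simp
    · have h := sum_norm_sq_le_im_colTrace hn (Function.update x k 0) hz
      have h2 := mul_le_mul_of_nonneg_left h (show 0 ≤ κ / (n * z.im) by positivity)
      refine le_trans (le_of_eq ?_) (h2.trans (le_of_eq ?_))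
      · field_simp
      · field_simp
  -- A bound on the conditional second moment uniform in the other columns yields square
  -- integrability on the product.
  have hbd : ∀ x, κ / z.im * (colTrace (Function.update x k 0) z).im
      ≤ κ / z.im * (Fintype.card ι / n / z.im) := fun x =>
    mul_le_mul_of_nonneg_left (((le_abs_self _).trans (Complex.abs_im_le_norm _)).trans
      (norm_colTrace_le _ hz)) (by positivity)
  have hsqm : Measurable fun q : (Fin n → ι → ℝ) × (ι → ℝ) => ‖d (Function.update q.1 k q.2)‖ ^ 2 :=
    ((hdm.comp hmp.measurable).norm).pow_const 2
  have hprod : Integrable (fun q : (Fin n → ι → ℝ) × (ι → ℝ) =>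
      ‖d (Function.update q.1 k q.2)‖ ^ 2) (P.prod (π k)) := by
    rw [integrable_prod_iff hsqm.aestronglyMeasurable]
    refine ⟨ae_of_all _ fun x => (hsec x).1.norm.integrable_sq, ?_⟩
    refine integrable_of_measurable_bdd P
      hsqm.norm.stronglyMeasurable.integral_prod_right'.measurable
      (C := κ / z.im * (Fintype.card ι / n / z.im)) fun x => ?_
    rw [abs_of_nonneg (integral_nonneg fun _ => norm_nonneg _)]
    simp only [norm_pow, norm_norm]
    exact (hsec x).2.2.trans (hbd x)
  have hsqi : Integrable (fun x => ‖d x‖ ^ 2) P := by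
    rw [← hmp.integrable_comp (hdm.norm.pow_const 2).aestronglyMeasurable]
    exact hprod
  have hL : MemLp d 2 P := (memLp_two_iff_integrable_sq_norm hdm.aestronglyMeasurable).2 hsqi
  refine ⟨hL, ?_, ?_⟩
  · rw [integral_eq_integral_update π k (hL.integrable one_le_two)]
    simp only [fun x => (hsec x).2.1]; simp
  · rw [integral_eq_integral_update π k hsqi, ← integral_const_mul]
    refine integral_mono hprod.integral_prod_left ?_ fun x => (hsec x).2.2
    exact ((integrable_colTrace_update hz k).im).const_mul _

theorem im_integral_colTrace (hz : 0 < z.im) :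
    ∫ x, (colTrace x z).im ∂(Measure.pi π) = (∫ x, colTrace x z ∂(Measure.pi π)).im :=
  integral_im (integrable_colTrace hz)

theorem norm_integral_colTrace_update_sub_le (hn : 0 < n) (hz : 0 < z.im) (k : Fin n) :
    ‖∫ x, colTrace x z ∂(Measure.pi π) - ∫ x, colTrace (Function.update x k 0) z ∂(Measure.pi π)‖
      ≤ 1 / (n * z.im) := by
  rw [← integral_sub (integrable_colTrace hz) (integrable_colTrace_update hz k)]
  exact norm_integral_le_of_forall _ fun x => norm_colTrace_sub_update_le hn x k hz

theorem integral_im_colTrace_update_le (hn : 0 < n) (hz : 0 < z.im) (k : Fin n) :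
    ∫ x, (colTrace (Function.update x k 0) z).im ∂(Measure.pi π)
      ≤ (∫ x, colTrace x z ∂(Measure.pi π)).im + 1 / (n * z.im) := by
  have h := (Complex.abs_im_le_norm _).trans
    (norm_integral_colTrace_update_sub_le (π := π) hn hz k)
  rw [Complex.sub_im] at h
  have e : ∫ x, (colTrace (Function.update x k 0) z).im ∂(Measure.pi π)
      = (∫ x, colTrace (Function.update x k 0) z ∂(Measure.pi π)).im :=
    integral_im (integrable_colTrace_update hz k)
  rw [e]
  linarith [(abs_le.1 h).1]

theorem im_neg_one_sub_div (m n : ℕ) (z : ℂ) :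
    (-((1 - (m / n : ℂ)) / z)).im = (1 - m / n) * (z.im / ‖z‖ ^ 2) := by
  have : (1 - (m / n : ℂ)) = ((1 - m / n : ℝ) : ℂ) := by push_cast; rfl
  rw [this, Complex.neg_im, div_eq_mul_inv, Complex.im_ofReal_mul, Complex.inv_im,
    Complex.normSq_eq_norm_sq]
  ring

theorem im_neg_one_sub_div_nonneg {m n : ℕ} (hmn : m ≤ n) (hz : 0 < z.im) :
    0 ≤ (-((1 - (m / n : ℂ)) / z)).im := by
  rw [im_neg_one_sub_div]
  have : (m : ℝ) / n ≤ 1 := div_le_one_of_le₀ (by exact_mod_cast hmn) (by positivity)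
  exact mul_nonneg (by linarith) (by positivity)

/-- Fluctuations of the normalized trace: second moment. -/
theorem integral_norm_sq_colTrace_sub_le (hn : 0 < n) (hz : 0 < z.im)
    (hQ : ∀ k, QuadraticConcentration (π k) (n : ℝ)⁻¹ (κ / n)) (hκ : 0 ≤ κ)
    (hnv : 1 ≤ n * z.im ^ 2) (hcard : Fintype.card ι ≤ n) :
    ∫ x, ‖colTrace x z - ∫ x', colTrace x' z ∂(Measure.pi π)‖ ^ 2 ∂(Measure.pi π)
      ≤ 2 / (n * z.im ^ 2) * ((z + ∫ x, colTrace x z ∂(Measure.pi π)).im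
          + (-((1 - (Fintype.card ι / n : ℂ)) / z)).im) := by
  set P := Measure.pi π with hP
  set v := z.im with hv
  have hn' : (0 : ℝ) < n := by exact_mod_cast hn
  set τ := ∫ x, colTrace x z ∂P with hτ
  set g : ℝ := (-((1 - (Fintype.card ι / n : ℂ)) / z)).im with hg
  have hES := efronStein_complex (0 : ι → ℝ) π (measurable_colTrace hz)
    (fun x => norm_colTrace_le x hz)
  refine hES.trans ?_
  have hqi : ∀ k, Integrable (fun x => colForm x k z) P := by
    intro k
    have := ((colForm_moments hn hz hQ hκ k).1.integrable one_le_two).add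
      (integrable_colTrace_update hz k)
    exact this.congr (ae_of_all _ fun x => by simp)
  have hqI : ∀ k, ∫ x, (colForm x k z).im ∂P
      = ∫ x, (colTrace (Function.update x k 0) z).im ∂P := by
    intro k
    have h0 := (colForm_moments hn hz hQ hκ k).2.1
    rw [integral_sub (hqi k) (integrable_colTrace_update hz k), sub_eq_zero] at h0
    have e1 : ∫ x, (colForm x k z).im ∂P = (∫ x, colForm x k z ∂P).im := integral_im (hqi k)
    have e2 : ∫ x, (colTrace (Function.update x k 0) z).im ∂P
      = (∫ x, colTrace (Function.update x k 0) z ∂P).im :=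
      integral_im (integrable_colTrace_update hz k)
    rw [e1, e2, h0]
  have hRi : ∀ k, Integrable (fun x => -(z + colForm x k z)⁻¹) P := by
    intro k
    refine Integrable.of_bound (C := v⁻¹) ?_ (ae_of_all _ fun x => ?_)
    · exact (((continuous_colForm hz k).measurable.const_add z).inv.neg).aestronglyMeasurable
    · rw [norm_neg]; exact norm_inv_add_colForm_le x k hz
  have hterm : ∀ k, ∫ x, ‖colTrace x z - colTrace (Function.update x k 0) z‖ ^ 2 ∂P
      ≤ (∫ x, (-(z + colForm x k z)⁻¹).im ∂P + (v + (τ.im + 1 / (n * v)))) / (n * v) ^ 2 := by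
    intro k
    have hb : Integrable (fun x => ((-(z + colForm x k z)⁻¹).im + (v + (colForm x k z).im))
        / (n * v) ^ 2) P :=
      ((hRi k).im.add ((integrable_const v).add (hqi k).im)).div_const _
    have h1 : ∫ x, ‖colTrace x z - colTrace (Function.update x k 0) z‖ ^ 2 ∂P
        ≤ ∫ x, ((-(z + colForm x k z)⁻¹).im + (v + (colForm x k z).im)) / (n * v) ^ 2 ∂P := by
      refine integral_mono_of_nonneg (ae_of_all _ fun x => by positivity) hb
        (ae_of_all _ fun x => norm_sq_colTrace_sub_update_le hn x k hz)
    refine h1.trans ?_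
    rw [integral_div]
    refine div_le_div_of_nonneg_right ?_ (by positivity)
    have i1 : Integrable (fun x => (-(z + colForm x k z)⁻¹).im) P := (hRi k).im
    have i2 : Integrable (fun x => (colForm x k z).im) P := (hqi k).im
    have i3 : Integrable (fun x => v + (colForm x k z).im) P := (integrable_const v).add i2
    rw [integral_add i1 i3, integral_add (integrable_const v) i2, hqI k]
    have := integral_im_colTrace_update_le (π := π) hn hz k
    simp only [integral_const, probReal_univ, one_smul]
    linarith
  -- The averaged identity evaluates this sum exactly, producing Im τ + Im(-c) instead of a crude
  -- n/v.
  have hsumR : ∑ k, ∫ x, (-(z + colForm x k z)⁻¹).im ∂P = n * (τ.im + g) := by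
    have e : ∀ k, ∫ x, (-(z + colForm x k z)⁻¹).im ∂P = (∫ x, -(z + colForm x k z)⁻¹ ∂P).im :=
      fun k => integral_im (hRi k)
    simp only [e]
    rw [← Complex.im_sum, ← integral_finsetSum _ fun k _ => hRi k]
    have e2 : ∀ x : Fin n → ι → ℝ, ∑ k, -(z + colForm x k z)⁻¹
        = n * (colTrace x z - (1 - (Fintype.card ι / n : ℂ)) / z) := by
      intro x
      rw [← avg_inv_add_colForm hn x hz, mul_inv_cancel_left₀]
      exact_mod_cast hn.ne'
    simp only [e2]
    rw [integral_const_mul, integral_sub (integrable_colTrace hz) (integrable_const _)]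
    rw [← nsmul_eq_mul, Complex.smul_im, nsmul_eq_mul]
    simp only [integral_const, probReal_univ, one_smul, Complex.sub_im, hg, Complex.neg_im]
    rw [hτ]; ring
  refine (Finset.sum_le_sum fun k _ => hterm k).trans ?_
  rw [← Finset.sum_div, Finset.sum_add_distrib, hsumR]
  simp only [Finset.sum_const, Finset.card_univ, Fintype.card_fin, nsmul_eq_mul]
  have hδ : 1 / (n * v) ≤ v := by
    rw [div_le_iff₀ (by positivity)]; nlinarith
  have hAim : (z + τ).im = v + τ.im := by rw [Complex.add_im]
  have hpos : 0 < (n : ℝ) * v ^ 2 := by positivity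
  have e : 2 / (n * v ^ 2) * (v + τ.im + g) = (n * (2 * (v + τ.im + g))) / (n * v) ^ 2 := by
    field_simp
  have hg0 : 0 ≤ g := im_neg_one_sub_div_nonneg hcard hz
  rw [hAim, e]
  refine div_le_div_of_nonneg_right ?_ (by positivity)
  have hτ0 : 0 ≤ τ.im := by
    rw [← im_integral_colTrace hz]
    exact integral_nonneg fun x => im_colTrace_nonneg hn x hz
  have : n * (τ.im + g) + n * (v + (τ.im + 1 / (n * v)))
      = n * ((τ.im + g) + (v + (τ.im + 1 / (n * v)))) := by ring
  rw [this]
  refine mul_le_mul_of_nonneg_left ?_ hn'.le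
  linarith

end SelfConsistent

section SelfConsistent

variable {ι : Type*} [Fintype ι] [DecidableEq ι] {n : ℕ} {π : Fin n → Measure (ι → ℝ)}
  [∀ k, IsProbabilityMeasure (π k)] {z : ℂ} {κ : ℝ}

/-- Fluctuations of the normalized trace: crude bound on the second moment. -/
theorem integral_norm_sq_colTrace_sub_le_one (hn : 0 < n) (hz : 0 < z.im)
    (hnv : 1 ≤ n * z.im ^ 2) :
    ∫ x, ‖colTrace x z - ∫ x', colTrace x' z ∂(Measure.pi π)‖ ^ 2 ∂(Measure.pi π) ≤ 1 := by
  have hn' : (0 : ℝ) < n := by exact_mod_cast hn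
  refine (efronStein_complex (0 : ι → ℝ) π (measurable_colTrace hz)
    (fun x => norm_colTrace_le x hz)).trans ?_
  have h : ∀ k, ∫ x, ‖colTrace x z - colTrace (Function.update x k 0) z‖ ^ 2 ∂(Measure.pi π)
      ≤ (1 / (n * z.im)) ^ 2 := by
    intro k
    refine (integral_mono_of_nonneg (ae_of_all _ fun x => by positivity) (integrable_const _)
      (ae_of_all _ fun x => pow_le_pow_left₀ (norm_nonneg _)
        (norm_colTrace_sub_update_le hn x k hz) 2)).trans ?_
    simp
  refine (Finset.sum_le_sum fun k _ => h k).trans ?_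
  simp only [Finset.sum_const, Finset.card_univ, Fintype.card_fin, nsmul_eq_mul]
  rw [show (n : ℝ) * (1 / (n * z.im)) ^ 2 = 1 / (n * z.im ^ 2) by field_simp]
  exact div_le_one_of_le₀ hnv (by positivity)

set_option maxHeartbeats 1000000 in
/-- Fluctuations of the normalized trace: fourth moment. -/
theorem integral_norm_pow_four_colTrace_sub_le (hn : 0 < n) (hz : 0 < z.im)
    (hQ : ∀ k, QuadraticConcentration (π k) (n : ℝ)⁻¹ (κ / n)) (hκ : 0 ≤ κ)
    (hnv : 1 ≤ n * z.im ^ 2) (hcard : Fintype.card ι ≤ n) :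
    ∫ x, ‖colTrace x z - ∫ x', colTrace x' z ∂(Measure.pi π)‖ ^ 4 ∂(Measure.pi π)
      ≤ 20 / (n * z.im ^ 2) * ((z + ∫ x, colTrace x z ∂(Measure.pi π)).im
          + (-((1 - (Fintype.card ι / n : ℂ)) / z)).im) := by
  have hn' : (0 : ℝ) < n := by exact_mod_cast hn
  have hn1 : (1 : ℝ) ≤ n := by exact_mod_cast hn
  have h2 := integral_norm_sq_colTrace_sub_le hn hz hQ hκ hnv hcard
  have h1 := integral_norm_sq_colTrace_sub_le_one (π := π) hn hz hnv
  set P := Measure.pi π with hP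
  set v := z.im with hv
  set τ := ∫ x, colTrace x z ∂P with hτ
  set W := (z + τ).im + (-((1 - (Fintype.card ι / n : ℂ)) / z)).im with hW
  set δ := 1 / (n * v) with hδ
  have hδ0 : 0 < δ := by positivity
  have hδv : δ ≤ v := by rw [hδ, div_le_iff₀ (by positivity)]; nlinarith
  have hδ1 : δ ≤ 1 := by rw [hδ, div_le_iff₀ (by positivity)]; nlinarith
  have hτ0 : 0 ≤ τ.im := by
    rw [hτ, ← im_integral_colTrace hz]
    exact integral_nonneg fun x => im_colTrace_nonneg hn x hz
  have hvW : v ≤ W := by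
    have := im_neg_one_sub_div_nonneg hcard hz
    rw [hW, Complex.add_im]; linarith
  set C := (Fintype.card ι : ℝ) / n / v with hC
  have hτC : ‖τ‖ ≤ C := norm_integral_le_of_forall P fun x => norm_colTrace_le x hz
  have hηC : ∀ x : Fin n → ι → ℝ, ‖colTrace x z - τ‖ ≤ C + C := fun x =>
    (norm_sub_le _ _).trans (add_le_add (norm_colTrace_le x hz) hτC)
  have hηm : Measurable fun x : Fin n → ι → ℝ => ‖colTrace x z - τ‖ :=
    ((measurable_colTrace hz).sub_const τ).norm
  have hg : Measurable fun x : Fin n → ι → ℝ => ‖colTrace x z - τ‖ ^ 2 := hηm.pow_const 2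
  have hgC : ∀ x : Fin n → ι → ℝ, |‖colTrace x z - τ‖ ^ 2| ≤ (C + C) ^ 2 := fun x => by
    rw [abs_of_nonneg (by positivity)]
    exact pow_le_pow_left₀ (norm_nonneg _) (hηC x) 2
  -- Efron–Stein for |t - τ|²: its variance is the fourth moment minus the square of the second.
  have hES := efronStein (0 : ι → ℝ) π hg hgC
  have i2 : Integrable (fun x => ‖colTrace x z - τ‖ ^ 2) P := integrable_of_measurable_bdd P hg hgC
  have i4 : Integrable (fun x => (‖colTrace x z - τ‖ ^ 2) ^ 2) P :=
    integrable_of_measurable_bdd P (hg.pow_const 2) (C := ((C + C) ^ 2) ^ 2) fun x => by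
      rw [abs_pow]; exact pow_le_pow_left₀ (abs_nonneg _) (hgC x) 2
  have hk : ∀ k, ∫ x, (‖colTrace x z - τ‖ ^ 2
      - ‖colTrace (Function.update x k 0) z - τ‖ ^ 2) ^ 2 ∂P
      ≤ δ ^ 2 * (8 * ∫ x, ‖colTrace x z - τ‖ ^ 2 ∂P + 2 * δ ^ 2) := by
    intro k
    have hb : Integrable (fun x => δ ^ 2 * (8 * ‖colTrace x z - τ‖ ^ 2 + 2 * δ ^ 2)) P :=
      ((i2.const_mul 8).add (integrable_const _)).const_mul _
    refine (integral_mono_of_nonneg (ae_of_all _ fun x => sq_nonneg _) hb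
      (ae_of_all _ fun x => ?_)).trans (le_of_eq ?_)
    · have h := norm_colTrace_sub_update_le hn x k hz
      set a := ‖colTrace x z - τ‖
      set a' := ‖colTrace (Function.update x k 0) z - τ‖
      have hd : |a - a'| ≤ δ := by
        refine (abs_norm_sub_norm_le _ _).trans ?_
        rwa [sub_sub_sub_cancel_right]
      have ha : 0 ≤ a := norm_nonneg _
      have ha' : 0 ≤ a' := norm_nonneg _
      have hs : a + a' ≤ 2 * a + δ := by linarith [(abs_le.1 hd).1]
      have e1 : (a - a') ^ 2 ≤ δ ^ 2 := sq_le_sq.2 (by rwa [abs_of_pos hδ0])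
      have e2 : (a + a') ^ 2 ≤ (2 * a + δ) ^ 2 := pow_le_pow_left₀ (by positivity) hs 2
      calc (a ^ 2 - a' ^ 2) ^ 2 = (a - a') ^ 2 * (a + a') ^ 2 := by ring
        _ ≤ δ ^ 2 * (2 * a + δ) ^ 2 := mul_le_mul e1 e2 (by positivity) (by positivity)
        _ ≤ δ ^ 2 * (8 * a ^ 2 + 2 * δ ^ 2) :=
          mul_le_mul_of_nonneg_left (by nlinarith [sq_nonneg (2 * a - δ)]) (by positivity)
    · rw [integral_const_mul, integral_add (i2.const_mul 8) (integrable_const _),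
        integral_const_mul]
      simp
  set W2 := ∫ x, ‖colTrace x z - τ‖ ^ 2 ∂P with hW2
  have hsum := hES.trans (Finset.sum_le_sum fun k _ => hk k)
  simp only [Finset.sum_const, Finset.card_univ, Fintype.card_fin, nsmul_eq_mul] at hsum
  have hvar : ∫ x, (‖colTrace x z - τ‖ ^ 2 - W2) ^ 2 ∂P
      = ∫ x, ‖colTrace x z - τ‖ ^ 4 ∂P - W2 ^ 2 := by
    have e : ∀ x : Fin n → ι → ℝ, (‖colTrace x z - τ‖ ^ 2 - W2) ^ 2
        = (‖colTrace x z - τ‖ ^ 2) ^ 2 - 2 * W2 * ‖colTrace x z - τ‖ ^ 2 + W2 ^ 2 := fun x => by ring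
    have e4 : ∀ x : Fin n → ι → ℝ, ‖colTrace x z - τ‖ ^ 4 = (‖colTrace x z - τ‖ ^ 2) ^ 2 :=
      fun x => by ring
    simp only [e, e4]
    have i5 : Integrable (fun x => (‖colTrace x z - τ‖ ^ 2) ^ 2
      - 2 * W2 * ‖colTrace x z - τ‖ ^ 2) P := i4.sub (i2.const_mul _)
    rw [integral_add i5 (integrable_const _), integral_sub i4 (i2.const_mul _),
      integral_const_mul, ← hW2]
    simp; ring
  rw [hvar] at hsum
  have hW20 : 0 ≤ W2 := integral_nonneg fun x => by positivity
  set s := 1 / (n * v ^ 2) with hs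
  have hs0 : 0 < s := by positivity
  have hs1 : s ≤ 1 := div_le_one_of_le₀ hnv (by positivity)
  have e1 : (n : ℝ) * (δ ^ 2 * (8 * W2 + 2 * δ ^ 2)) = s * (8 * W2 + 2 * δ ^ 2) := by
    rw [hδ, hs]; field_simp
  have e2 : 2 / (n * v ^ 2) * W = 2 * (s * W) := by rw [hs]; ring
  have e3 : 20 / (n * v ^ 2) * W = 20 * (s * W) := by rw [hs]; ring
  rw [e1] at hsum
  rw [e2] at h2
  rw [e3]
  -- The constant 20 is 16 + 2 + 2: from 8sW2 ≤ 8W2 ≤ 16sW, 2sδ² ≤ 2sW, and W2² ≤ W2 ≤ 2sW.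
  have a1 : s * W2 ≤ W2 := mul_le_of_le_one_left hW20 hs1
  have a2 : s * δ ^ 2 ≤ s * W := by
    refine mul_le_mul_of_nonneg_left (le_trans ?_ hvW) hs0.le
    rw [sq]; exact (mul_le_of_le_one_left hδ0.le hδ1).trans hδv
  have a3 : W2 ^ 2 ≤ W2 := by rw [sq]; exact mul_le_of_le_one_left hW20 h1
  have a4 : s * (8 * W2 + 2 * δ ^ 2) = 8 * (s * W2) + 2 * (s * δ ^ 2) := by ring
  linarith

set_option maxHeartbeats 1000000 in
/-- The averaged cubic equation satisfied by the mean trace, with explicit error. -/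
theorem norm_self_consistent_le (hn : 0 < n) (hz : 0 < z.im)
    (hQ : ∀ k, QuadraticConcentration (π k) (n : ℝ)⁻¹ (κ / n)) (hκ : (n : ℝ)⁻¹ ≤ κ)
    (hnv : 1 ≤ n * z.im ^ 2) (hcard : Fintype.card ι ≤ n) {A c : ℂ}
    (hA : A = z + ∫ x, colTrace x z ∂(Measure.pi π)) (hc : c = (1 - (Fintype.card ι / n : ℂ)) / z) :
    ‖A * (A ^ 2 - (z + c) * A + 1)‖
      ≤ κ / z.im ^ 2 * (A.im + (-c).im) * (16 + 2 * ‖3 * A - (z + c)‖) := by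
  have hn' : (0 : ℝ) < n := by exact_mod_cast hn
  have hn1 : (1 : ℝ) ≤ n := by exact_mod_cast hn
  have hnC : (n : ℂ) ≠ 0 := by exact_mod_cast hn.ne'
  have hκ0 : 0 ≤ κ := le_trans (by positivity) hκ
  have h2 := integral_norm_sq_colTrace_sub_le hn hz hQ hκ0 hnv hcard
  have h4 := integral_norm_pow_four_colTrace_sub_le hn hz hQ hκ0 hnv hcard
  have hc0 := im_neg_one_sub_div_nonneg hcard hz
  rw [← hA, ← hc] at h2 h4
  rw [← hc] at hc0
  set P := Measure.pi π with hP
  set τ := ∫ x, colTrace x z ∂P with hτ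
  set v := z.im with hv
  set W := A.im + (-c).im with hW
  set δ := 1 / (n * v) with hδ
  set r := κ / v ^ 2 with hr
  have hδ0 : 0 < δ := by positivity
  have hδv : δ ≤ v := by rw [hδ, div_le_iff₀ (by positivity)]; nlinarith
  have hτ0 : 0 ≤ τ.im := by
    rw [hτ, ← im_integral_colTrace hz]
    exact integral_nonneg fun x => im_colTrace_nonneg hn x hz
  have hAim : A.im = v + τ.im := by rw [hA, Complex.add_im]
  have hvW : v ≤ W := by rw [hW]; linarith
  have hW0 : 0 ≤ W := hz.le.trans hvW
  have hs : 1 / (n * v ^ 2) ≤ r := by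
    rw [hr, ← div_div, ← inv_eq_one_div]; gcongr
  have hr0 : 0 < r := lt_of_lt_of_le (by positivity) hs
  have hδr : δ ≤ r * W := by
    calc δ = 1 / (n * v ^ 2) * v := by rw [hδ]; field_simp
      _ ≤ r * W := by gcongr
  have hM2 : ∫ x, ‖colTrace x z - τ‖ ^ 2 ∂P ≤ 2 * (r * W) := by
    refine h2.trans ?_
    calc 2 / (n * v ^ 2) * W = 2 * (1 / (n * v ^ 2) * W) := by ring
      _ ≤ _ := by gcongr
  have hM4 : ∫ x, ‖colTrace x z - τ‖ ^ 4 ∂P ≤ 20 * (r * W) := by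
    refine h4.trans ?_
    calc 20 / (n * v ^ 2) * W = 20 * (1 / (n * v ^ 2) * W) := by ring
      _ ≤ _ := by gcongr
  set C := (Fintype.card ι : ℝ) / n / v with hC
  have hτC : ‖τ‖ ≤ C := norm_integral_le_of_forall P fun x => norm_colTrace_le x hz
  have hηC : ∀ x : Fin n → ι → ℝ, ‖colTrace x z - τ‖ ≤ C + C := fun x =>
    (norm_sub_le _ _).trans (add_le_add (norm_colTrace_le x hz) hτC)
  have hηm : Measurable fun x : Fin n → ι → ℝ => colTrace x z - τ :=
    (measurable_colTrace hz).sub_const τ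
  have hηi : ∀ m : ℕ, Integrable (fun x => (colTrace x z - τ) ^ m) P := fun m =>
    Integrable.of_bound (hηm.pow_const m).aestronglyMeasurable ((C + C) ^ m) (ae_of_all _ fun x => by
      rw [norm_pow]; exact pow_le_pow_left₀ (norm_nonneg _) (hηC x) m)
  have hηn : ∀ m : ℕ, Integrable (fun x => ‖colTrace x z - τ‖ ^ m) P := fun m => by
    simpa only [norm_pow] using (hηi m).norm
  have hη0 : ∫ x, (colTrace x z - τ) ∂P = 0 := by
    rw [integral_sub (integrable_colTrace hz) (integrable_const _), ← hτ]; simp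
  -- By |η|³ ≤ (|η|² + |η|⁴)/2, giving (2 + 20)/2 = 11.
  have hM3 : ‖∫ x, (colTrace x z - τ) ^ 3 ∂P‖ ≤ 11 * (r * W) := by
    refine (norm_integral_le_integral_norm _).trans ?_
    have hb : Integrable (fun x => (‖colTrace x z - τ‖ ^ 2 + ‖colTrace x z - τ‖ ^ 4) / 2) P :=
      ((hηn 2).add (hηn 4)).div_const 2
    refine (integral_mono_of_nonneg (ae_of_all _ fun x => norm_nonneg _) hb
      (ae_of_all _ fun x => ?_)).trans ?_
    · change ‖(colTrace x z - τ) ^ 3‖ ≤ _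
      rw [norm_pow]
      nlinarith [sq_nonneg (‖colTrace x z - τ‖ * (1 - ‖colTrace x z - τ‖))]
    · rw [integral_div, integral_add (hηn 2) (hηn 4)]; linarith
  have hM2' : ‖∫ x, (colTrace x z - τ) ^ 2 ∂P‖ ≤ 2 * (r * W) := by
    refine (norm_integral_le_integral_norm _).trans ?_
    simpa only [norm_pow] using hM2
  -- the error terms of a single column
  have hD : ∀ k, Integrable (fun x => (colForm x k z - colTrace x z)
        + (colForm x k z - colTrace x z) ^ 2 * -(z + colForm x k z)⁻¹) P ∧
      ‖∫ x, ((colForm x k z - colTrace x z)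
        + (colForm x k z - colTrace x z) ^ 2 * -(z + colForm x k z)⁻¹) ∂P‖ ≤ 5 * (r * W) := by
    intro k
    obtain ⟨m1, m2, m3⟩ := colForm_moments hn hz hQ hκ0 k
    have hI := integral_im_colTrace_update_le (π := π) hn hz k
    have hTL : MemLp (fun x => colTrace (Function.update x k 0) z - colTrace x z) 2 P :=
      MemLp.of_bound ((measurable_colTrace_update hz k).sub
        (measurable_colTrace hz)).aestronglyMeasurable δ (ae_of_all _ fun x => by
          rw [norm_sub_rev]; exact norm_colTrace_sub_update_le hn x k hz)
    have hεL : MemLp (fun x => colForm x k z - colTrace x z) 2 P := by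
      have := m1.add hTL
      refine this.ae_eq (ae_of_all _ fun x => ?_)
      simp
    have hε1 : Integrable (fun x => colForm x k z - colTrace x z) P := hεL.integrable one_le_two
    have hε2 : Integrable (fun x => ‖colForm x k z - colTrace x z‖ ^ 2) P :=
      hεL.norm.integrable_sq
    have hRm : Measurable fun x : Fin n → ι → ℝ => -(z + colForm x k z)⁻¹ :=
      ((continuous_colForm hz k).measurable.const_add z).inv.neg
    have hR : ∀ x : Fin n → ι → ℝ, ‖-(z + colForm x k z)⁻¹‖ ≤ v⁻¹ := fun x => by
      rw [norm_neg]; exact norm_inv_add_colForm_le x k hz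
    have hbnd : ∀ x : Fin n → ι → ℝ, ‖(colForm x k z - colTrace x z) ^ 2 * -(z + colForm x k z)⁻¹‖
        ≤ ‖colForm x k z - colTrace x z‖ ^ 2 * v⁻¹ := fun x => by
      rw [norm_mul, norm_pow]; exact mul_le_mul_of_nonneg_left (hR x) (by positivity)
    have hεm : Measurable fun x : Fin n → ι → ℝ => colForm x k z - colTrace x z :=
      (continuous_colForm hz k).measurable.sub (measurable_colTrace hz)
    have hεR : Integrable (fun x => (colForm x k z - colTrace x z) ^ 2
        * -(z + colForm x k z)⁻¹) P :=
      (hε2.mul_const v⁻¹).mono' ((hεm.pow_const 2).mul hRm).aestronglyMeasurable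
        (ae_of_all _ hbnd)
    refine ⟨hε1.add hεR, ?_⟩
    rw [integral_add hε1 hεR]
    have b1 : ‖∫ x, (colForm x k z - colTrace x z) ∂P‖ ≤ r * W := by
      have e : ∀ x : Fin n → ι → ℝ, colForm x k z - colTrace x z
          = (colForm x k z - colTrace (Function.update x k 0) z)
            + (colTrace (Function.update x k 0) z - colTrace x z) := fun x => by ring
      simp only [e]
      rw [integral_add (m1.integrable one_le_two) (hTL.integrable one_le_two), m2, zero_add]
      refine (norm_integral_le_of_forall P fun x => ?_).trans hδr
      rw [norm_sub_rev]; exact norm_colTrace_sub_update_le hn x k hz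
    have b2 : ∫ x, ‖colForm x k z - colTrace x z‖ ^ 2 ∂P ≤ 2 * (κ / v * W) + 2 * δ ^ 2 := by
      have i1 : Integrable (fun x => ‖colForm x k z - colTrace (Function.update x k 0) z‖ ^ 2) P :=
        m1.norm.integrable_sq
      have hb : Integrable (fun x => 2 * ‖colForm x k z - colTrace (Function.update x k 0) z‖ ^ 2
          + 2 * δ ^ 2) P := (i1.const_mul 2).add (integrable_const _)
      refine (integral_mono_of_nonneg (ae_of_all _ fun x => by positivity) hb
        (ae_of_all _ fun x => ?_)).trans ?_
      · have h1 := norm_colTrace_sub_update_le hn x k hz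
        have h3 : ‖colForm x k z - colTrace x z‖
            ≤ ‖colForm x k z - colTrace (Function.update x k 0) z‖ + δ := by
          refine (norm_sub_le_norm_sub_add_norm_sub _ (colTrace (Function.update x k 0) z) _).trans ?_
          rw [norm_sub_rev (colTrace (Function.update x k 0) z)]
          exact add_le_add_right h1 _
        have h5 := pow_le_pow_left₀ (norm_nonneg _) h3 2
        change ‖colForm x k z - colTrace x z‖ ^ 2 ≤ _
        nlinarith [sq_nonneg (‖colForm x k z - colTrace (Function.update x k 0) z‖ - δ)]
      · rw [integral_add (i1.const_mul 2) (integrable_const _), integral_const_mul]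
        simp only [integral_const, probReal_univ, one_smul]
        have hIW : ∫ x, (colTrace (Function.update x k 0) z).im ∂P ≤ W := by
          rw [hW]; linarith
        have := mul_le_mul_of_nonneg_left hIW (show 0 ≤ κ / v by positivity)
        linarith
    have b3 : ‖∫ x, (colForm x k z - colTrace x z) ^ 2 * -(z + colForm x k z)⁻¹ ∂P‖
        ≤ 4 * (r * W) := by
      refine (norm_integral_le_integral_norm _).trans ?_
      refine (integral_mono hεR.norm (hε2.mul_const _) hbnd).trans ?_
      rw [integral_mul_const]
      calc (∫ x, ‖colForm x k z - colTrace x z‖ ^ 2 ∂P) * v⁻¹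
          ≤ (2 * (κ / v * W) + 2 * δ ^ 2) * v⁻¹ := by gcongr
        _ = 2 * (r * W) + 2 * (δ * (δ / v)) := by rw [hr]; field_simp
        _ ≤ 2 * (r * W) + 2 * (δ * 1) := by
          gcongr; exact (div_le_one₀ hz).2 hδv
        _ ≤ 4 * (r * W) := by linarith
    refine (norm_add_le _ _).trans ?_
    linarith
  -- the pointwise identity
  have hid : ∀ x : Fin n → ι → ℝ, (n : ℂ)⁻¹ * ∑ k, ((colForm x k z - colTrace x z)
        + (colForm x k z - colTrace x z) ^ 2 * -(z + colForm x k z)⁻¹)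
      = A * (A ^ 2 - (z + c) * A + 1) + (3 * A ^ 2 - 2 * (z + c) * A + 1) * (colTrace x z - τ)
        + (3 * A - (z + c)) * (colTrace x z - τ) ^ 2 + (colTrace x z - τ) ^ 3 := by
    intro x
    have hav := avg_inv_add_colForm hn x hz
    rw [← hc] at hav
    set t := colTrace x z with ht
    -- With a = z + t and w = z + qₖ, (w - a) - (w - a)²/w = a - a²/w. This expands 1/w about 1/a
    -- with denominators cleared, so no lower bound on |z + t| is required. Averaging gives a cubic
    -- in a, whose Taylor expansion at A has a linear term of mean zero.
    have hterm : ∀ k, (colForm x k z - t) + (colForm x k z - t) ^ 2 * -(z + colForm x k z)⁻¹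
        = (z + t) + (z + t) ^ 2 * -(z + colForm x k z)⁻¹ := by
      intro k
      have h0 := add_colForm_ne_zero x k hz
      field_simp
      ring
    simp only [hterm]
    rw [Finset.sum_add_distrib, ← Finset.mul_sum, mul_add, mul_left_comm, hav]
    simp only [Finset.sum_const, Finset.card_univ, Fintype.card_fin, nsmul_eq_mul]
    rw [inv_mul_cancel_left₀ hnC, hA]
    ring
  have hint : (n : ℂ)⁻¹ * ∑ k, ∫ x, ((colForm x k z - colTrace x z)
        + (colForm x k z - colTrace x z) ^ 2 * -(z + colForm x k z)⁻¹) ∂P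
      = A * (A ^ 2 - (z + c) * A + 1) + (3 * A - (z + c)) * ∫ x, (colTrace x z - τ) ^ 2 ∂P
        + ∫ x, (colTrace x z - τ) ^ 3 ∂P := by
    rw [← integral_finsetSum _ fun k _ => (hD k).1, ← integral_const_mul]
    simp only [hid]
    have j1 : Integrable (fun x => (3 * A ^ 2 - 2 * (z + c) * A + 1) * (colTrace x z - τ)) P := by
      simpa only [pow_one] using (hηi 1).const_mul (3 * A ^ 2 - 2 * (z + c) * A + 1)
    have j2 : Integrable (fun x => A * (A ^ 2 - (z + c) * A + 1)
        + (3 * A ^ 2 - 2 * (z + c) * A + 1) * (colTrace x z - τ)) P := (integrable_const _).add j1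
    have j3 : Integrable (fun x => A * (A ^ 2 - (z + c) * A + 1)
        + (3 * A ^ 2 - 2 * (z + c) * A + 1) * (colTrace x z - τ)
        + (3 * A - (z + c)) * (colTrace x z - τ) ^ 2) P := j2.add ((hηi 2).const_mul _)
    rw [integral_add j3 (hηi 3), integral_add j2 ((hηi 2).const_mul _),
      integral_add (integrable_const _) j1,
      integral_const_mul (3 * A ^ 2 - 2 * (z + c) * A + 1), integral_const_mul (3 * A - (z + c)), hη0]
    simp
  have hDn : ‖(n : ℂ)⁻¹ * ∑ k, ∫ x, ((colForm x k z - colTrace x z)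
        + (colForm x k z - colTrace x z) ^ 2 * -(z + colForm x k z)⁻¹) ∂P‖ ≤ 5 * (r * W) := by
    rw [norm_mul, norm_inv, Complex.norm_natCast, inv_mul_le_iff₀ hn']
    refine (norm_sum_le _ _).trans ((Finset.sum_le_sum fun k _ => (hD k).2).trans ?_)
    simp
  have e : A * (A ^ 2 - (z + c) * A + 1) = (n : ℂ)⁻¹ * ∑ k, ∫ x, ((colForm x k z - colTrace x z)
        + (colForm x k z - colTrace x z) ^ 2 * -(z + colForm x k z)⁻¹) ∂P
      - (3 * A - (z + c)) * ∫ x, (colTrace x z - τ) ^ 2 ∂P - ∫ x, (colTrace x z - τ) ^ 3 ∂P := by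
    rw [hint]; ring
  rw [e]
  -- The constant 16 collects 5 from the column errors and 11 from the third moment; the second
  -- moment contributes 2|3A - (z + c)|.
  refine (norm_sub_le _ _).trans ((add_le_add (norm_sub_le _ _) le_rfl).trans ?_)
  rw [norm_mul (3 * A - (z + c))]
  have := mul_le_mul_of_nonneg_left hM2' (norm_nonneg (3 * A - (z + c)))
  linarith

end SelfConsistent

/-! ### Stability and bootstrap in the height -/

/-- Stability of the quadratic equation `A ^ 2 - (z + c) * A + 1 = 0` under the error term of the
averaged self-consistent equation. -/
theorem norm_sub_le_of_self_consistent {z c τ₀ A : ℂ} {r : ℝ} (hr : 0 ≤ r) (hz : 0 < z.im)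
    (hc : 0 ≤ (-c).im) (hc8 : ‖c‖ ≤ 8) (hτ : 0 ≤ τ₀.im) (hτ1 : ‖τ₀‖ ≤ 1)
    (heq : (z + τ₀) * (τ₀ - c) = -1) (hA : z.im ≤ A.im)
    (h : ‖A * (A ^ 2 - (z + c) * A + 1)‖
      ≤ r * (A.im + (-c).im) * (16 + 2 * ‖3 * A - (z + c)‖))
    (hΔ : ‖A - (z + τ₀)‖ ≤ 1 / 18) : ‖A - (z + τ₀)‖ ≤ 656 * r := by
  set W := A + (τ₀ - c) with hW
  have hfac : A ^ 2 - (z + c) * A + 1 = (A - (z + τ₀)) * W := by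
    rw [hW]; linear_combination heq
  -- The decisive cancellation: the cofactor dominates the same imaginary part that multiplies the
  -- error, so dividing by it costs nothing.
  have hWim : A.im + (-c).im ≤ ‖W‖ := by
    refine le_trans ?_ ((le_abs_self _).trans (Complex.abs_im_le_norm W))
    rw [hW, Complex.add_im, Complex.sub_im, Complex.neg_im]; linarith
  have hW0 : 0 < ‖W‖ := by linarith
  set Δ := ‖A - (z + τ₀)‖ with hΔd
  set d := ‖3 * A - (z + c)‖ with hd
  have hd0 : 0 ≤ d := norm_nonneg _
  have h1 : ‖A‖ * Δ ≤ r * (16 + 2 * d) := by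
    rw [hfac, norm_mul, norm_mul, ← hΔd] at h
    have h2 : r * (A.im + (-c).im) * (16 + 2 * d) ≤ r * ‖W‖ * (16 + 2 * d) := by gcongr
    refine le_of_mul_le_mul_right ?_ hW0
    calc ‖A‖ * Δ * ‖W‖ = ‖A‖ * (Δ * ‖W‖) := by ring
      _ ≤ r * ‖W‖ * (16 + 2 * d) := h.trans h2
      _ = _ := by ring
  have h9 : ‖τ₀ - c‖ ≤ 9 := (norm_sub_le _ _).trans (by linarith)
  have hd2 : d ≤ 2 * ‖A‖ + Δ + 9 := by
    have e : 3 * A - (z + c) = 2 * A + (A - (z + τ₀)) + (τ₀ - c) := by ring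
    rw [hd, e]
    refine (norm_add_le _ _).trans (add_le_add ((norm_add_le _ _).trans ?_) h9)
    rw [norm_mul]; simp [hΔd]
  -- The two factors of the limit equation have product of modulus 1, and one is at most 9. The
  -- closeness 1/18 then keeps |A| ≥ 1/18, which allows cancelling the extra factor A of the cubic.
  have hA0 : 1 / 9 ≤ ‖z + τ₀‖ := by
    have : ‖z + τ₀‖ * ‖τ₀ - c‖ = 1 := by rw [← norm_mul, heq]; simp
    nlinarith [norm_nonneg (z + τ₀)]
  have hA18 : 1 / 18 ≤ ‖A‖ := by
    have := norm_sub_norm_le (z + τ₀) A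
    rw [norm_sub_rev] at this
    linarith
  have h3 : ‖A‖ * Δ ≤ ‖A‖ * (656 * r) := by
    have h4 : r * (16 + 2 * d) ≤ r * (656 * ‖A‖) := by
      refine mul_le_mul_of_nonneg_left ?_ hr
      linarith
    linarith
  exact le_of_mul_le_mul_left h3 (by linarith)

/-- A continuous function with a forbidden value, small somewhere to the right, is small. -/
theorem le_of_continuousOn_of_gap {f : ℝ → ℝ} {a T b b' : ℝ} (hf : ContinuousOn f (Set.Icc a T))
    (hbb : b' < b) (haT : a ≤ T) (hT : f T ≤ b) (h : ∀ t ∈ Set.Icc a T, f t ≤ b → f t ≤ b') :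
    f a ≤ b := by
  by_contra hlt
  push Not at hlt
  obtain ⟨s, hs, hsb⟩ := intermediate_value_Icc' haT hf ⟨hT, hlt.le⟩
  have := h s hs hsb.le
  linarith

section

variable {ι : Type*} [Fintype ι] [DecidableEq ι] {n : ℕ} {π : Fin n → Measure (ι → ℝ)}
  [∀ k, IsProbabilityMeasure (π k)] {κ y : ℝ}

/-- Stability is conditional: a difference at most 1/18 is improved to 656κ/s², hence to at most
1/36 since v² ≥ 23616κ = 656·36κ. By continuity in the height the values between 1/36 and 1/18
cannot be crossed, so smallness at a large height propagates down to t. -/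
theorem norm_stieltjes_sub_mp_le (hn : 0 < n) (hy : y = Fintype.card ι / n) (hy0 : 0 < y)
    (hy1 : y ≤ 1)
    (hQ : ∀ k, QuadraticConcentration (π k) (n : ℝ)⁻¹ (κ / n)) (hκ : (n : ℝ)⁻¹ ≤ κ)
    (μ : Measure ℝ) [IsProbabilityMeasure μ] (hμ : μ (Set.Iio 0) = 0)
    (htr : ∀ z : ℂ, 0 < z.im → y * (z * ∫ t : ℝ, ((t : ℂ) - z ^ 2)⁻¹ ∂μ)
      = ∫ x, colTrace x z ∂(Measure.pi π))
    {v : ℝ} (hv : 0 < v) (hvκ : 23616 * κ ≤ v ^ 2) {x t : ℝ} (ht : v ≤ t)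
    (hxt : (1 - √y) / 4 ≤ max |x| t) :
    ‖(∫ s : ℝ, ((s : ℂ) - (x + t * Complex.I))⁻¹ ∂symmSqrt μ)
      - ∫ s : ℝ, ((s : ℂ) - (x + t * Complex.I))⁻¹ ∂symmSqrt (mpMeasure y)‖
      ≤ 656 * κ / y / t ^ 2 := by
  have hn' : (0 : ℝ) < n := by exact_mod_cast hn
  have hκ0 : 0 < κ := lt_of_lt_of_le (by positivity) hκ
  have hcard : Fintype.card ι ≤ n := by
    rw [hy, div_le_one hn'] at hy1; exact_mod_cast hy1
  have : IsProbabilityMeasure (mpMeasure y) := isProbabilityMeasure_mpMeasure hy0 hy1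
  have hmp0 : mpMeasure y (Set.Iio 0) = 0 :=
    mpMeasure_eq_zero measurableSet_Iio fun s hs => lt_of_lt_of_le hs (sq_nonneg _)
  set f : ℝ → ℂ := fun t => (∫ s : ℝ, ((s : ℂ) - (x + t * Complex.I))⁻¹ ∂symmSqrt μ)
      - ∫ s : ℝ, ((s : ℂ) - (x + t * Complex.I))⁻¹ ∂symmSqrt (mpMeasure y) with hf
  have hfc : ContinuousOn (fun t => y * ‖f t‖) (Set.Ioi 0) :=
    continuousOn_const.mul ((continuousOn_stieltjes _ x).sub (continuousOn_stieltjes _ x)).norm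
  have key : ∀ s, t ≤ s → y * ‖f s‖ ≤ 1 / 18 → y * ‖f s‖ ≤ 656 * (κ / s ^ 2) := by
    intro s hs hΔ
    have hs0 : 0 < s := by linarith
    set z : ℂ := x + s * Complex.I with hzd
    have hzim : z.im = s := by simp [hzd]
    have hz : 0 < z.im := by rw [hzim]; exact hs0
    have hnv : 1 ≤ n * z.im ^ 2 := by
      rw [hzim]
      have h1 : 1 ≤ n * κ := by rwa [inv_le_iff_one_le_mul₀' hn'] at hκ
      have h2 : κ ≤ s ^ 2 := by nlinarith
      nlinarith
    set c : ℂ := (1 - (Fintype.card ι / n : ℂ)) / z with hc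
    have hcy : c = (1 - (y : ℂ)) / z := by rw [hc, hy]; push_cast; rfl
    set τ₀ : ℂ := y * (z * ∫ t : ℝ, ((t : ℂ) - z ^ 2)⁻¹ ∂(mpMeasure y)) with hτ₀
    obtain ⟨heq, hτ1⟩ := mp_self_consistent hy0 hy1 hz hτ₀
    have heq' : (z + τ₀) * (τ₀ - c) = -1 := by rw [hcy]; exact heq
    set τ : ℂ := ∫ x, colTrace x z ∂(Measure.pi π) with hτ
    have hfs : f s = ((y : ℂ))⁻¹ * (τ - τ₀) := by
      have hy0' : (y : ℂ) ≠ 0 := by exact_mod_cast hy0.ne'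
      rw [hτ, ← htr z hz, hτ₀, ← mul_sub, inv_mul_cancel_left₀ hy0', ← integral_symmSqrt μ hμ hz,
        ← integral_symmSqrt (mpMeasure y) hmp0 hz]
    have hfn : y * ‖f s‖ = ‖(z + τ) - (z + τ₀)‖ := by
      rw [hfs, norm_mul, norm_inv, Complex.norm_real, Real.norm_of_nonneg hy0.le,
        mul_inv_cancel_left₀ hy0.ne', add_sub_add_left_eq_sub]
    rw [hfn] at hΔ ⊢
    have hzn : max |x| s ≤ ‖z‖ := by
      refine max_le ?_ ?_
      · have := Complex.abs_re_le_norm z; simpa [hzd] using this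
      · have := (le_abs_self _).trans (Complex.abs_im_le_norm z); rwa [hzim] at this
    have hz4 : (1 - √y) / 4 ≤ ‖z‖ := hxt.trans ((max_le_max le_rfl hs).trans hzn)
    have hz0 : 0 < ‖z‖ := lt_of_lt_of_le hs0 ((le_max_right _ _).trans hzn)
    -- Since 1 - y = (1 - √y)(1 + √y) ≤ 2(1 - √y) ≤ 8|z|.
    have hc8 : ‖c‖ ≤ 8 := by
      rw [hcy, norm_div, div_le_iff₀ hz0, ← Complex.ofReal_one, ← Complex.ofReal_sub,
        Complex.norm_real, Real.norm_of_nonneg (by linarith)]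
      have h1 : √y ≤ 1 := Real.sqrt_le_one.2 hy1
      have h2 := Real.sq_sqrt hy0.le
      nlinarith [Real.sqrt_nonneg y]
    have hτim : 0 ≤ τ.im := by
      rw [hτ, ← im_integral_colTrace hz]
      exact integral_nonneg fun x => im_colTrace_nonneg hn x hz
    have hτ₀im : 0 ≤ τ₀.im := by
      rw [hτ₀, ← integral_symmSqrt (mpMeasure y) hmp0 hz, Complex.im_ofReal_mul]
      exact mul_nonneg hy0.le (im_stieltjes_nonneg _ hz)
    have hsc := norm_self_consistent_le hn hz hQ hκ hnv hcard rfl hc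
    have hst := norm_sub_le_of_self_consistent (r := κ / z.im ^ 2) (by positivity) hz
      (im_neg_one_sub_div_nonneg hcard hz) hc8 hτ₀im hτ1 (heq' : (z + τ₀) * (τ₀ - c) = -1)
      (A := z + τ) (by rw [Complex.add_im z τ]; linarith) hsc hΔ
    rwa [hzim] at hst
  have hvt : v ^ 2 ≤ t ^ 2 := pow_le_pow_left₀ hv.le ht 2
  have hgap : y * ‖f t‖ ≤ 1 / 18 := by
    -- At height T ≥ 36 each transform is at most 1/36, so the difference is at most 1/18.
    refine le_of_continuousOn_of_gap (f := fun t => y * ‖f t‖) (T := max t 36) (b' := 1 / 36)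
      (hfc.mono fun s hs => lt_of_lt_of_le (by linarith) hs.1) (by norm_num) (le_max_left _ _) ?_ ?_
    · set T := max t 36
      have hT : 36 ≤ T := le_max_right _ _
      have hT0 : 0 < T := by linarith
      have him : ((x : ℂ) + T * Complex.I).im = T := by simp
      have h1 : ‖f T‖ ≤ T⁻¹ + T⁻¹ := by
        refine (norm_sub_le _ _).trans (add_le_add ?_ ?_)
        · have := norm_stieltjes_le (symmSqrt μ) (z := (x : ℂ) + T * Complex.I) (by rw [him]; exact hT0)
          rwa [him] at this
        · have := norm_stieltjes_le (symmSqrt (mpMeasure y)) (z := (x : ℂ) + T * Complex.I)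
            (by rw [him]; exact hT0)
          rwa [him] at this
      have h2 : T⁻¹ ≤ 36⁻¹ := inv_anti₀ (by norm_num) hT
      have h3 : y * ‖f T‖ ≤ 1 * ‖f T‖ := mul_le_mul_of_nonneg_right hy1 (norm_nonneg _)
      norm_num at h2 ⊢
      linarith
    · intro s hs hΔ
      refine (key s hs.1 hΔ).trans ?_
      have ht0 : 0 < t := by linarith
      have h1 : κ / s ^ 2 ≤ κ / t ^ 2 := by
        gcongr; exact hs.1
      have h2 : κ / t ^ 2 ≤ 1 / 23616 := by
        rw [div_le_div_iff₀ (by positivity) (by norm_num)]; linarith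
      linarith
  have h := key t le_rfl hgap
  have e : 656 * κ / y / t ^ 2 = (656 * (κ / t ^ 2)) / y := by ring
  rw [e, le_div_iff₀ hy0, mul_comm]
  exact h

/-- Convergence rate to the Marchenko-Pastur law of a measure whose Stieltjes transform is the
mean normalized trace of the resolvent. -/
theorem abs_cdf_sub_mpCDF_le_of_colTrace (hn : 0 < n) (hy : y = Fintype.card ι / n) (hy0 : 0 < y)
    (hy1 : y ≤ 1)
    (hQ : ∀ k, QuadraticConcentration (π k) (n : ℝ)⁻¹ (κ / n)) (hκ : (n : ℝ)⁻¹ ≤ κ)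
    (μ : Measure ℝ) [IsProbabilityMeasure μ] (hμ : μ (Set.Iio 0) = 0)
    (htr : ∀ z : ℂ, 0 < z.im → y * (z * ∫ t : ℝ, ((t : ℂ) - z ^ 2)⁻¹ ∂μ)
      = ∫ x, colTrace x z ∂(Measure.pi π)) (x : ℝ) :
    |μ.real (Set.Iic x) - mpCDF y x| ≤ 2473 / y * √κ := by
  have hn' : (0 : ℝ) < n := by exact_mod_cast hn
  have hκ0 : 0 < κ := lt_of_lt_of_le (by positivity) hκ
  have hs : 0 < √κ := Real.sqrt_pos.2 hκ0
  have hsq := Real.sq_sqrt hκ0.le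
  -- The choice works because 154² = 23716 ≥ 23616; the final constant 2473 bounds 2·656/154 +
  -- 16·154.
  have hv : 0 < 154 * √κ := by positivity
  have h := abs_cdf_sub_mpCDF_le hy0 hy1 μ hμ hv (K := 656 * κ / y) (by positivity)
    (fun x t ht hxt => norm_stieltjes_sub_mp_le hn hy hy0 hy1 hQ hκ μ hμ htr hv
      (by rw [mul_pow, hsq]; linarith) ht hxt) x
  refine h.trans ?_
  have e : 2 * (656 * κ / y / (154 * √κ)) + 16 * (154 * √κ / y)
      = (1312 / 154 + 2464) / y * √κ := by
    rw [← hsq]; field_simp; rw [Real.sqrt_sq (Real.sqrt_nonneg κ)]; ring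
  rw [e]
  gcongr
  norm_num

end

/-! ### Spectral decomposition, measurability and the mean spectral law -/

theorem diagonal_add_pi {K ι : Type*} [Field K] [DecidableEq ι] (d e : ι → K) :
    Matrix.diagonal (d + e) = Matrix.diagonal d + Matrix.diagonal e :=
  (Matrix.diagonal_add d e).symm

section Diagonalization

variable {K ι : Type*} [Field K] [Fintype ι] [DecidableEq ι] {V V' : Matrix ι ι K}

theorem one_eq_conj_diagonal (h : V * V' = 1) : 1 = V * Matrix.diagonal (1 : ι → K) * V' := by
  have : Matrix.diagonal (1 : ι → K) = 1 := Matrix.diagonal_one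
  rw [this, Matrix.mul_one, h]

theorem conj_diagonal_pow (h : V' * V = 1) (h' : V * V' = 1) (d : ι → K) (k : ℕ) :
    (V * Matrix.diagonal d * V') ^ k = V * Matrix.diagonal (d ^ k) * V' := by
  induction k with
  | zero => simp [h', Matrix.diagonal_one']
  | succ k ih =>
    have e : V * Matrix.diagonal (d ^ k) * V' * (V * Matrix.diagonal d * V')
        = V * Matrix.diagonal (d ^ k) * (V' * V) * Matrix.diagonal d * V' := by
      simp only [Matrix.mul_assoc]
    rw [pow_succ, ih, e, h, Matrix.mul_one, Matrix.mul_assoc V, Matrix.diagonal_mul_diagonal]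
    congr 3
    funext i; simp [pow_succ]

theorem trace_inv_conj_diagonal (h : V' * V = 1) (h' : V * V' = 1) {d : ι → K}
    (hd : ∀ i, d i ≠ 0) :
    ((V * Matrix.diagonal d * V')⁻¹).trace = ∑ i, (d i)⁻¹ := by
  have hinv : (V * Matrix.diagonal d * V')⁻¹ = V * Matrix.diagonal (fun i => (d i)⁻¹) * V' := by
    refine Matrix.inv_eq_right_inv ?_
    have e : V * Matrix.diagonal d * V' * (V * Matrix.diagonal (fun i => (d i)⁻¹) * V')
        = V * Matrix.diagonal d * (V' * V) * Matrix.diagonal (fun i => (d i)⁻¹) * V' := by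
      simp only [Matrix.mul_assoc]
    rw [e, h, Matrix.mul_one, Matrix.mul_assoc V, Matrix.diagonal_mul_diagonal]
    have : (fun i => d i * (d i)⁻¹) = fun _ => (1 : K) := by
      ext i; exact mul_inv_cancel₀ (hd i)
    rw [this]
    simp [h']
  rw [hinv, Matrix.trace_mul_comm, ← Matrix.mul_assoc, h, Matrix.one_mul, Matrix.trace_diagonal]

end Diagonalization

section Gram

variable {p n : ℕ}

/-- The matrix with given columns. -/
def ofCols (x : Fin n → Fin p → ℝ) : Matrix (Fin p) (Fin n) ℝ := Matrix.of fun i k => x k i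

theorem continuous_ofCols_gram :
    Continuous fun x : Fin n → Fin p → ℝ => ofCols x * (ofCols x)ᵀ := by
  refine continuous_matrix fun i j => ?_
  simp only [Matrix.mul_apply, Matrix.transpose_apply, ofCols, Matrix.of_apply]
  fun_prop

theorem colGram_eq_map (x : Fin n → Fin p → ℝ) :
    colGram x = (ofCols x * (ofCols x)ᵀ).map Complex.ofReal := by
  ext i j
  simp [colGram, Matrix.sum_apply, Matrix.vecMulVec_apply, Matrix.mul_apply, ofCols]

theorem eigenvalues_gram_nonneg (A : Matrix (Fin p) (Fin n) ℝ) (i : Fin p) :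
    0 ≤ (isHermitian_gram A).eigenvalues i := by
  have h := Matrix.posSemidef_self_mul_conjTranspose A
  rw [Matrix.conjTranspose_eq_transpose_of_trivial] at h
  exact h.eigenvalues_nonneg i

/-- Orthogonal diagonalization of the Gram matrix. -/
theorem exists_gram_eq_conj (A : Matrix (Fin p) (Fin n) ℝ) :
    ∃ V V' : Matrix (Fin p) (Fin p) ℝ, V' * V = 1 ∧ V * V' = 1 ∧
      A * Aᵀ = V * Matrix.diagonal (isHermitian_gram A).eigenvalues * V' := by
  refine ⟨(isHermitian_gram A).eigenvectorUnitary,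
    star ((isHermitian_gram A).eigenvectorUnitary : Matrix (Fin p) (Fin p) ℝ),
    Unitary.coe_star_mul_self _, Unitary.coe_mul_star_self _, ?_⟩
  conv_lhs => rw [(isHermitian_gram A).spectral_theorem, Unitary.conjStarAlgAut_apply]
  rfl

theorem trace_sqResolvent_colGram (x : Fin n → Fin p → ℝ) {z : ℂ} (hz : 0 < z.im) :
    (sqResolvent (colGram x) z).trace
      = z * ∑ i, (((isHermitian_gram (ofCols x)).eigenvalues i : ℂ) - z ^ 2)⁻¹ := by
  obtain ⟨V, V', h, h', e⟩ := exists_gram_eq_conj (ofCols x)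
  set d := (isHermitian_gram (ofCols x)).eigenvalues with hd
  set W := V.map Complex.ofReal
  set W' := V'.map Complex.ofReal
  have hmul : ∀ B C : Matrix (Fin p) (Fin p) ℝ,
      (B * C).map Complex.ofReal = B.map Complex.ofReal * C.map Complex.ofReal := fun B C =>
    Matrix.map_mul (f := Complex.ofRealHom)
  have hW : W' * W = 1 := by rw [← hmul, h]; exact Matrix.map_one _ (by simp) (by simp)
  have hW' : W * W' = 1 := by rw [← hmul, h']; exact Matrix.map_one _ (by simp) (by simp)
  have hc : colGram x = W * Matrix.diagonal (fun i => (d i : ℂ)) * W' := by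
    rw [colGram_eq_map, e, hmul, hmul, Matrix.diagonal_map (by simp)]
  have hc2 : colGram x - (z ^ 2) • (1 : Matrix (Fin p) (Fin p) ℂ)
      = W * Matrix.diagonal (fun i => (d i : ℂ) - z ^ 2) * W' := by
    have : Matrix.diagonal (fun i => (d i : ℂ) - z ^ 2)
        = Matrix.diagonal (fun i => (d i : ℂ)) - (z ^ 2) • (1 : Matrix (Fin p) (Fin p) ℂ) := by
      ext i j
      by_cases hij : i = j <;> simp [hij]
    rw [hc, this, Matrix.mul_sub, Matrix.sub_mul, Matrix.mul_smul, Matrix.smul_mul, Matrix.mul_one,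
      hW']
  rw [sqResolvent, Matrix.trace_smul, smul_eq_mul, hc2, trace_inv_conj_diagonal hW hW']
  intro i h0
  refine sq_ne_ofReal_of_nonneg hz (eigenvalues_gram_nonneg (ofCols x) i) ?_
  rw [← hd]
  exact (sub_eq_zero.1 h0).symm

/-- A rational function of the Gram matrix approximating a spectral projection. -/
theorem trace_inv_gram (A : Matrix (Fin p) (Fin n) ℝ) {b s : ℝ} (hb : 0 ≤ b) (hs : 0 ≤ s) (k : ℕ) :
    ((1 + s • (b • (1 + A * Aᵀ)) ^ k)⁻¹).trace
      = ∑ i, (1 + s * (b * (1 + (isHermitian_gram A).eigenvalues i)) ^ k)⁻¹ := by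
  obtain ⟨V, V', h, h', e⟩ := exists_gram_eq_conj A
  have h0 := eigenvalues_gram_nonneg A
  set d := (isHermitian_gram A).eigenvalues with hd
  have hone := one_eq_conj_diagonal h'
  have h1 : b • (1 + A * Aᵀ) = V * Matrix.diagonal (fun i => b * (1 + d i)) * V' := by
    have : (fun i => b * (1 + d i)) = b • ((1 : Fin p → ℝ) + d) := rfl
    rw [this, Matrix.diagonal_smul, diagonal_add_pi, e]
    nth_rewrite 1 [hone]
    rw [Matrix.mul_smul, Matrix.smul_mul, Matrix.mul_add, Matrix.add_mul]
  have h2 : 1 + s • (b • (1 + A * Aᵀ)) ^ k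
      = V * Matrix.diagonal (fun i => 1 + s * (b * (1 + d i)) ^ k) * V' := by
    have : (fun i => 1 + s * (b * (1 + d i)) ^ k)
        = (1 : Fin p → ℝ) + s • (fun i => b * (1 + d i)) ^ k := rfl
    rw [this, diagonal_add_pi, Matrix.diagonal_smul, h1, conj_diagonal_pow h h']
    nth_rewrite 1 [hone]
    rw [Matrix.mul_add, Matrix.add_mul, Matrix.mul_smul, Matrix.smul_mul]
  rw [h2, trace_inv_conj_diagonal h h']
  intro i
  have := h0 i
  positivity

/-- The factor 1/(k + 1) tips the boundary case t = 1 to the limit 1 instead of 1/2, matching the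
closed half-line, and is still beaten by exponential growth when t > 1. -/
theorem tendsto_inv_one_add_pow {t : ℝ} (ht : 0 ≤ t) :
    Tendsto (fun k : ℕ => (1 + ((k : ℝ) + 1)⁻¹ * t ^ k)⁻¹) atTop
      (𝓝 (Set.indicator (Set.Iic 1) (fun _ => (1 : ℝ)) t)) := by
  rcases le_or_gt t 1 with h | h
  · rw [Set.indicator_of_mem (Set.mem_Iic.2 h)]
    have h1 : Tendsto (fun k : ℕ => ((k : ℝ) + 1)⁻¹) atTop (𝓝 0) := by
      simpa [one_div] using tendsto_one_div_add_atTop_nhds_zero_nat (𝕜 := ℝ)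
    have h2 : Tendsto (fun k : ℕ => ((k : ℝ) + 1)⁻¹ * t ^ k) atTop (𝓝 0) :=
      squeeze_zero (fun k => by positivity)
        (fun k => mul_le_of_le_one_right (by positivity) (pow_le_one₀ ht h)) h1
    have h3 := (h2.const_add 1).inv₀ (by norm_num)
    simpa using h3
  · rw [Set.indicator_of_notMem (by simpa using h)]
    refine Tendsto.inv_tendsto_atTop (tendsto_atTop_add_const_left _ _ ?_)
    have h1 := tendsto_pow_const_div_const_pow_of_one_lt 1 h
    have h2 : Tendsto (fun k : ℕ => ((k : ℝ) + 1) / t ^ k) atTop (𝓝[>] 0) := by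
      rw [tendsto_nhdsWithin_iff]
      refine ⟨?_, Eventually.of_forall fun k => by simp only [Set.mem_Ioi]; positivity⟩
      have h3 := tendsto_pow_const_div_const_pow_of_one_lt 0 h
      have := h1.add h3
      simp only [pow_one, pow_zero, add_zero] at this
      refine this.congr fun k => ?_
      ring
    have h4 := h2.inv_tendsto_nhdsGT_zero
    refine h4.congr fun k => ?_
    simp only [Pi.inv_apply, inv_div]
    ring

/-- Measurability of individual eigenvalues is avoided: the count is a pointwise limit of traces of
rational functions of the Gram matrix, which are measurable in the entries by Cramer's rule. -/
theorem measurable_gramESD (t : ℝ) :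
    Measurable fun x : Fin n → Fin p → ℝ => gramESD (ofCols x) t := by
  rcases lt_or_ge t 0 with ht | ht
  · have : (fun x : Fin n → Fin p → ℝ => gramESD (ofCols x) t) = fun _ => 0 := by
      funext x
      rw [gramESD, Finset.sum_eq_zero, mul_zero]
      intro i _
      refine Set.indicator_of_notMem ?_ _
      have := eigenvalues_gram_nonneg (ofCols x) i
      simp only [Set.mem_Iic, not_le]; linarith
    rw [this]
    exact measurable_const
  · have ht1 : 0 < 1 + t := by linarith
    refine measurable_of_tendsto_metrizable
      (f := fun (k : ℕ) x => 1 / (p : ℝ) *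
        ((1 + ((k : ℝ) + 1)⁻¹ • ((1 + t)⁻¹ • (1 + ofCols x * (ofCols x)ᵀ)) ^ k)⁻¹).trace) ?_ ?_
    · intro k
      have hc : Continuous fun x : Fin n → Fin p → ℝ =>
          1 + ((k : ℝ) + 1)⁻¹ • ((1 + t)⁻¹ • (1 + ofCols x * (ofCols x)ᵀ)) ^ k :=
        have h1 : Continuous fun x : Fin n → Fin p → ℝ => 1 + ofCols x * (ofCols x)ᵀ :=
          continuous_const.add continuous_ofCols_gram
        have h2 : Continuous fun x : Fin n → Fin p → ℝ =>
            (1 + t)⁻¹ • (1 + ofCols x * (ofCols x)ᵀ) := h1.const_smul (1 + t)⁻¹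
        have h3 : Continuous fun x : Fin n → Fin p → ℝ =>
            ((1 + t)⁻¹ • (1 + ofCols x * (ofCols x)ᵀ)) ^ k := h2.pow k
        have h4 : Continuous fun x : Fin n → Fin p → ℝ =>
            ((k : ℝ) + 1)⁻¹ • ((1 + t)⁻¹ • (1 + ofCols x * (ofCols x)ᵀ)) ^ k := h3.const_smul ((k : ℝ) + 1)⁻¹
        continuous_const.add h4
      have hdet := hc.matrix_det.measurable.inv
      have htr := hc.matrix_adjugate.matrix_trace.measurable
      have : (fun x : Fin n → Fin p → ℝ => 1 / (p : ℝ) *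
          ((1 + ((k : ℝ) + 1)⁻¹ • ((1 + t)⁻¹ • (1 + ofCols x * (ofCols x)ᵀ)) ^ k)⁻¹).trace)
          = fun x => 1 / (p : ℝ) *
          ((1 + ((k : ℝ) + 1)⁻¹ • ((1 + t)⁻¹ • (1 + ofCols x * (ofCols x)ᵀ)) ^ k).det⁻¹ *
          (1 + ((k : ℝ) + 1)⁻¹ • ((1 + t)⁻¹ • (1 + ofCols x * (ofCols x)ᵀ)) ^ k).adjugate.trace) := by
        funext x
        rw [Matrix.inv_def, Ring.inverse_eq_inv', Matrix.trace_smul, smul_eq_mul]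
      rw [this]
      exact (hdet.mul htr).const_mul _
    · rw [tendsto_pi_nhds]
      intro x
      have e : ∀ k : ℕ, ((1 + ((k : ℝ) + 1)⁻¹ • ((1 + t)⁻¹ • (1 + ofCols x * (ofCols x)ᵀ)) ^ k)⁻¹).trace
          = ∑ i, (1 + ((k : ℝ) + 1)⁻¹ * ((1 + t)⁻¹ *
            (1 + (isHermitian_gram (ofCols x)).eigenvalues i)) ^ k)⁻¹ := fun k =>
        trace_inv_gram _ (by positivity) (by positivity) k
      simp only [e, gramESD]
      refine Tendsto.const_mul _ (tendsto_finsetSum _ fun i _ => ?_)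
      have h0 := eigenvalues_gram_nonneg (ofCols x) i
      have h := tendsto_inv_one_add_pow
        (t := (1 + t)⁻¹ * (1 + (isHermitian_gram (ofCols x)).eigenvalues i)) (by positivity)
      convert h using 2
      simp only [Set.indicator_apply, Set.mem_Iic]
      refine if_congr ?_ rfl rfl
      rw [inv_mul_le_iff₀ ht1]
      constructor <;> intro _ <;> linarith

/-- The empirical spectral distribution of the Gram matrix with given columns. -/
noncomputable def gramMeasure (x : Fin n → Fin p → ℝ) : Measure ℝ :=
  ENNReal.ofReal (1 / p) • ∑ i, Measure.dirac ((isHermitian_gram (ofCols x)).eigenvalues i)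

theorem isProbabilityMeasure_gramMeasure (hp : 0 < p) (x : Fin n → Fin p → ℝ) :
    IsProbabilityMeasure (gramMeasure x) := by
  have hp' : (0 : ℝ) < p := by exact_mod_cast hp
  constructor
  simp only [gramMeasure, Measure.smul_apply, Measure.finsetSum_apply, smul_eq_mul, measure_univ,
    Finset.sum_const, Finset.card_univ, Fintype.card_fin, nsmul_eq_mul, mul_one]
  rw [← ENNReal.ofReal_natCast, ← ENNReal.ofReal_mul (by positivity), one_div,
    inv_mul_cancel₀ hp'.ne', ENNReal.ofReal_one]

theorem gramMeasure_Iic (x : Fin n → Fin p → ℝ) (t : ℝ) :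
    gramMeasure x (Set.Iic t) = ENNReal.ofReal (gramESD (ofCols x) t) := by
  simp only [gramMeasure, Measure.smul_apply, Measure.finsetSum_apply, smul_eq_mul, gramESD,
    Measure.dirac_apply' _ measurableSet_Iic]
  rw [ENNReal.ofReal_mul (by positivity), ENNReal.ofReal_sum_of_nonneg]
  · congr 1
    refine Finset.sum_congr rfl fun i _ => ?_
    by_cases h : (isHermitian_gram (ofCols x)).eigenvalues i ≤ t <;> simp [h]
  · exact fun i _ => Set.indicator_nonneg (fun _ _ => zero_le_one) _

theorem gramMeasure_Iio_zero (x : Fin n → Fin p → ℝ) : gramMeasure x (Set.Iio 0) = 0 := by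
  simp only [gramMeasure, Measure.smul_apply, Measure.finsetSum_apply, smul_eq_mul,
    Measure.dirac_apply' _ measurableSet_Iio]
  rw [Finset.sum_eq_zero, mul_zero]
  intro i _
  exact Set.indicator_of_notMem (by simpa using eigenvalues_gram_nonneg (ofCols x) i) _

theorem integral_gramMeasure (x : Fin n → Fin p → ℝ) (f : ℝ → ℂ) :
    ∫ t, f t ∂(gramMeasure x)
      = (p : ℂ)⁻¹ * ∑ i, f ((isHermitian_gram (ofCols x)).eigenvalues i) := by
  rw [gramMeasure, integral_smul_measure, integral_finsetSum_measure]
  · simp only [integral_dirac]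
    rw [ENNReal.toReal_ofReal (by positivity), Complex.real_smul]
    push_cast
    rw [one_div]
  · exact fun i _ => integrable_dirac (by simp)

theorem measurable_gramMeasure (hp : 0 < p) :
    Measurable (gramMeasure : (Fin n → Fin p → ℝ) → Measure ℝ) := by
  have : ∀ x : Fin n → Fin p → ℝ, IsProbabilityMeasure (gramMeasure x) :=
    isProbabilityMeasure_gramMeasure hp
  refine Measurable.measure_of_isPiSystem_of_isProbabilityMeasure (borel_eq_generateFrom_Iic ℝ)
    isPiSystem_Iic ?_
  rintro _ ⟨t, rfl⟩
  simp only [gramMeasure_Iic]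
  exact (measurable_gramESD t).ennreal_ofReal

theorem gramESD_nonneg (A : Matrix (Fin p) (Fin n) ℝ) (t : ℝ) : 0 ≤ gramESD A t :=
  mul_nonneg (by positivity) (Finset.sum_nonneg fun _ _ =>
    Set.indicator_nonneg (fun _ _ => zero_le_one) _)

theorem colTrace_eq_integral_gramMeasure (hp : 0 < p) (x : Fin n → Fin p → ℝ) {z : ℂ}
    (hz : 0 < z.im) :
    colTrace x z = ((p : ℝ) / n : ℝ) * (z * ∫ t : ℝ, ((t : ℂ) - z ^ 2)⁻¹ ∂(gramMeasure x)) := by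
  have hp' : (p : ℂ) ≠ 0 := by exact_mod_cast hp.ne'
  rw [integral_gramMeasure, colTrace, trace_sqResolvent_colGram x hz]
  push_cast
  field_simp

/-- The mean empirical spectral distribution. -/
theorem exists_mean_spectral_measure (hp : 0 < p) (P : Measure (Fin n → Fin p → ℝ))
    [IsProbabilityMeasure P] :
    ∃ ν : Measure ℝ, IsProbabilityMeasure ν ∧ ν (Set.Iio 0) = 0 ∧
      (∀ t, ν.real (Set.Iic t) = ∫ x, gramESD (ofCols x) t ∂P) ∧
      ∀ z : ℂ, 0 < z.im → ((p : ℝ) / n : ℝ) * (z * ∫ t : ℝ, ((t : ℂ) - z ^ 2)⁻¹ ∂ν)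
        = ∫ x, colTrace x z ∂P := by
  have hpr : ∀ x : Fin n → Fin p → ℝ, IsProbabilityMeasure (gramMeasure x) :=
    isProbabilityMeasure_gramMeasure hp
  have hm := measurable_gramMeasure (p := p) (n := n) hp
  let η : Kernel (Fin n → Fin p → ℝ) ℝ := ⟨gramMeasure, hm⟩
  have hη : IsMarkovKernel η := ⟨hpr⟩
  set κ : Kernel Unit (Fin n → Fin p → ℝ) := Kernel.const Unit P
  have hν : ∀ s, MeasurableSet s → (η ∘ₖ κ) () s = ∫⁻ x, gramMeasure x s ∂P := fun s hs =>
    Kernel.comp_apply' η κ () hs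
  have hprob : IsProbabilityMeasure ((η ∘ₖ κ) ()) := inferInstance
  refine ⟨(η ∘ₖ κ) (), hprob, ?_, fun t => ?_, fun z hz => ?_⟩
  · rw [hν _ measurableSet_Iio]
    simp [gramMeasure_Iio_zero]
  · rw [measureReal_def, hν _ measurableSet_Iic, integral_eq_lintegral_of_nonneg_ae
      (ae_of_all _ fun x => gramESD_nonneg _ _) (measurable_gramESD t).aestronglyMeasurable]
    simp only [gramMeasure_Iic]
  · have hbd : Integrable (fun t : ℝ => ((t : ℂ) - z ^ 2)⁻¹) ((η ∘ₖ κ) ()) := by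
      have hnn : ∀ᵐ t ∂((η ∘ₖ κ) ()), (0 : ℝ) ≤ t := by
        rw [ae_iff]
        simp only [not_le]
        change (η ∘ₖ κ) () (Set.Iio 0) = 0
        rw [hν _ measurableSet_Iio]
        simp [gramMeasure_Iio_zero]
      -- The distance from z² to the closed nonnegative half-line is positive, so the integrand is
      -- bounded on the support.
      obtain ⟨c, hc0, hc⟩ : ∃ c : ℝ, 0 < c ∧ ∀ t : ℝ, 0 ≤ t → c ≤ ‖(t : ℂ) - z ^ 2‖ := by
        have hne : ∀ t : ℝ, 0 ≤ t → (t : ℂ) - z ^ 2 ≠ 0 := fun t ht h =>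
          sq_ne_ofReal_of_nonneg hz ht (sub_eq_zero.1 h).symm
        have hcl : IsClosed ((fun t : ℝ => (t : ℂ)) '' Set.Ici 0) :=
          (Complex.isometry_ofReal.isClosedEmbedding).isClosedMap _ isClosed_Ici
        have hnm : z ^ 2 ∉ (fun t : ℝ => (t : ℂ)) '' Set.Ici 0 := by
          rintro ⟨t, ht, h⟩
          exact sq_ne_ofReal_of_nonneg hz ht h.symm
        refine ⟨Metric.infDist (z ^ 2) ((fun t : ℝ => (t : ℂ)) '' Set.Ici 0),
          (hcl.notMem_iff_infDist_pos ⟨0, 0, by simp, by simp⟩).1 hnm, fun t ht => ?_⟩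
        rw [← dist_eq_norm, dist_comm]
        exact Metric.infDist_le_dist_of_mem ⟨t, ht, rfl⟩
      refine Integrable.of_bound (C := c⁻¹) (by fun_prop) (hnn.mono fun t ht => ?_)
      rw [norm_inv]
      exact inv_anti₀ hc0 (hc t ht)
    rw [Kernel.integral_comp hbd]
    simp only [fun x : Fin n → Fin p → ℝ => colTrace_eq_integral_gramMeasure hp x hz]
    rw [integral_const_mul, integral_const_mul]
    rfl

end Gram

/-! ### Independence of columns and moments of sparse entries -/

section Independence

variable {Ω ι : Type*} [MeasurableSpace Ω] {μ : Measure Ω} [IsProbabilityMeasure μ]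

/-- Two independent families of independent variables give independent pairs. -/
theorem iIndepFun_pair [Fintype ι] {α β : Type*} [MeasurableSpace α] [MeasurableSpace β]
    {f : ι → Ω → α} {g : ι → Ω → β} (hf : ∀ i, Measurable (f i)) (hg : ∀ i, Measurable (g i))
    (hfi : iIndepFun f μ) (hgi : iIndepFun g μ)
    (hfg : IndepFun (fun ω i => f i ω) (fun ω i => g i ω) μ) :
    iIndepFun (fun i ω => (f i ω, g i ω)) μ := by
  have hF : Measurable fun ω i => f i ω := measurable_pi_iff.2 hf
  have hG : Measurable fun ω i => g i ω := measurable_pi_iff.2 hg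
  have pf : ∀ i, IsProbabilityMeasure (μ.map (f i)) := fun i =>
    Measure.isProbabilityMeasure_map (hf i).aemeasurable
  have pg : ∀ i, IsProbabilityMeasure (μ.map (g i)) := fun i =>
    Measure.isProbabilityMeasure_map (hg i).aemeasurable
  rw [iIndepFun_iff_map_fun_eq_pi_map fun i => ((hf i).prodMk (hg i)).aemeasurable]
  have hpair : ∀ i, μ.map (fun ω => (f i ω, g i ω)) = (μ.map (f i)).prod (μ.map (g i)) := fun i =>
    (indepFun_iff_map_prod_eq_prod_map_map (hf i).aemeasurable (hg i).aemeasurable).1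
      (hfg.comp (measurable_pi_apply i) (measurable_pi_apply i))
  simp only [hpair]
  have h1 := (indepFun_iff_map_prod_eq_prod_map_map hF.aemeasurable hG.aemeasurable).1 hfg
  rw [(iIndepFun_iff_map_fun_eq_pi_map fun i => (hf i).aemeasurable).1 hfi,
    (iIndepFun_iff_map_fun_eq_pi_map fun i => (hg i).aemeasurable).1 hgi] at h1
  have h2 := measurePreserving_arrowProdEquivProdArrow α β ι (fun i => μ.map (f i))
    (fun i => μ.map (g i))
  rw [← (h2.symm _).map_eq, ← h1, Measure.map_map (MeasurableEquiv.measurable _) (hF.prodMk hG)]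
  rfl

/-- Independence of blocks of an independent array. -/
theorem map_columns_eq_pi {m n : ℕ} {h : Fin m → Fin n → Ω → ℝ}
    (hm : ∀ i k, Measurable (h i k))
    (hind : iIndepFun (fun i : Fin m × Fin n => h i.1 i.2) μ) :
    μ.map (fun ω k i => h i k ω) = Measure.pi fun k => μ.map fun ω i => h i k ω := by
  have hp : ∀ (k : Fin n) (i : Fin m), IsProbabilityMeasure (μ.map (h i k)) := fun k i =>
    Measure.isProbabilityMeasure_map (hm i k).aemeasurable
  have hswap : iIndepFun (fun q : Fin n × Fin m => h q.2 q.1) μ :=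
    hind.precomp (g := Prod.swap) Prod.swap_injective
  have hall := (iIndepFun_iff_map_fun_eq_pi_map
    fun q : Fin n × Fin m => (hm q.2 q.1).aemeasurable).1 hswap
  have hcol : ∀ k, μ.map (fun ω i => h i k ω) = Measure.pi fun i => μ.map (h i k) := fun k =>
    (iIndepFun_iff_map_fun_eq_pi_map fun i => (hm i k).aemeasurable).1
      (hind.precomp (g := fun i => (i, k)) fun a b hab => by simpa using hab)
  have hc := Measure.infinitePi_map_curry fun (k : Fin n) (i : Fin m) => μ.map (h i k)
  simp only [Measure.infinitePi_eq_pi] at hc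
  simp only [hcol]
  have hms : Measurable fun ω (q : Fin n × Fin m) => h q.2 q.1 ω :=
    measurable_pi_iff.2 fun q => hm q.2 q.1
  rw [← hc, ← hall, Measure.map_map (MeasurableEquiv.measurable _) hms]
  rfl

end Independence

section Entries

variable {Ω : Type*} [MeasurableSpace Ω] {μ : Measure Ω} {e X : Ω → ℝ} {q : ℝ}

/-- A variable with values in {0, 1} equals all its positive powers. Fourth moments thus keep a
single factor q, the source of M/(nq) in the rate. -/
theorem integral_bernoulli_pow (he : IsBernoulliVar μ e q) {m : ℕ} (hm : m ≠ 0) :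
    ∫ ω, e ω ^ m ∂μ = q := by
  obtain ⟨h1, h2, h3⟩ := he
  have hs : MeasurableSet {ω | e ω = 1} := h1 (measurableSet_singleton 1)
  have : (fun ω => e ω ^ m) =ᵐ[μ] Set.indicator {ω | e ω = 1} fun _ => (1 : ℝ) := by
    filter_upwards [h2] with ω hω
    rcases hω with h | h
    · rw [Set.indicator_of_notMem (by simp [h]), h, zero_pow hm]
    · rw [Set.indicator_of_mem (by simpa using h), h, one_pow]
  rw [integral_congr_ae this, integral_indicator hs]
  simpa using h3

theorem bernoulli_param_le_one [IsProbabilityMeasure μ] (he : IsBernoulliVar μ e q) : q ≤ 1 := by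
  rw [← he.2.2]; exact measureReal_le_one

theorem integral_sparse_entry_pow (he : IsBernoulliVar μ e q) (hX : Measurable X)
    (hind : IndepFun e X μ) (a : ℝ) {m : ℕ} (hm : m ≠ 0) :
    ∫ ω, (a * (e ω * X ω)) ^ m ∂μ = a ^ m * (q * ∫ ω, X ω ^ m ∂μ) := by
  simp only [mul_pow]
  rw [integral_const_mul]
  have hi : IndepFun (fun ω => e ω ^ m) (fun ω => X ω ^ m) μ :=
    hind.comp (measurable_id.pow_const m) (measurable_id.pow_const m)
  rw [hi.integral_fun_mul_eq_mul_integral (he.1.pow_const m).aestronglyMeasurable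
    (hX.pow_const m).aestronglyMeasurable, integral_bernoulli_pow he hm]

theorem memLp_sparse_entry (he : IsBernoulliVar μ e q) (hX : MemLp X 4 μ) (hXm : Measurable X)
    (a : ℝ) : MemLp (fun ω => a * (e ω * X ω)) 4 μ := by
  refine MemLp.const_mul (hX.mono (he.1.mul hXm).aestronglyMeasurable ?_) a
  filter_upwards [he.2.1] with ω hω
  rcases hω with h | h <;> simp [h]

/-- From x⁴ ≥ 2x² - 1. Together with q ≤ 1 it ensures κ ≥ 1/n, so that rank-one errors of order 1/n
are dominated by κ. -/
theorem one_le_fourth_moment [IsProbabilityMeasure μ] (hX : MemLp X 4 μ) (h2 : ∫ ω, |X ω| ^ 2 ∂μ = 1) :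
    1 ≤ ∫ ω, |X ω| ^ 4 ∂μ := by
  have h4 : Integrable (fun ω => |X ω| ^ 4) μ := by
    have := hX.integrable_norm_pow (p := 4) (by norm_num)
    simpa using this
  have h2' : Integrable (fun ω => |X ω| ^ 2) μ := by
    -- Otherwise the Bochner integral would be 0, not 1.
    by_contra h
    rw [integral_undef h] at h2
    norm_num at h2
  have hle : ∫ ω, (2 * |X ω| ^ 2 - 1) ∂μ ≤ ∫ ω, |X ω| ^ 4 ∂μ := by
    refine integral_mono ((h2'.const_mul 2).sub (integrable_const 1)) h4 fun ω => ?_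
    change 2 * |X ω| ^ 2 - 1 ≤ |X ω| ^ 4
    nlinarith [sq_nonneg (|X ω| ^ 2 - 1)]
  rw [integral_sub (h2'.const_mul 2) (integrable_const 1), integral_const_mul, h2] at hle
  simp only [integral_const, probReal_univ, one_smul] at hle
  linarith

end Entries

/-! ### Assembly for the sparse model -/

section Sparse

variable {Ω : Type*} [MeasurableSpace Ω] {μ : Measure Ω} [IsProbabilityMeasure μ] {p n : ℕ}
  {q M : ℝ} {X e : Fin p → Fin n → Ω → ℝ}

/-- Rate of convergence to the Marchenko-Pastur law for sparse sample covariance matrices. -/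
theorem abs_integral_gramESD_sparse_sub_mpCDF_le (hp : 0 < p) (hn : 0 < n) (hpn : p ≤ n)
    (hq : 0 < q) (hXm : ∀ j k, Measurable (X j k))
    (hXi : iIndepFun (fun i : Fin p × Fin n => X i.1 i.2) μ)
    (hX4 : ∀ j k, MemLp (X j k) 4 μ) (hX0 : ∀ j k, ∫ ω, X j k ω ∂μ = 0)
    (hX2 : ∀ j k, ∫ ω, |X j k ω| ^ 2 ∂μ = 1) (hM : ∀ j k, ∫ ω, |X j k ω| ^ 4 ∂μ ≤ M)
    (he : ∀ j k, IsBernoulliVar μ (e j k) q)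
    (hei : iIndepFun (fun i : Fin p × Fin n => e i.1 i.2) μ)
    (heX : IndepFun (fun ω (i : Fin p × Fin n) => e i.1 i.2 ω)
      (fun ω (i : Fin p × Fin n) => X i.1 i.2 ω) μ) (x : ℝ) :
    |(∫ ω, gramESD (sparseMatrix q (fun j k => e j k ω) (fun j k => X j k ω)) x ∂μ)
        - mpCDF ((p : ℝ) / n) x|
      ≤ 2473 / ((p : ℝ) / n) * √(8 * (M / (n * q))) := by
  have hn' : (0 : ℝ) < n := by exact_mod_cast hn
  have hp' : (0 : ℝ) < p := by exact_mod_cast hp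
  set a : ℝ := 1 / √((n : ℝ) * q) with ha
  have ha2 : a ^ 2 = 1 / (n * q) := by
    rw [ha, div_pow, Real.sq_sqrt (by positivity), one_pow]
  have ha4 : a ^ 4 = 1 / (n * q) ^ 2 := by
    rw [show a ^ 4 = (a ^ 2) ^ 2 by ring, ha2, div_pow, one_pow]
  set h : Fin p → Fin n → Ω → ℝ := fun j k ω => a * (e j k ω * X j k ω) with hh
  have hem : ∀ j k, Measurable (e j k) := fun j k => (he j k).1
  have hm : ∀ j k, Measurable (h j k) := fun j k => ((hem j k).mul (hXm j k)).const_mul a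
  have hind : iIndepFun (fun i : Fin p × Fin n => h i.1 i.2) μ :=
    (iIndepFun_pair (fun i : Fin p × Fin n => hem i.1 i.2) (fun i => hXm i.1 i.2) hei hXi heX).comp
      (fun _ w => a * (w.1 * w.2)) fun _ => (measurable_fst.mul measurable_snd).const_mul a
  have heX1 : ∀ j k, IndepFun (e j k) (X j k) μ := fun j k =>
    heX.comp (measurable_pi_apply (j, k)) (measurable_pi_apply (j, k))
  have h4 : ∀ j k, MemLp (h j k) 4 μ := fun j k => memLp_sparse_entry (he j k) (hX4 j k) (hXm j k) a
  have h0 : ∀ j k, ∫ ω, h j k ω ∂μ = 0 := fun j k => by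
    have := integral_sparse_entry_pow (he j k) (hXm j k) (heX1 j k) a one_ne_zero
    simpa only [pow_one, hX0, mul_zero] using this
  have h2 : ∀ j k, ∫ ω, h j k ω ^ 2 ∂μ = (n : ℝ)⁻¹ := fun j k => by
    have h5 := hX2 j k
    simp only [sq_abs] at h5
    rw [integral_sparse_entry_pow (he j k) (hXm j k) (heX1 j k) a two_ne_zero, h5, ha2]
    field_simp
  have hK : ∀ j k, ∫ ω, h j k ω ^ 4 ∂μ ≤ M / (n * q) / n := fun j k => by
    have e4 : ∀ ω, X j k ω ^ 4 = |X j k ω| ^ 4 := fun ω => (Even.pow_abs (by decide) _).symm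
    rw [integral_sparse_entry_pow (he j k) (hXm j k) (heX1 j k) a four_ne_zero, ha4]
    simp only [e4]
    calc 1 / (n * q) ^ 2 * (q * ∫ ω, |X j k ω| ^ 4 ∂μ) ≤ 1 / (n * q) ^ 2 * (q * M) := by
          gcongr; exact hM j k
      _ = _ := by field_simp
  have hM1 : 1 ≤ M := (one_le_fourth_moment (hX4 ⟨0, hp⟩ ⟨0, hn⟩) (hX2 _ _)).trans (hM _ _)
  have hq1 : q ≤ 1 := bernoulli_param_le_one (he ⟨0, hp⟩ ⟨0, hn⟩)
  have hκ : (n : ℝ)⁻¹ ≤ M / (n * q) := by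
    rw [inv_eq_one_div, div_le_div_iff₀ hn' (by positivity)]
    nlinarith [mul_le_mul_of_nonneg_left (hq1.trans hM1) hn'.le]
  set π : Fin n → Measure (Fin p → ℝ) := fun k => μ.map fun ω i => h i k ω with hπ
  have hcm : ∀ k, Measurable fun ω i => h i k ω := fun k => measurable_pi_iff.2 fun i => hm i k
  have hπp : ∀ k, IsProbabilityMeasure (π k) := fun k =>
    Measure.isProbabilityMeasure_map (hcm k).aemeasurable
  have hQ : ∀ k, QuadraticConcentration (π k) (n : ℝ)⁻¹ (8 * (M / (n * q)) / n) := fun k => by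
    have := quadraticConcentration_map (μ := μ) (c := fun i => h i k) (fun i => hm i k)
      (fun i => h4 i k) (hind.precomp (g := fun i => (i, k)) fun a b hab => by simpa using hab)
      (fun i => h0 i k) (fun i => h2 i k) (fun i => hK i k) (by
        rw [sq, ← div_eq_mul_inv]; gcongr)
    rwa [← mul_div_assoc] at this
  obtain ⟨ν, hν, hν0, hνI, hνS⟩ := exists_mean_spectral_measure hp (Measure.pi π)
  have hmain := abs_cdf_sub_mpCDF_le_of_colTrace (π := π) (y := (p : ℝ) / n) hn
    (by rw [Fintype.card_fin]) (by positivity)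
    (div_le_one_of_le₀ (by exact_mod_cast hpn) hn'.le) hQ
    (hκ.trans (by linarith [show 0 ≤ M / (n * q) from le_trans (by positivity) hκ])) ν hν0 hνS x
  have hE : ∫ ω, gramESD (sparseMatrix q (fun j k => e j k ω) (fun j k => X j k ω)) x ∂μ
      = ν.real (Set.Iic x) := by
    rw [hνI, ← map_columns_eq_pi hm hind, integral_map
      (measurable_pi_iff.2 hcm).aemeasurable (measurable_gramESD x).aestronglyMeasurable]
    rfl
  rw [hE]
  exact hmain

end Sparse

theorem theorem1p3 (θ : ℝ) (hθ : 0 < θ) :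
    ∃ C : ℝ, 0 < C ∧
      ∀ (p : ℕ → ℕ) (q : ℕ → ℝ)
        (Ω : ℕ → Type*) [∀ n, MeasurableSpace (Ω n)]
        (μ : ∀ n, Measure (Ω n)) [∀ n, IsProbabilityMeasure (μ n)]
        (X e : ∀ n, Fin (p n) → Fin n → Ω n → ℝ),
        -- the dimension ratio `y = p / n` satisfies `θ < y ≤ 1`
        (∀ n, 1 ≤ n → θ < (p n : ℝ) / n ∧ (p n : ℝ) / n ≤ 1) →
        -- the entries are independent, centred, of variance one, with finite fourth moment
        (∀ n j k, Measurable (X n j k)) →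
        (∀ n, iIndepFun (fun i : Fin (p n) × Fin n => X n i.1 i.2) (μ n)) →
        (∀ n j k, MemLp (X n j k) 4 (μ n)) →
        (∀ n j k, ∫ ω, X n j k ω ∂(μ n) = 0) →
        (∀ n j k, ∫ ω, |X n j k ω| ^ 2 ∂(μ n) = 1) →
        -- the independent Bernoulli variables, independent of the entries
        (∀ n, 1 ≤ n → 0 < q n) →
        (∀ n j k, IsBernoulliVar (μ n) (e n j k) (q n)) →
        (∀ n, iIndepFun (fun i : Fin (p n) × Fin n => e n i.1 i.2) (μ n)) →
        (∀ n, IndepFun (fun ω (i : Fin (p n) × Fin n) => e n i.1 i.2 ω)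
          (fun ω (i : Fin (p n) × Fin n) => X n i.1 i.2 ω) (μ n)) →
        Tendsto (fun n : ℕ => (n : ℝ) * q n) atTop atTop →
        ∀ n, 1 ≤ n →
          (⨆ x : ℝ, |(∫ ω, gramESD (sparseMatrix (q n) (fun j k => e n j k ω)
              (fun j k => X n j k ω)) x ∂(μ n)) - mpCDF ((p n : ℝ) / n) x|)
            ≤ C * (⨆ i : Fin (p n) × Fin n, ∫ ω, |X n i.1 i.2 ω| ^ 4 ∂(μ n)) ^ (1 / 2 : ℝ)
                * ((n : ℝ) * q n) ^ (-(1 / 2) : ℝ) := by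
  -- The numerator is 3·2473, with 3 bounding √8, and 1/y ≤ 1/θ.
  refine ⟨7419 / θ, by positivity, ?_⟩
  intro p q Ω _ μ _ X e hy hXm hXi hX4 hX0 hX2 hq he hei heX _ n hn
  have hn' : (0 : ℝ) < n := by exact_mod_cast hn
  obtain ⟨hy1, hy2⟩ := hy n hn
  have hpos : 0 < (p n : ℝ) / n := hθ.trans hy1
  have hp : 0 < p n := by
    rcases Nat.eq_zero_or_pos (p n) with h | h
    · rw [h] at hpos; simp at hpos
    · exact h
  have hpn : p n ≤ n := by
    rw [div_le_one hn'] at hy2; exact_mod_cast hy2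
  have hqn := hq n hn
  set M := ⨆ i : Fin (p n) × Fin n, ∫ ω, |X n i.1 i.2 ω| ^ 4 ∂(μ n) with hMdef
  have hM : ∀ j k, ∫ ω, |X n j k ω| ^ 4 ∂(μ n) ≤ M := fun j k =>
    le_ciSup (f := fun i : Fin (p n) × Fin n => ∫ ω, |X n i.1 i.2 ω| ^ 4 ∂(μ n))
      (Set.finite_range _).bddAbove (j, k)
  have hM0 : 0 ≤ M := le_trans (integral_nonneg fun ω => by positivity) (hM ⟨0, hp⟩ ⟨0, hn⟩)
  refine ciSup_le fun x => ?_
  refine (abs_integral_gramESD_sparse_sub_mpCDF_le hp hn hpn hqn (hXm n) (hXi n) (hX4 n) (hX0 n)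
    (hX2 n) hM (he n) (hei n) (heX n) x).trans ?_
  have hnq : 0 < (n : ℝ) * q n := by positivity
  have h8 : √8 ≤ 3 := by rw [Real.sqrt_le_left (by norm_num)]; norm_num
  rw [Real.sqrt_mul (by norm_num), Real.sqrt_div hM0, Real.rpow_neg hnq.le, ← Real.sqrt_eq_rpow,
    ← Real.sqrt_eq_rpow]
  calc 2473 / ((p n : ℝ) / n) * (√8 * (√M / √(n * q n)))
      ≤ 2473 / θ * (3 * (√M / √(n * q n))) := by gcongr
    _ = 7419 / θ * √M * (√(n * q n))⁻¹ := by ring
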